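/- Let $X$ be a compact connected complex manifold of dimension $n$ with a holomorphic action of $T_{\mathbb C}=(\mathbb C^*)^r$, and let $T=(S^1)^r\subset T_{\mathbb C}$ be the compact torus (for example, $X$ Fano and $T$ a maximal compact torus of $\mathrm{Aut}(X)$). Let $\omega_0$ be a $T$-invariant Kähler form on $X$ in $2\pi c_1(X)$ with Ricci potential $\rho_0\in C^\infty(X,\mathbb R)$, i.e. $\mathrm{Ric}(\omega_0)-\omega_0=\sqrt{-1}\partial\bar\partial\rho_0$ and $\int_X(e^{\rho_0}-1)\,\omega_0^n=0$ (so $X$ is Fano). Put $V=\int_X\omega_0^n$, $\omega_\phi=\omega_0+\sqrt{-1}\partial\bar\partial\phi$, and let $\mathcal H^T$ be the set of $T$-invariant $\phi\in C^\infty(X,\mathbb R)$ with $\omega_\phi>0$. For $\phi\in\mathcal H^T$ let $\mu_\phi=(\theta_1,\dots,\theta_r)\colon X\to\mathbb R^r$ be the moment map: with $\xi_\alpha$ the holomorphic vector field generating the action of the $\alpha$-th factor of $T_{\mathbb C}$, $i_{\xi_\alpha}\omega_\phi=\sqrt{-1}\,\bar\partial\theta_\alpha$ and $\int_X\theta_\alpha\,\omega_\phi^n=0$.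 Its image $P$ does not depend on $\phi$. Let $g\colon P\to\mathbb R$ be positive and smooth (i.e. the restriction of a smooth function on a neighbourhood of $P$), put $g_\phi=g\circ\mu_\phi$, and assume the normalization $\int_X(g_0-1)\,\omega_0^n=0$. Define on $\mathcal H^T$ $$E(\phi)=\frac1{(n+1)V}\sum_{i=0}^n\int_X\phi\,\omega_0^i\wedge\omega_\phi^{n-i},\qquad E_g(\phi)=\int_0^1\frac1V\int_X\phi\,g_{s\phi}\,\omega_{s\phi}^n\,ds,$$ $$I_g(\phi)=\frac1V\int_X\phi\,(g_0\omega_0^n-g_\phi\omega_\phi^n),\qquad J_g(\phi)=\frac1V\int_X\phi\,g_0\omega_0^n-E_g(\phi),$$ $$M(\phi)=\frac1V\int_X\log\frac{\omega_\phi^n}{\omega_0^n}\,\omega_\phi^n+\frac1V\int_X\phi\,\omega_\phi^n-E(\phi)+\frac1V\int_X\rho_0(\omega_0^n-\omega_\phi^n),\qquad M_g=M+E-E_g .$$ For $\sigma\in T_{\mathbb C}$ and $\phi\in\mathcal H^T$ there is a function $\sigma[\phi]\in\mathcal H^T$, unique up to an additive constant, with $\sigma^*\omega_\phi=\omega_0+\sqrt{-1}\partial\bar\partial\,\sigma[\phi]$.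 Assume that $M_g$ is bounded from below on $\mathcal H^T$, and let $\phi_t\in\mathcal H^T$ be a solution of $$g_{\phi_t}\,\omega_{\phi_t}^n=e^{-t\phi_t+\rho_0}\,\omega_0^n$$ for some $t\in[0,1)$. Then $$\inf_{\sigma\in T_{\mathbb C}}(I_g-J_g)(\sigma[\phi_t])=(I_g-J_g)(\phi_t).$$ -/

import Mathlib

open MeasureTheory Set
open scoped Manifold ContDiff ComplexOrder

namespace GSoliton

noncomputable section

/-! ### Calculus on `ℂⁿ` -/

/-- The Wirtinger derivative `∂f/∂zᵢ = ½ (∂f/∂xᵢ - √-1 ∂f/∂yᵢ)`. -/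
def dz {n : ℕ} (i : Fin n) (f : (Fin n → ℂ) → ℂ) (z : Fin n → ℂ) : ℂ :=
  (fderiv ℝ f z (Pi.single i 1) - Complex.I * fderiv ℝ f z (Pi.single i Complex.I)) / 2

/-- The Wirtinger derivative `∂f/∂z̄ⱼ = ½ (∂f/∂xⱼ + √-1 ∂f/∂yⱼ)`. -/
def dzbar {n : ℕ} (j : Fin n) (f : (Fin n → ℂ) → ℂ) (z : Fin n → ℂ) : ℂ :=
  (fderiv ℝ f z (Pi.single j 1) + Complex.I * fderiv ℝ f z (Pi.single j Complex.I)) / 2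

/-- The complex Hessian `(∂²f/∂zᵢ∂z̄ⱼ)ᵢⱼ` of a real function. -/
def complexHessian {n : ℕ} (f : (Fin n → ℂ) → ℝ) (z : Fin n → ℂ) : Matrix (Fin n) (Fin n) ℂ :=
  Matrix.of fun i j => dz i (dzbar j fun w => (f w : ℂ)) z

/-- The complex Jacobian matrix `(∂τₖ/∂zᵢ)ₖᵢ` of a holomorphic map. -/
def complexJacobian {n : ℕ} (τ : (Fin n → ℂ) → (Fin n → ℂ)) (z : Fin n → ℂ) :
    Matrix (Fin n) (Fin n) ℂ :=
  Matrix.of fun k i => fderiv ℂ τ z (Pi.single i 1) k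

/-! ### Forms of type (1,1) on a complex manifold -/

/-- The local coefficients of a (1,1)-form `√-1 ∑ hᵢⱼ dzᵢ ∧ dz̄ⱼ`: the matrix `h e z` belongs to
the chart `e` and the point with coordinates `z ∈ e.target`.
Only charts of the atlas and points of `e.target` are ever used. -/
abbrev CoeffForm (n : ℕ) (X : Type*) [TopologicalSpace X] : Type _ :=
  OpenPartialHomeomorph X (Fin n → ℂ) → (Fin n → ℂ) → Matrix (Fin n) (Fin n) ℂ

section Forms

variable {n : ℕ} {X : Type*} [TopologicalSpace X] [ChartedSpace (Fin n → ℂ) X]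

/-- Smooth real functions on the complex manifold `X`. -/
def IsSmooth (n : ℕ) {X : Type*} [TopologicalSpace X] [ChartedSpace (Fin n → ℂ) X]
    (φ : X → ℝ) : Prop :=
  ContMDiff 𝓘(ℝ, Fin n → ℂ) 𝓘(ℝ, ℝ) ∞ φ

/-- `h' = σ^* h` for a holomorphic map `σ`, in local coordinates:
`h'ᵢⱼ = ∑ₖₗ (∂τₖ/∂zᵢ) hₖₗ(τ) conj (∂τₗ/∂zⱼ)` where `τ` is `σ` read in charts. -/
def IsPullback (σ : X → X) (h h' : CoeffForm n X) : Prop :=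
  ∀ e ∈ atlas (Fin n → ℂ) X, ∀ e' ∈ atlas (Fin n → ℂ) X, ∀ z ∈ e.target,
    σ (e.symm z) ∈ e'.source →
      let τ : (Fin n → ℂ) → (Fin n → ℂ) := fun w => e' (σ (e.symm w))
      h' e z = (complexJacobian τ z).transpose * h e' (τ z) * (complexJacobian τ z).map star

/-- `h` is positive definite (as a Hermitian form) at every point. -/
def IsPositive (h : CoeffForm n X) : Prop :=
  ∀ e ∈ atlas (Fin n → ℂ) X, ∀ z ∈ e.target, (h e z).PosDef

/-- `h` is a Kähler form: the coefficients are smooth, transform as those of a (1,1)-form,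
are Hermitian and positive definite, and the form is closed. -/
structure IsKahlerForm (h : CoeffForm n X) : Prop where
  smooth : ∀ e ∈ atlas (Fin n → ℂ) X, ∀ i j, ContDiffOn ℝ ∞ (fun z => h e z i j) e.target
  compatible : IsPullback id h h
  positive : IsPositive h
  closed : ∀ e ∈ atlas (Fin n → ℂ) X, ∀ z ∈ e.target, ∀ i j k,
    dz k (fun w => h e w i j) z = dz i (fun w => h e w k j) z

/-- The form `√-1 ∂∂̄ φ`. -/
def ddbar (φ : X → ℝ) : CoeffForm n X :=
  fun e z => complexHessian (fun w => φ (e.symm w)) z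

/-- The form `ω_φ = ω₀ + √-1 ∂∂̄ φ`. -/
def perturb (ω₀ : CoeffForm n X) (φ : X → ℝ) : CoeffForm n X :=
  fun e z => ω₀ e z + ddbar φ e z

/-- The Ricci form `-√-1 ∂∂̄ log det h`. -/
def ricciForm (h : CoeffForm n X) : CoeffForm n X :=
  fun e z => -complexHessian (fun w => Real.log (h e w).det.re) z

/-! ### Integration -/

/-- The measure on `X` given by the local densities `d e` with respect to Lebesgue measure in the
charts `e`. (If the densities are those of a non-negative top degree form, each chart contributes
the restriction of one and the same measure to the domain of the chart, and the supremum is this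
measure.) -/
def densityMeasure [MeasurableSpace X]
    (d : OpenPartialHomeomorph X (Fin n → ℂ) → (Fin n → ℂ) → ℝ) : Measure X :=
  ⨆ e ∈ atlas (Fin n → ℂ) X,
    ((volume.restrict e.target).withDensity fun z => ENNReal.ofReal (d e z)).map e.symm

/-- The measure `ωⁿ`, whose local density is `2ⁿ n! det h`. -/
def vol [MeasurableSpace X] (h : CoeffForm n X) : Measure X :=
  densityMeasure fun e z => 2 ^ n * (n.factorial : ℝ) * (h e z).det.re

/-- The measure `h₁ⁱ ∧ h₂ⁿ⁻ⁱ`, read off from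
`(s h₁ + h₂)ⁿ = ∑ᵢ (n choose i) sⁱ h₁ⁱ ∧ h₂ⁿ⁻ⁱ`. -/
def mixedVol [MeasurableSpace X] (h₁ h₂ : CoeffForm n X) (i : ℕ) : Measure X :=
  densityMeasure fun e z => 2 ^ n * (n.factorial : ℝ) *
    (((Polynomial.X : Polynomial ℂ) • (h₁ e z).map Polynomial.C +
      (h₂ e z).map Polynomial.C).det.coeff i).re / (n.choose i : ℝ)

/-- The total volume `V = ∫_X ω₀ⁿ`. -/
def totalVol [MeasurableSpace X] (ω₀ : CoeffForm n X) : ℝ := (vol ω₀).real univ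

/-- `ρ` is the Ricci potential of the Kähler form `h`: `Ric(h) - h = √-1 ∂∂̄ ρ` and
`∫ (e^ρ - 1) hⁿ = 0`. The first condition contains `h ∈ 2π c₁(X)`. -/
structure IsRicciPotential [MeasurableSpace X] (h : CoeffForm n X) (ρ : X → ℝ) : Prop where
  smooth : IsSmooth n ρ
  eq : ∀ e ∈ atlas (Fin n → ℂ) X, ∀ z ∈ e.target, ricciForm h e z - h e z = ddbar ρ e z
  normalized : ∫ x, (Real.exp (ρ x) - 1) ∂(vol h) = 0

end Forms

/-! ### The torus `T = (S¹)^r` and its complexification `T_ℂ = (ℂˣ)^r` -/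

/-- The exponential map `ℂ^r → (ℂˣ)^r`. -/
def torusExp {r : ℕ} (w : Fin r → ℂ) : Fin r → ℂˣ :=
  fun α => Units.mk0 (Complex.exp (w α)) (Complex.exp_ne_zero _)

/-- The inclusion `(S¹)^r ⊆ (ℂˣ)^r`. -/
def compactTorus {r : ℕ} (u : Fin r → Circle) : Fin r → ℂˣ :=
  fun α => Circle.toUnits (u α)

/-- The action of `(ℂˣ)^r` on `X` is holomorphic; as the exponential map is a holomorphic
covering, this can be tested on `ℂ^r × X`. -/
def IsHolomorphicAction (r n : ℕ) (X : Type*) [TopologicalSpace X] [ChartedSpace (Fin n → ℂ) X]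
    [MulAction (Fin r → ℂˣ) X] : Prop :=
  ContMDiff (𝓘(ℂ, Fin r → ℂ).prod 𝓘(ℂ, Fin n → ℂ)) 𝓘(ℂ, Fin n → ℂ) ω
    fun p : (Fin r → ℂ) × X => torusExp p.1 • p.2

section Torus

variable {n : ℕ} {X : Type*} [TopologicalSpace X] [ChartedSpace (Fin n → ℂ) X]

/-- The `i`-th component, in the chart `e`, of the holomorphic vector field `ξ_α` generating the
action of the `α`-th factor of `(ℂˣ)^r`. -/
def generator (r : ℕ) [MulAction (Fin r → ℂˣ) X] (α : Fin r)
    (e : OpenPartialHomeomorph X (Fin n → ℂ)) (z : Fin n → ℂ) (i : Fin n) : ℂ :=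
  deriv (fun w : ℂ => e (torusExp (Pi.single α w) • e.symm z) i) 0

variable (r : ℕ) [MulAction (Fin r → ℂˣ) X]

/-- The form `h` is invariant under the compact torus. -/
def IsInvariantForm (h : CoeffForm n X) : Prop :=
  ∀ u : Fin r → Circle, IsPullback (fun x => compactTorus u • x) h h

/-- The space `ℋ(X, ω₀)^T` of torus-invariant Kähler potentials. -/
structure IsPotential (ω₀ : CoeffForm n X) (φ : X → ℝ) : Prop where
  smooth : IsSmooth n φ
  positive : IsPositive (perturb ω₀ φ)
  invariant : ∀ (u : Fin r → Circle) (x : X), φ (compactTorus u • x) = φ x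

variable {r}

/-- `ψ` is (a choice of) `σ[φ]`, i.e. `σ^* ω_φ = ω₀ + √-1 ∂∂̄ ψ`. -/
structure IsTranslate (ω₀ : CoeffForm n X) (σ : Fin r → ℂˣ) (φ ψ : X → ℝ) : Prop where
  potential : IsPotential r ω₀ ψ
  eq : IsPullback (fun x => σ • x) (perturb ω₀ φ) (perturb ω₀ ψ)

variable [MeasurableSpace X]

/-- `θ` is the normalized Hamilton function of `ξ_α` with respect to `h`:
`i_{ξ_α} h = √-1 ∂̄ θ` and `∫ θ hⁿ = 0`. -/
structure IsHamiltonian (h : CoeffForm n X) (α : Fin r) (θ : X → ℝ) : Prop where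
  smooth : IsSmooth n θ
  eq : ∀ e ∈ atlas (Fin n → ℂ) X, ∀ z ∈ e.target, ∀ j,
    ∑ i, generator r α e z i * h e z i j = dzbar j (fun w => (θ (e.symm w) : ℂ)) z
  normalized : ∫ x, θ x ∂(vol h) = 0

variable (r)

/-- The moment map `μ = (θ₁, …, θ_r)`; the normalized Hamilton functions are unique, and
they exist for the forms `ω_φ` considered here. -/
def momentMap (h : CoeffForm n X) (x : X) : Fin r → ℝ :=
  fun α => Classical.epsilon (fun θ : X → ℝ => IsHamiltonian h α θ) x

/-- The moment polytope `P`, the image of the moment map. -/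
def momentPolytope (h : CoeffForm n X) : Set (Fin r → ℝ) := range (momentMap r h)

/-! ### Energy functionals -/

variable (ω₀ : CoeffForm n X)

/-- The integral `∫_X f g_φ ω_φⁿ`, where `g_φ = g ∘ μ_φ`. -/
def gIntegral (g : (Fin r → ℝ) → ℝ) (φ f : X → ℝ) : ℝ :=
  ∫ x, f x * g (momentMap r (perturb ω₀ φ) x) ∂(vol (perturb ω₀ φ))

/-- The `g`-twisted Monge-Ampère energy: the primitive, vanishing at `0`, of the one-form
`u ↦ V⁻¹ ∫ u g_φ ω_φⁿ` on the space of potentials, integrated along the segment from `0` to `φ`. -/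
def energyG (g : (Fin r → ℝ) → ℝ) (φ : X → ℝ) : ℝ :=
  ∫ s in (0 : ℝ)..1, (totalVol ω₀)⁻¹ * gIntegral r ω₀ g (fun x => s * φ x) φ

/-- `I_g(φ) = V⁻¹ ∫ φ (g₀ ω₀ⁿ - g_φ ω_φⁿ)`. -/
def functionalI (g : (Fin r → ℝ) → ℝ) (φ : X → ℝ) : ℝ :=
  (totalVol ω₀)⁻¹ *
    ((∫ x, φ x * g (momentMap r ω₀ x) ∂(vol ω₀)) - gIntegral r ω₀ g φ φ)

/-- `J_g(φ) = V⁻¹ ∫ φ g₀ ω₀ⁿ - E_g(φ)`. -/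
def functionalJ (g : (Fin r → ℝ) → ℝ) (φ : X → ℝ) : ℝ :=
  (totalVol ω₀)⁻¹ * (∫ x, φ x * g (momentMap r ω₀ x) ∂(vol ω₀)) - energyG r ω₀ g φ

end Torus

section Mabuchi

variable {n : ℕ} {X : Type*} [TopologicalSpace X] [ChartedSpace (Fin n → ℂ) X]
  [MeasurableSpace X] (ω₀ : CoeffForm n X)

/-- The Monge-Ampère energy
`E(φ) = ((n + 1) V)⁻¹ ∑_{i = 0}^n ∫ φ ω₀ⁱ ∧ ω_φⁿ⁻ⁱ`. -/
def energy (φ : X → ℝ) : ℝ :=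
  (((n : ℝ) + 1) * totalVol ω₀)⁻¹ *
    ∑ i ∈ Finset.range (n + 1), ∫ x, φ x ∂(mixedVol ω₀ (perturb ω₀ φ) i)

/-- The Monge-Ampère probability measure `MA(φ) = V⁻¹ ω_φⁿ`. -/
def measureMA (φ : X → ℝ) : Measure X :=
  ENNReal.ofReal (totalVol ω₀)⁻¹ • vol (perturb ω₀ φ)

/-- The relative entropy `∫ log (dμ/dν) dμ`. -/
def entropy (μ ν : Measure X) : ℝ := ∫ x, llr μ ν x ∂μ

/-- The Mabuchi functional
`M(φ) = Ent(MA(φ) | MA(0)) + V⁻¹ ∫ φ ω_φⁿ - E(φ) + V⁻¹ ∫ ρ₀ (ω₀ⁿ - ω_φⁿ)`. -/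
def mabuchi (ρ₀ φ : X → ℝ) : ℝ :=
  entropy (measureMA ω₀ φ) (measureMA ω₀ 0)
    + (totalVol ω₀)⁻¹ * (∫ x, φ x ∂(vol (perturb ω₀ φ))) - energy ω₀ φ
    + (totalVol ω₀)⁻¹ * ((∫ x, ρ₀ x ∂(vol ω₀)) - ∫ x, ρ₀ x ∂(vol (perturb ω₀ φ)))

/-- The `g`-Mabuchi functional `M_g = M + E - E_g`. -/
def mabuchiG (r : ℕ) [MulAction (Fin r → ℂˣ) X] (g : (Fin r → ℝ) → ℝ) (ρ₀ φ : X → ℝ) : ℝ :=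
  mabuchi ω₀ ρ₀ φ + energy ω₀ φ - energyG r ω₀ g φ

/-- `φ` is a torus-invariant Kähler potential that solves
`g_φ ω_φⁿ = e^{-tφ + ρ₀} ω₀ⁿ`. -/
structure SolvesContinuity (r : ℕ) [MulAction (Fin r → ℂˣ) X] (g : (Fin r → ℝ) → ℝ)
    (ρ₀ : X → ℝ) (t : ℝ) (φ : X → ℝ) : Prop where
  potential : IsPotential r ω₀ φ
  eq : ∀ e ∈ atlas (Fin n → ℂ) X, ∀ z ∈ e.target,
    g (momentMap r (perturb ω₀ φ) (e.symm z)) * (perturb ω₀ φ e z).det.re =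
      Real.exp (-t * φ (e.symm z) + ρ₀ (e.symm z)) * (ω₀ e z).det.re

end Mabuchi

end

end GSoliton

open GSoliton

/-! Put Ω = e^{ρ₀} ω₀ⁿ. The Ricci potential equation says -√-1∂∂̄ log Ω = ω₀, so a potential φ is
the same thing as the volume form e^{-φ} Ω, a metric on -K_X with curvature ω_φ, and the torus acts
on these by pullback. This singles out the representative σ[φ] = φ∘σ - c_σ with c_σ = log(σ^*Ω/Ω)
(`translate`, `logCocycle`). Since c is a cocycle, this is a genuine action of a commutative group.

The moment map of σ[φ] is μ_φ∘σ. Hence E_g(σ[φ]) = E_g(φ) + E_g(σ[0]), and σ ↦ E_g(σ[0]) is a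
homomorphism to ℝ. Up to a constant, the rest of M_g is the mean of log(ω_φⁿ / e^{-φ}Ω) against
ω_φⁿ, which is invariant, so M_g drops by E_g(σ[0]). A lower bound for M_g therefore kills the
homomorphism (`gEnergy_translate_zero`).

Write dm = g_φ ω_φⁿ. As V(I_g - J_g)(φ) = V E_g(φ) - ∫φ dm, passing from φ to σ[φ] changes V(I_g -
J_g) by -∫c_{σ⁻¹} dm. So it suffices that A(σ) = ∫c_σ dm is ≤ 0 for every σ. Let B(σ) = ∫(φ∘σ - φ)
dm. Concavity of E_g together with its invariance gives A ≤ B (`gWeight_logCocycle_le`). The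
equation says dm = e^{-tφ}Ω, and Jensen's inequality gives A ≤ tB (`integral_logCocycle_le_mul`).
Along s ↦ exp(sb) with b real, both inequalities are equalities at s = 0, so the derivatives there
satisfy A' = B' and A' = tB'; as t ≠ 1, A' = 0. Finally s ↦ c_{exp(sb)} is concave
(`concaveOn_logCocycle`), so A ≤ 0 on the real part of the torus, and the compact part does not
change c.

The geometry of the action comes from one computation, `translate_local`: the function (w, x) ↦
exp(w)[φ](x) on ℂ^r × X has Levi form equal to the pullback of ω_φ under the action map minus ω₀.
The X-directions give σ^*ω_φ = ω_{σ[φ]}, the mixed directions the Hamilton functions, the torus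
directions the concavity. The variational formulas rest on integration by parts (`stokes`), which
comes from the Piola identity for the adjugate of a closed form. -/

namespace GSoliton

noncomputable section

set_option linter.unusedSectionVars false

/-! ### The Levi form -/

section Levi

variable {E F : Type*} [NormedAddCommGroup E] [NormedSpace ℝ E] [NormedSpace ℂ E]
  [IsScalarTower ℝ ℂ E] [NormedAddCommGroup F] [NormedSpace ℝ F] [NormedSpace ℂ F]
  [IsScalarTower ℝ ℂ F]

/-- The Levi form `∂_a ∂̄_b f` of a real function on a complex vector space. -/
def levi (f : E → ℝ) (z a b : E) : ℂ :=
  (((fderiv ℝ (fderiv ℝ f) z a b + fderiv ℝ (fderiv ℝ f) z (Complex.I • a) (Complex.I • b) : ℝ) : ℂ)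
    + Complex.I * ((fderiv ℝ (fderiv ℝ f) z a (Complex.I • b)
      - fderiv ℝ (fderiv ℝ f) z (Complex.I • a) b : ℝ) : ℂ)) / 4

theorem ContDiffAt.differentiableAt_fderiv {G : Type*} [NormedAddCommGroup G] [NormedSpace ℝ G]
    {f : E → G} {z : E} (hf : ContDiffAt ℝ 2 f z) :
    DifferentiableAt ℝ (fderiv ℝ f) z :=
  (hf.fderiv_right (m := 1) (by norm_num)).differentiableAt (by norm_num)

theorem levi_congr {f g : E → ℝ} {z : E} (h : f =ᶠ[nhds z] g) (a b : E) :
    levi f z a b = levi g z a b := by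
  unfold levi
  rw [h.fderiv.fderiv_eq]

theorem levi_add {f g : E → ℝ} {z : E} (hf : ContDiffAt ℝ 2 f z) (hg : ContDiffAt ℝ 2 g z)
    (a b : E) : levi (fun y => f y + g y) z a b = levi f z a b + levi g z a b := by
  have h1 : fderiv ℝ (fun y => f y + g y) =ᶠ[nhds z] fun y => fderiv ℝ f y + fderiv ℝ g y := by
    filter_upwards [hf.eventually (by simp), hg.eventually (by simp)] with y hy hy'
    exact fderiv_fun_add (hy.differentiableAt (by norm_num)) (hy'.differentiableAt (by norm_num))
  unfold levi
  rw [h1.fderiv_eq, fderiv_fun_add hf.differentiableAt_fderiv hg.differentiableAt_fderiv]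
  simp only [add_apply]
  push_cast
  ring

theorem levi_const_mul {f : E → ℝ} {z : E} (hf : ContDiffAt ℝ 2 f z) (c : ℝ)
    (a b : E) : levi (fun y => c * f y) z a b = c * levi f z a b := by
  have h1 : fderiv ℝ (fun y => c * f y) =ᶠ[nhds z] fun y => c • fderiv ℝ f y := by
    filter_upwards [hf.eventually (by simp)] with y hy
    exact fderiv_const_mul (hy.differentiableAt (by norm_num)) c
  unfold levi
  rw [h1.fderiv_eq, fderiv_fun_const_smul hf.differentiableAt_fderiv c]
  simp only [smul_apply, smul_eq_mul]
  push_cast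
  ring

theorem levi_sub {f g : E → ℝ} {z : E} (hf : ContDiffAt ℝ 2 f z) (hg : ContDiffAt ℝ 2 g z)
    (a b : E) : levi (fun y => f y - g y) z a b = levi f z a b - levi g z a b := by
  have h := levi_add hf (g := fun y => (-1) * g y) (contDiffAt_const.mul hg) a b
  rw [levi_const_mul hg] at h
  have e : (fun y => f y - g y) = fun y => f y + (-1) * g y := by ext; ring
  rw [e, h]
  push_cast; ring

theorem levi_const (c : ℝ) (z a b : E) : levi (fun _ => c) z a b = 0 := by
  simp [levi]

/-- The second-order chain rule. The last term involves the complex second derivative of τ and is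
therefore complex bilinear in (a, b), which is what makes it cancel in the Levi form. -/
theorem hasFDerivAt_fderiv_apply_comp {f : F → ℝ} {τ : E → F} {z : E}
    (hf : ContDiffAt ℝ 2 f (τ z)) (hτ : ContDiffAt ℂ 2 τ z) (a b : E) :
    fderiv ℝ (fderiv ℝ (f ∘ τ)) z a b =
      fderiv ℝ (fderiv ℝ f) (τ z) (fderiv ℂ τ z a) (fderiv ℂ τ z b) +
        fderiv ℝ f (τ z) (fderiv ℂ (fderiv ℂ τ) z a b) := by
  have hτ' : ContDiffAt ℝ 2 τ z := hτ.restrict_scalars ℝ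
  have hd : DifferentiableAt ℂ (fderiv ℂ τ) z :=
    (hτ.fderiv_right (m := 1) (by norm_num)).differentiableAt (by norm_num)
  have hfτ : ContDiffAt ℝ 2 (f ∘ τ) z := hf.comp z hτ'
  have e1 : fderiv ℝ (fderiv ℝ (f ∘ τ)) z a b = fderiv ℝ (fun y => fderiv ℝ (f ∘ τ) y b) z a := by
    rw [fderiv_clm_apply hfτ.differentiableAt_fderiv (differentiableAt_const b)]
    simp
  have e2 : (fun y => fderiv ℝ (f ∘ τ) y b) =ᶠ[nhds z]
      fun y => fderiv ℝ f (τ y) (fderiv ℂ τ y b) := by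
    filter_upwards [hτ.eventually (by simp), hτ.continuousAt.eventually (hf.eventually (by simp))]
      with y hy hy'
    have hy1 := hy.differentiableAt (by norm_num)
    rw [fderiv_comp y (hy'.differentiableAt (by norm_num)) (hy1.restrictScalars ℝ),
      hy1.fderiv_restrictScalars ℝ]
    rfl
  rw [e1, e2.fderiv_eq]
  have h1 : HasFDerivAt (fun y => fderiv ℝ f (τ y))
      ((fderiv ℝ (fderiv ℝ f) (τ z)).comp ((fderiv ℂ τ z).restrictScalars ℝ)) z :=
    hf.differentiableAt_fderiv.hasFDerivAt.comp z
      ((hτ.differentiableAt (by norm_num)).hasFDerivAt.restrictScalars ℝ)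
  have h2 : HasFDerivAt (fun y => fderiv ℂ τ y b)
      (((fderiv ℂ (fderiv ℂ τ) z).flip b).restrictScalars ℝ) z := by
    refine HasFDerivAt.restrictScalars ℝ ?_
    have := hd.hasFDerivAt.clm_apply (hasFDerivAt_const b z)
    simpa using this
  rw [(h1.clm_apply h2).fderiv]
  simp [add_comm]

/-- A complex bilinear T satisfies T(a, b) + T(ia, ib) = 0 and T(a, ib) = T(ia, b), so the term with
the second derivative of τ drops out. -/
theorem levi_comp {f : F → ℝ} {τ : E → F} {z : E}
    (hf : ContDiffAt ℝ 2 f (τ z)) (hτ : ContDiffAt ℂ 2 τ z) (a b : E) :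
    levi (fun y => f (τ y)) z a b = levi f (τ z) (fderiv ℂ τ z a) (fderiv ℂ τ z b) := by
  have key := hasFDerivAt_fderiv_apply_comp hf hτ
  change levi (f ∘ τ) z a b = _
  unfold levi
  rw [key, key, key, key]
  have hI : ∀ x : F, Complex.I • Complex.I • x = -x := fun x => by
    rw [smul_smul, Complex.I_mul_I, neg_one_smul]
  simp only [map_smul, smul_apply, hI, map_neg]
  push_cast
  ring

end Levi

/-! ### Sesquilinearity of the Levi form and pluriharmonic functions -/

section LeviAlgebra

variable {E : Type*} [NormedAddCommGroup E] [NormedSpace ℝ E] [NormedSpace ℂ E]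
  [IsScalarTower ℝ ℂ E]

theorem I_smul_I_smul (x : E) : Complex.I • Complex.I • x = -x := by
  rw [smul_smul, Complex.I_mul_I, neg_one_smul]

theorem complex_smul_eq (c : ℂ) (x : E) : c • x = c.re • x + c.im • Complex.I • x := by
  conv_lhs => rw [← Complex.re_add_im c]
  rw [add_smul, mul_smul]
  simp only [Complex.coe_smul]
  rw [← algebraMap_smul ℂ c.re x, ← algebraMap_smul ℂ c.im (Complex.I • x)]
  rfl

theorem levi_add_left (f : E → ℝ) (z a a' b : E) :
    levi f z (a + a') b = levi f z a b + levi f z a' b := by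
  simp only [levi, smul_add, map_add, add_apply]
  push_cast; ring

theorem levi_add_right (f : E → ℝ) (z a b b' : E) :
    levi f z a (b + b') = levi f z a b + levi f z a b' := by
  simp only [levi, smul_add, map_add]
  push_cast; ring

theorem levi_smul_left (f : E → ℝ) (z a b : E) (c : ℂ) :
    levi f z (c • a) b = c * levi f z a b := by
  have h1 : ∀ (x : ℝ) (a : E), levi f z (x • a) b = x * levi f z a b := fun x a => by
    have : Complex.I • x • a = x • Complex.I • a := smul_comm _ _ _
    simp only [levi, this, map_smul, smul_apply, smul_eq_mul]
    push_cast; ring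
  have h2 : levi f z (Complex.I • a) b = Complex.I * levi f z a b := by
    simp only [levi, I_smul_I_smul, map_neg, neg_apply]
    push_cast
    linear_combination (-(fderiv ℝ (fderiv ℝ f) z a (Complex.I • b) : ℂ)
      + fderiv ℝ (fderiv ℝ f) z (Complex.I • a) b) / 4 * Complex.I_sq
  rw [complex_smul_eq c a, levi_add_left, h1, h1, h2]
  conv_rhs => rw [← Complex.re_add_im c]
  ring

theorem levi_smul_right (f : E → ℝ) (z a b : E) (c : ℂ) :
    levi f z a (c • b) = star c * levi f z a b := by
  have h1 : ∀ (x : ℝ) (b : E), levi f z a (x • b) = x * levi f z a b := fun x b => by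
    have : Complex.I • x • b = x • Complex.I • b := smul_comm _ _ _
    simp only [levi, this, map_smul, smul_eq_mul]
    push_cast; ring
  have h2 : levi f z a (Complex.I • b) = - Complex.I * levi f z a b := by
    simp only [levi, I_smul_I_smul, map_neg]
    push_cast
    linear_combination ((fderiv ℝ (fderiv ℝ f) z a (Complex.I • b) : ℂ)
      - fderiv ℝ (fderiv ℝ f) z (Complex.I • a) b) / 4 * Complex.I_sq
  rw [complex_smul_eq c b, levi_add_right, h1, h1, h2]
  have : star c = (c.re : ℂ) - c.im * Complex.I := by
    apply Complex.ext <;> simp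
  rw [this]
  ring

theorem levi_conj_symm {f : E → ℝ} {z : E} (hf : ContDiffAt ℝ 2 f z) (a b : E) :
    levi f z b a = star (levi f z a b) := by
  have hs := hf.isSymmSndFDerivAt (by simp)
  simp only [levi]
  rw [hs b a, hs (Complex.I • b) (Complex.I • a), hs b (Complex.I • a), hs (Complex.I • b) a]
  simp only [star_div₀, star_add, star_mul', RCLike.star_def, Complex.conj_ofReal, Complex.conj_I]
  push_cast
  have : (starRingEnd ℂ) 4 = 4 := Complex.conj_ofNat 4
  rw [this]
  ring

theorem levi_re_comp {F : E → ℂ} {z : E} (hF : ContDiffAt ℂ 2 F z) (a b : E) :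
    levi (fun y => (F y).re) z a b = 0 := by
  rw [levi_comp (f := Complex.re) Complex.reCLM.contDiff.contDiffAt hF]
  have : fderiv ℝ Complex.re = fun _ => Complex.reCLM := by
    ext1 x; exact Complex.reCLM.fderiv
  simp [levi, this]

/-- Near z the function is a constant plus twice the real part of log(F / F z). Dividing by F z puts
the value at z equal to 1, where the principal branch is holomorphic. This is why Jacobian factors
do not contribute to curvature. -/
theorem levi_log_normSq {F : E → ℂ} {z : E} (hF : ContDiffAt ℂ 2 F z) (h0 : F z ≠ 0) (a b : E) :
    levi (fun y => Real.log (Complex.normSq (F y))) z a b = 0 := by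
  have hG : ContDiffAt ℂ 2 (fun y => Complex.log (F y / F z)) z := by
    have h1 : F z / F z ∈ Complex.slitPlane := by
      rw [div_self h0]; exact Complex.one_mem_slitPlane
    exact (Complex.contDiffAt_log h1).comp z (hF.div_const _)
  have h1 : (fun y => Real.log (Complex.normSq (F y))) =ᶠ[nhds z]
      fun y => Real.log (Complex.normSq (F z)) + 2 * (Complex.log (F y / F z)).re := by
    filter_upwards [hF.continuousAt.eventually_ne h0] with y hy
    rw [Complex.log_re, norm_div, Real.log_div (norm_ne_zero_iff.2 hy) (norm_ne_zero_iff.2 h0),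
      Complex.normSq_eq_norm_sq, Complex.normSq_eq_norm_sq, Real.log_pow, Real.log_pow]
    push_cast; ring
  have hG' : ContDiffAt ℝ 2 (fun y => (Complex.log (F y / F z)).re) z :=
    (Complex.reCLM.contDiff.contDiffAt).comp z (hG.restrict_scalars ℝ)
  rw [levi_congr h1, levi_add contDiffAt_const (contDiffAt_const.mul hG'), levi_const,
    levi_const_mul hG', levi_re_comp hG]
  simp

/-- The derivative `∂_a f` of a real function. -/
def wd (f : E → ℝ) (z a : E) : ℂ :=
  ((fderiv ℝ f z a : ℂ) - Complex.I * (fderiv ℝ f z (Complex.I • a) : ℂ)) / 2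

theorem wd_add_right (f : E → ℝ) (z a b : E) : wd f z (a + b) = wd f z a + wd f z b := by
  simp only [wd, smul_add, map_add]; push_cast; ring

theorem wd_smul_right (f : E → ℝ) (z a : E) (c : ℂ) : wd f z (c • a) = c * wd f z a := by
  have h1 : ∀ (x : ℝ) (a : E), wd f z (x • a) = x * wd f z a := fun x a => by
    have : Complex.I • x • a = x • Complex.I • a := smul_comm _ _ _
    simp only [wd, this, map_smul, smul_eq_mul]
    push_cast; ring
  have h2 : wd f z (Complex.I • a) = Complex.I * wd f z a := by
    simp only [wd, I_smul_I_smul, map_neg]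
    push_cast
    linear_combination (fderiv ℝ f z (Complex.I • a) : ℂ) / 2 * Complex.I_sq
  rw [complex_smul_eq c a, wd_add_right, h1, h1, h2]
  conv_rhs => rw [← Complex.re_add_im c]
  ring

theorem wd_comp {F : Type*} [NormedAddCommGroup F] [NormedSpace ℝ F] [NormedSpace ℂ F]
    [IsScalarTower ℝ ℂ F] {f : F → ℝ} {τ : E → F} {z : E} (hf : DifferentiableAt ℝ f (τ z))
    (hτ : DifferentiableAt ℂ τ z) (a : E) :
    wd (fun y => f (τ y)) z a = wd f (τ z) (fderiv ℂ τ z a) := by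
  have : fderiv ℝ (fun y => f (τ y)) z = (fderiv ℝ f (τ z)).comp ((fderiv ℂ τ z).restrictScalars ℝ) :=
    (hf.hasFDerivAt.comp z (hτ.hasFDerivAt.restrictScalars ℝ)).fderiv
  simp [wd, this]

end LeviAlgebra

/-! ### Wirtinger derivatives and the complex Hessian in coordinates -/

section Coordinates

variable {n : ℕ}

theorem single_I (i : Fin n) :
    (Pi.single i Complex.I : Fin n → ℂ) = Complex.I • Pi.single i (1 : ℂ) := by
  ext j; by_cases h : j = i
  · subst h; simp
  · simp [h]

theorem fderiv_ofReal {f : (Fin n → ℂ) → ℝ} {z : Fin n → ℂ} (hf : DifferentiableAt ℝ f z)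
    (a : Fin n → ℂ) : fderiv ℝ (fun w => (f w : ℂ)) z a = (fderiv ℝ f z a : ℂ) := by
  have := (Complex.ofRealCLM.hasFDerivAt.comp z hf.hasFDerivAt).fderiv
  have h2 : (Complex.ofRealCLM ∘ f) = fun w => (f w : ℂ) := rfl
  rw [h2] at this
  rw [this]; rfl

theorem dz_ofReal {f : (Fin n → ℂ) → ℝ} {z : Fin n → ℂ} (hf : DifferentiableAt ℝ f z)
    (i : Fin n) : dz i (fun w => (f w : ℂ)) z = wd f z (Pi.single i 1) := by
  rw [dz, fderiv_ofReal hf, fderiv_ofReal hf, single_I, wd]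

theorem dzbar_ofReal {f : (Fin n → ℂ) → ℝ} {z : Fin n → ℂ} (hf : DifferentiableAt ℝ f z)
    (i : Fin n) : dzbar i (fun w => (f w : ℂ)) z = star (wd f z (Pi.single i 1)) := by
  rw [dzbar, fderiv_ofReal hf, fderiv_ofReal hf, single_I, wd]
  simp

theorem sum_smul_single (a : Fin n → ℂ) : a = ∑ i, a i • (Pi.single i 1 : Fin n → ℂ) := by
  ext j; simp [Pi.single_apply]

theorem wd_eq_sum (f : (Fin n → ℂ) → ℝ) (z a : Fin n → ℂ) :
    wd f z a = ∑ i, a i * wd f z (Pi.single i 1) := by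
  have h := map_sum (AddMonoidHom.mk' (wd f z) (wd_add_right f z))
    (fun i => a i • (Pi.single i 1 : Fin n → ℂ)) Finset.univ
  simp only [AddMonoidHom.mk'_apply, ← sum_smul_single, wd_smul_right] at h
  exact h

/-- Bridge between the coordinate definition and the Levi form, whose behaviour under holomorphic
maps is already known. -/
theorem complexHessian_apply {f : (Fin n → ℂ) → ℝ} {z : Fin n → ℂ} (hf : ContDiffAt ℝ 2 f z)
    (i j : Fin n) : complexHessian f z i j = levi f z (Pi.single i 1) (Pi.single j 1) := by
  have h1 : dzbar j (fun w => (f w : ℂ)) =ᶠ[nhds z] fun w =>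
      ((fderiv ℝ f w (Pi.single j 1) : ℂ) +
        Complex.I * (fderiv ℝ f w (Complex.I • Pi.single j 1) : ℂ)) / 2 := by
    filter_upwards [hf.eventually (by simp)] with y hy
    have hy' := hy.differentiableAt (by norm_num)
    rw [dzbar, fderiv_ofReal hy', fderiv_ofReal hy', single_I]
  have hD := hf.differentiableAt_fderiv
  have h2 : ∀ b : Fin n → ℂ, HasFDerivAt (fun w => (fderiv ℝ f w b : ℂ))
      (Complex.ofRealCLM.comp ((fderiv ℝ (fderiv ℝ f) z).flip b)) z := fun b => by
    refine Complex.ofRealCLM.hasFDerivAt.comp z ?_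
    simpa using hD.hasFDerivAt.clm_apply (hasFDerivAt_const b z)
  have h3 := (((h2 (Pi.single j 1)).add ((h2 (Complex.I • Pi.single j 1)).const_mul Complex.I)).mul_const
    (2 : ℂ)⁻¹)
  simp only [← div_eq_mul_inv] at h3
  have h4 := (h3.congr_of_eventuallyEq h1).fderiv
  simp only [complexHessian, Matrix.of_apply, dz, levi]
  rw [h4, single_I]
  simp
  linear_combination (((fderiv ℝ (fderiv ℝ f) z (Complex.I • Pi.single i 1))
    (Complex.I • Pi.single j 1) : ℂ) / (-4)) * Complex.I_sq

theorem levi_eq_sum {f : (Fin n → ℂ) → ℝ} {z : Fin n → ℂ} (hf : ContDiffAt ℝ 2 f z)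
    (a b : Fin n → ℂ) :
    levi f z a b = ∑ i, ∑ j, a i * complexHessian f z i j * star (b j) := by
  have h1 := map_sum (AddMonoidHom.mk' (fun a => levi f z a b) fun a a' => levi_add_left f z a a' b)
    (fun i => a i • (Pi.single i 1 : Fin n → ℂ)) Finset.univ
  simp only [AddMonoidHom.mk'_apply, ← sum_smul_single, levi_smul_left] at h1
  rw [h1]
  refine Finset.sum_congr rfl fun i _ => ?_
  have h2 := map_sum (AddMonoidHom.mk' (fun b => levi f z (Pi.single i 1) b)
    fun a a' => levi_add_right f z _ a a')
    (fun i => b i • (Pi.single i 1 : Fin n → ℂ)) Finset.univ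
  simp only [AddMonoidHom.mk'_apply, ← sum_smul_single, levi_smul_right] at h2
  rw [h2, Finset.mul_sum]
  refine Finset.sum_congr rfl fun j _ => ?_
  rw [complexHessian_apply hf]; ring

theorem complexHessian_congr {f g : (Fin n → ℂ) → ℝ} {z : Fin n → ℂ} (h : f =ᶠ[nhds z] g) :
    complexHessian f z = complexHessian g z := by
  ext i j
  simp only [complexHessian, Matrix.of_apply, dz]
  have h1 : dzbar j (fun w => (f w : ℂ)) =ᶠ[nhds z] dzbar j (fun w => (g w : ℂ)) := by
    filter_upwards [h.eventually_nhds] with y hy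
    have : (fun w => (f w : ℂ)) =ᶠ[nhds y] fun w => (g w : ℂ) := hy.mono fun w hw => by simp [hw]
    simp only [dzbar, this.fderiv_eq]
  rw [h1.fderiv_eq]

theorem complexHessian_comp {f : (Fin n → ℂ) → ℝ} {τ : (Fin n → ℂ) → (Fin n → ℂ)} {z : Fin n → ℂ}
    (hf : ContDiffAt ℝ 2 f (τ z)) (hτ : ContDiffAt ℂ 2 τ z) :
    complexHessian (fun w => f (τ w)) z = (complexJacobian τ z).transpose *
      complexHessian f (τ z) * (complexJacobian τ z).map star := by
  ext i j
  have hc : ContDiffAt ℝ 2 (fun w => f (τ w)) z := hf.comp z (hτ.restrict_scalars ℝ)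
  rw [complexHessian_apply hc, levi_comp hf hτ, levi_eq_sum hf]
  simp only [Matrix.mul_apply, Matrix.transpose_apply, Matrix.map_apply, complexJacobian,
    Matrix.of_apply, Finset.sum_mul]
  exact Finset.sum_comm

theorem complexHessian_isHermitian {f : (Fin n → ℂ) → ℝ} {z : Fin n → ℂ} (hf : ContDiffAt ℝ 2 f z) :
    (complexHessian f z).IsHermitian := by
  ext i j
  rw [Matrix.conjTranspose_apply, complexHessian_apply hf, complexHessian_apply hf,
    levi_conj_symm hf]
  simp

theorem complexHessian_add {f g : (Fin n → ℂ) → ℝ} {z : Fin n → ℂ} (hf : ContDiffAt ℝ 2 f z)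
    (hg : ContDiffAt ℝ 2 g z) :
    complexHessian (fun w => f w + g w) z = complexHessian f z + complexHessian g z := by
  ext i j
  rw [Matrix.add_apply, complexHessian_apply (hf.add hg), complexHessian_apply hf,
    complexHessian_apply hg, levi_add hf hg]

theorem complexHessian_const_mul {f : (Fin n → ℂ) → ℝ} {z : Fin n → ℂ} (hf : ContDiffAt ℝ 2 f z)
    (c : ℝ) : complexHessian (fun w => c * f w) z = (c : ℂ) • complexHessian f z := by
  ext i j
  rw [Matrix.smul_apply, complexHessian_apply (contDiffAt_const.mul hf), complexHessian_apply hf,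
    levi_const_mul hf, smul_eq_mul]

theorem complexHessian_const (z : Fin n → ℂ) (c : ℝ) :
    complexHessian (fun _ => c) z = 0 := by
  ext i j
  have : dzbar j (fun _ : Fin n → ℂ => (c : ℂ)) = fun _ => 0 := by
    ext w; simp [dzbar]
  simp only [complexHessian, Matrix.of_apply, this]
  simp [dz]

theorem dz_comm {H : (Fin n → ℂ) → ℂ} {z : Fin n → ℂ} (hH : ContDiffAt ℝ 2 H z) (i k : Fin n) :
    dz k (dz i H) z = dz i (dz k H) z := by
  have hD := ContDiffAt.differentiableAt_fderiv hH
  have hs := hH.isSymmSndFDerivAt (by simp)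
  have h2 : ∀ b : Fin n → ℂ, HasFDerivAt (fun w => fderiv ℝ H w b)
      ((fderiv ℝ (fderiv ℝ H) z).flip b) z := fun b => by
    simpa using hD.hasFDerivAt.clm_apply (hasFDerivAt_const b z)
  have h3 : ∀ i, fderiv ℝ (dz i H) z = _ := fun i =>
    (((h2 (Pi.single i 1)).sub ((h2 (Pi.single i Complex.I)).const_mul Complex.I)).mul_const
      (2 : ℂ)⁻¹).fderiv
  simp only [dz.eq_1 _ (dz _ H), h3]
  simp only [smul_apply, sub_apply, ContinuousLinearMap.flip_apply, smul_eq_mul]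
  rw [hs (Pi.single k 1) (Pi.single i 1), hs (Pi.single k 1) (Pi.single i Complex.I),
    hs (Pi.single k Complex.I) (Pi.single i 1), hs (Pi.single k Complex.I) (Pi.single i Complex.I)]
  ring

end Coordinates

/-! ### Derivatives of determinants and adjugates -/

section MatrixCalculus

variable {n : ℕ} {E : Type*} [NormedAddCommGroup E] [NormedSpace ℝ E]

/-- The determinant as a continuous multilinear function of the rows. -/
def detRows (n : ℕ) : ContinuousMultilinearMap ℝ (fun _ : Fin n => Fin n → ℂ) ℂ where
  toFun M := Matrix.det (Matrix.of M)
  map_update_add' {inst} m i x y := by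
    obtain rfl : inst = instDecidableEqFin n := Subsingleton.elim _ _
    exact (Matrix.detRowAlternating (R := ℂ) (n := Fin n)).map_update_add m i x y
  map_update_smul' {inst} m i c x := by
    obtain rfl : inst = instDecidableEqFin n := Subsingleton.elim _ _
    have h := (Matrix.detRowAlternating (R := ℂ) (n := Fin n)).map_update_smul m i (c : ℂ) x
    have e : (c : ℂ) • x = c • x := by ext; simp
    rw [e] at h
    exact h
  cont := by
    change Continuous fun M : Fin n → Fin n → ℂ => Matrix.det (Matrix.of M)
    fun_prop

/-- Jacobi's formula: the determinant is multilinear in the rows, and replacing one row gives a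
cofactor expansion along it. -/
theorem hasFDerivAt_det {M : E → Matrix (Fin n) (Fin n) ℂ}
    {M' : Fin n → Fin n → E →L[ℝ] ℂ} {z : E}
    (hM : ∀ i j, HasFDerivAt (fun w => M w i j) (M' i j) z) :
    HasFDerivAt (fun w => (M w).det)
      (∑ i, ∑ j, (M z).adjugate j i • M' i j) z := by
  have h1 : HasFDerivAt (fun w => (fun i j => M w i j : Fin n → Fin n → ℂ))
      (ContinuousLinearMap.pi fun i => ContinuousLinearMap.pi fun j => M' i j) z :=
    hasFDerivAt_pi.2 fun i => hasFDerivAt_pi.2 fun j => hM i j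
  have h2 := ((detRows n).hasFDerivAt (fun i j => M z i j)).comp z h1
  refine h2.congr_fderiv ?_
  ext a
  simp only [ContinuousLinearMap.comp_apply, ContinuousMultilinearMap.linearDeriv_apply]
  rw [sum_apply]
  refine Finset.sum_congr rfl fun i _ => ?_
  change Matrix.det (Matrix.updateRow (M z) i (fun j => M' i j a)) = _
  rw [← Matrix.cramer_transpose_apply, Matrix.cramer_eq_adjugate_mulVec,
    ← Matrix.adjugate_transpose]
  simp [Matrix.mulVec, dotProduct, Matrix.transpose_apply]

theorem trace_adjugate_mul_eq_sum (A K : Matrix (Fin n) (Fin n) ℂ) :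
    (A.adjugate * K).trace = ∑ i, ∑ j, A.adjugate j i * K i j := by
  simp only [Matrix.trace, Matrix.diag, Matrix.mul_apply]
  exact Finset.sum_comm

theorem differentiableAt_det {M : E → Matrix (Fin n) (Fin n) ℂ} {z : E}
    (hM : ∀ i j, DifferentiableAt ℝ (fun w => M w i j) z) :
    DifferentiableAt ℝ (fun w => (M w).det) z :=
  (hasFDerivAt_det fun i j => (hM i j).hasFDerivAt).differentiableAt

theorem differentiableAt_adjugate {M : E → Matrix (Fin n) (Fin n) ℂ} {z : E}
    (hM : ∀ i j, DifferentiableAt ℝ (fun w => M w i j) z) (i j : Fin n) :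
    DifferentiableAt ℝ (fun w => (M w).adjugate i j) z := by
  simp only [Matrix.adjugate_apply]
  refine differentiableAt_det fun k l => ?_
  by_cases h : k = j
  · subst h; simp
  · simpa [Matrix.updateRow_ne h] using hM k l

theorem contDiffAt_det {N : WithTop ℕ∞} {M : E → Matrix (Fin n) (Fin n) ℂ} {z : E}
    (hM : ∀ i j, ContDiffAt ℝ N (fun w => M w i j) z) :
    ContDiffAt ℝ N (fun w => (M w).det) z := by
  simp only [Matrix.det_apply']
  exact ContDiffAt.sum fun σ _ => contDiffAt_const.mul (contDiffAt_prod fun i _ => hM _ _)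

theorem contDiffAt_det_complex {E : Type*} [NormedAddCommGroup E] [NormedSpace ℂ E]
    {N : WithTop ℕ∞} {M : E → Matrix (Fin n) (Fin n) ℂ} {z : E}
    (hM : ∀ i j, ContDiffAt ℂ N (fun w => M w i j) z) :
    ContDiffAt ℂ N (fun w => (M w).det) z := by
  simp only [Matrix.det_apply']
  exact ContDiffAt.sum fun σ _ => contDiffAt_const.mul (contDiffAt_prod fun i _ => hM _ _)

theorem contDiffAt_adjugate {N : WithTop ℕ∞} {M : E → Matrix (Fin n) (Fin n) ℂ} {z : E}
    (hM : ∀ i j, ContDiffAt ℝ N (fun w => M w i j) z) (i j : Fin n) :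
    ContDiffAt ℝ N (fun w => (M w).adjugate i j) z := by
  simp only [Matrix.adjugate_apply]
  refine contDiffAt_det fun k l => ?_
  by_cases h : k = j
  · subst h; simp [contDiffAt_const]
  · simpa [Matrix.updateRow_ne h] using hM k l

/-- An entry of the adjugate is the determinant of the matrix with one row frozen. The formula is
polynomial in M and its first derivatives, hence visibly continuous when M is perturbed by a
constant; `piola` needs exactly this. -/
theorem fderiv_adjugate {M : E → Matrix (Fin n) (Fin n) ℂ} {z : E}
    (hM : ∀ i j, DifferentiableAt ℝ (fun w => M w i j) z) (i j : Fin n) (a : E) :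
    fderiv ℝ (fun w => (M w).adjugate i j) z a =
      (((M z).updateRow j (Pi.single i 1)).adjugate *
        (Matrix.of fun k l => fderiv ℝ (fun w => M w k l) z a).updateRow j 0).trace := by
  simp only [Matrix.adjugate_apply (A := M _)]
  have hd : ∀ k l, HasFDerivAt (fun w => (M w).updateRow j (Pi.single i 1) k l)
      (if k = j then 0 else fderiv ℝ (fun w => M w k l) z) z := fun k l => by
    by_cases h : k = j
    · subst h; simpa using hasFDerivAt_const _ _
    · simpa [Matrix.updateRow_ne h, h] using (hM k l).hasFDerivAt
  rw [(hasFDerivAt_det hd).fderiv, trace_adjugate_mul_eq_sum]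
  simp only [sum_apply, smul_apply, smul_eq_mul]
  refine Finset.sum_congr rfl fun k _ => Finset.sum_congr rfl fun l _ => ?_
  by_cases h : k = j
  · subst h; simp
  · simp [h]

end MatrixCalculus

/-! ### The Piola identity for closed (1,1)-forms -/

section Piola

variable {n : ℕ}

theorem dzbar_mul {f g : (Fin n → ℂ) → ℂ} {z : Fin n → ℂ} (hf : DifferentiableAt ℝ f z)
    (hg : DifferentiableAt ℝ g z) (j : Fin n) :
    dzbar j (fun w => f w * g w) z = dzbar j f z * g z + f z * dzbar j g z := by
  simp only [dzbar, fderiv_fun_mul hf hg, add_apply, smul_apply, smul_eq_mul]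
  ring

theorem dzbar_sum {ι : Type*} (s : Finset ι) {f : ι → (Fin n → ℂ) → ℂ} {z : Fin n → ℂ}
    (hf : ∀ i ∈ s, DifferentiableAt ℝ (f i) z) (j : Fin n) :
    dzbar j (fun w => ∑ i ∈ s, f i w) z = ∑ i ∈ s, dzbar j (f i) z := by
  simp only [dzbar, fderiv_fun_sum hf, sum_apply]
  rw [Finset.mul_sum, ← Finset.sum_add_distrib, Finset.sum_div]

theorem dzbar_det {M : (Fin n → ℂ) → Matrix (Fin n) (Fin n) ℂ} {z : Fin n → ℂ}
    (hM : ∀ i j, DifferentiableAt ℝ (fun w => M w i j) z) (k : Fin n) :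
    dzbar k (fun w => (M w).det) z =
      ((M z).adjugate * Matrix.of fun i j => dzbar k (fun w => M w i j) z).trace := by
  rw [trace_adjugate_mul_eq_sum]
  simp only [dzbar, (hasFDerivAt_det fun i j => (hM i j).hasFDerivAt).fderiv,
    sum_apply, smul_apply, smul_eq_mul, Matrix.of_apply]
  rw [Finset.mul_sum, ← Finset.sum_add_distrib, Finset.sum_div]
  refine Finset.sum_congr rfl fun i _ => ?_
  rw [Finset.mul_sum, ← Finset.sum_add_distrib, Finset.sum_div]
  refine Finset.sum_congr rfl fun j _ => ?_
  ring

/-- Differentiate adj M · M = det M · 1 and multiply by adj M on the right: det M times the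
derivative of adj M becomes a difference of two expressions, each quadratic in adj M. After
contraction the two sums agree, because closedness makes the differentiation index and the column
index of the derivative of M interchangeable. -/
theorem piola_of_det_ne_zero {M : (Fin n → ℂ) → Matrix (Fin n) (Fin n) ℂ} {z : Fin n → ℂ}
    (hM : ∀ i j, DifferentiableAt ℝ (fun w => M w i j) z)
    (hcl : ∀ i j k, dzbar k (fun w => M w i j) z = dzbar j (fun w => M w i k) z)
    (hdet : (M z).det ≠ 0) (i : Fin n) :
    ∑ j, dzbar j (fun w => (M w).adjugate j i) z = 0 := by
  set A := (M z).adjugate with hA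
  set K : Fin n → Matrix (Fin n) (Fin n) ℂ := fun k => Matrix.of fun i j =>
    dzbar k (fun w => M w i j) z with hK
  set A' : Fin n → Matrix (Fin n) (Fin n) ℂ := fun k => Matrix.of fun i j =>
    dzbar k (fun w => (M w).adjugate i j) z with hA'
  have h1 : ∀ k, A' k * M z + A * K k = (A * K k).trace • (1 : Matrix (Fin n) (Fin n) ℂ) := by
    intro k
    ext a b
    have e1 : (fun w => ∑ c, (M w).adjugate a c * M w c b) = fun w =>
        (M w).det * (1 : Matrix (Fin n) (Fin n) ℂ) a b := by
      ext w
      have := congrFun (congrFun (Matrix.adjugate_mul (M w)) a) b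
      simpa [Matrix.mul_apply] using this
    have e2 : dzbar k (fun w => ∑ c, (M w).adjugate a c * M w c b) z =
        dzbar k (fun w => (M w).det * (1 : Matrix (Fin n) (Fin n) ℂ) a b) z := by rw [e1]
    rw [dzbar_sum _ fun c _ => (differentiableAt_adjugate hM a c).fun_mul (hM c b)] at e2
    rw [dzbar_mul (differentiableAt_det hM) (differentiableAt_const _), dzbar_det hM] at e2
    have e3 : dzbar k (fun _ => (1 : Matrix (Fin n) (Fin n) ℂ) a b) z = 0 := by simp [dzbar]
    rw [e3, mul_zero, add_zero] at e2
    simp only [dzbar_mul (differentiableAt_adjugate hM a _) (hM _ b), Finset.sum_add_distrib] at e2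
    simpa [Matrix.mul_apply, hK, hA', hA] using e2
  have h2 : ∀ k, (M z).det • A' k = (A * K k).trace • A - A * K k * A := by
    intro k
    have := congrArg (fun B => B * A) (h1 k)
    simp only [Matrix.add_mul, Matrix.mul_assoc, hA, Matrix.mul_adjugate, Matrix.smul_mul,
      Matrix.one_mul, Matrix.mul_smul, Matrix.mul_one] at this
    rw [hA, Matrix.mul_assoc]
    exact eq_sub_of_add_eq this
  have h3 : (M z).det * ∑ j, A' j j i = 0 := by
    rw [Finset.mul_sum]
    have : ∀ j, (M z).det * A' j j i = (A * K j).trace * A j i - (A * K j * A) j i := fun j => by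
      have := congrFun (congrFun (h2 j) j) i
      simpa using this
    rw [Finset.sum_congr rfl fun j _ => this j, Finset.sum_sub_distrib, sub_eq_zero]
    simp only [Matrix.trace, Matrix.diag, Matrix.mul_apply, Finset.sum_mul]
    have hs : ∀ a b c, K c b a = K a b c := fun a b c => by simp [hK, hcl b a c]
    conv_rhs => rw [Finset.sum_comm]
    refine Finset.sum_congr rfl fun j _ => Finset.sum_congr rfl fun a _ =>
      Finset.sum_congr rfl fun b _ => ?_
    rw [hs a b j]
  rcases mul_eq_zero.1 h3 with h | h
  · exact absurd h hdet
  · exact h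

theorem eventually_det_add_smul_one_ne_zero (A : Matrix (Fin n) (Fin n) ℂ) :
    ∀ᶠ ε : ℂ in nhdsWithin 0 {0}ᶜ, (A + ε • (1 : Matrix (Fin n) (Fin n) ℂ)).det ≠ 0 := by
  have hfin : ({ε : ℂ | (-A).charpoly.IsRoot ε} \ {0}).Finite :=
    (Polynomial.finite_setOfPred_isRoot (Matrix.charpoly_monic _).ne_zero).subset sdiff_subset
  have h1 : ({ε : ℂ | (-A).charpoly.IsRoot ε} \ {0})ᶜ ∈ nhds (0 : ℂ) :=
    hfin.isClosed.isOpen_compl.mem_nhds (by simp)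
  filter_upwards [mem_nhdsWithin_of_mem_nhds h1, self_mem_nhdsWithin] with ε hε h0 hd
  refine hε ⟨?_, h0⟩
  rw [mem_ofPred_eq, Polynomial.IsRoot, Matrix.eval_charpoly, ← hd, sub_neg_eq_add, add_comm,
    Matrix.smul_one_eq_diagonal]
  rfl

/-- The rows of the adjugate of a closed form are divergence free. -/
theorem piola {M : (Fin n → ℂ) → Matrix (Fin n) (Fin n) ℂ} {z : Fin n → ℂ}
    (hM : ∀ i j, DifferentiableAt ℝ (fun w => M w i j) z)
    (hcl : ∀ i j k, dzbar k (fun w => M w i j) z = dzbar j (fun w => M w i k) z) (i : Fin n) :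
    ∑ j, dzbar j (fun w => (M w).adjugate j i) z = 0 := by
  -- Degenerate matrices are reached by continuity: M + ε·1 has the same derivatives, so it is still
  -- closed, and it is invertible for small ε ≠ 0. The divergence S(ε) is continuous in ε, so it
  -- also vanishes at 0.
  set S : ℂ → ℂ := fun ε => ∑ j, dzbar j
    (fun w => (M w + ε • (1 : Matrix (Fin n) (Fin n) ℂ)).adjugate j i) z with hS
  have hMε : ∀ (ε : ℂ) i j, DifferentiableAt ℝ
      (fun w => (M w + ε • (1 : Matrix (Fin n) (Fin n) ℂ)) i j) z := fun ε i j => by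
    simpa using (hM i j)
  have hd : ∀ (ε : ℂ) i j, fderiv ℝ (fun w => (M w + ε • (1 : Matrix (Fin n) (Fin n) ℂ)) i j) z =
      fderiv ℝ (fun w => M w i j) z := fun ε i j => by
    simp
  have hcont : Continuous S := by
    refine continuous_finsetSum _ fun j _ => ?_
    simp only [dzbar, fderiv_adjugate (hMε _), hd]
    fun_prop
  have hz : ∀ᶠ ε : ℂ in nhdsWithin 0 {0}ᶜ, S ε = 0 := by
    filter_upwards [eventually_det_add_smul_one_ne_zero (M z)] with ε hε
    refine piola_of_det_ne_zero (hMε ε) (fun i j k => ?_) hε i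
    simpa only [dzbar, hd] using hcl i j k
  have h1 : Filter.Tendsto S (nhdsWithin 0 {0}ᶜ) (nhds (S 0)) :=
    hcont.continuousAt.tendsto.mono_left nhdsWithin_le_nhds
  have h2 : Filter.Tendsto S (nhdsWithin 0 {0}ᶜ) (nhds 0) :=
    tendsto_const_nhds.congr' (hz.mono fun _ h => h.symm)
  have h3 := tendsto_nhds_unique h1 h2
  simpa [hS] using h3

end Piola

theorem nat_le_infty (k : ℕ) : (k : WithTop ℕ∞) ≤ ∞ := by
  exact_mod_cast (le_top : (k : ℕ∞) ≤ ⊤)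

/-! ### Holomorphic maps, smooth functions and pullbacks in charts -/

section Charts

variable {n : ℕ} {X : Type*} [TopologicalSpace X] [ChartedSpace (Fin n → ℂ) X]
  [IsManifold 𝓘(ℂ, Fin n → ℂ) ω X]

/-- Holomorphic self-maps of `X`. -/
def IsHolo (n : ℕ) {X : Type*} [TopologicalSpace X] [ChartedSpace (Fin n → ℂ) X]
    (σ : X → X) : Prop :=
  ContMDiff 𝓘(ℂ, Fin n → ℂ) 𝓘(ℂ, Fin n → ℂ) ω σ

theorem IsHolo.contDiffAt {σ : X → X} (hσ : IsHolo n σ)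
    {e e' : OpenPartialHomeomorph X (Fin n → ℂ)} (he : e ∈ atlas (Fin n → ℂ) X)
    (he' : e' ∈ atlas (Fin n → ℂ) X) {z : Fin n → ℂ} (hz : z ∈ e.target)
    (hz' : σ (e.symm z) ∈ e'.source) :
    ContDiffAt ℂ ω (fun w => e' (σ (e.symm w))) z := by
  rw [← contMDiffAt_iff_contDiffAt]
  have h1 : ContMDiffAt 𝓘(ℂ, Fin n → ℂ) 𝓘(ℂ, Fin n → ℂ) ω e.symm z :=
    (contMDiffOn_symm_of_mem_maximalAtlas (IsManifold.subset_maximalAtlas he)).contMDiffAt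
      (e.open_target.mem_nhds hz)
  have h2 : ContMDiffAt 𝓘(ℂ, Fin n → ℂ) 𝓘(ℂ, Fin n → ℂ) ω e' (σ (e.symm z)) :=
    (contMDiffOn_of_mem_maximalAtlas (IsManifold.subset_maximalAtlas he')).contMDiffAt
      (e'.open_source.mem_nhds hz')
  exact h2.comp z ((hσ (e.symm z)).comp z h1)

theorem isHolo_id : IsHolo n (id : X → X) := contMDiff_id

theorem IsHolo.continuous {σ : X → X} (hσ : IsHolo n σ) : Continuous σ := ContMDiff.continuous hσ

/-- Holomorphic transition maps are real smooth; this gives access to the real theory, in particular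
to partitions of unity. -/
theorem isManifold_real : IsManifold 𝓘(ℝ, Fin n → ℂ) ∞ X := by
  refine isManifold_of_contDiffOn _ _ _ fun e e' he he' => ?_
  intro z hz
  simp only [modelWithCornersSelf_coe, modelWithCornersSelf_coe_symm, Function.comp_id,
    Function.id_comp, preimage_id, range_id, inter_univ] at hz ⊢
  have hz' := hz
  rw [OpenPartialHomeomorph.trans_source] at hz'
  have := (isHolo_id (n := n) (X := X)).contDiffAt he he' (z := z) (by simpa using hz'.1) (by simpa using hz'.2)
  exact ((this.restrict_scalars ℝ).of_le le_top).contDiffWithinAt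

theorem IsSmooth.contDiffAt {φ : X → ℝ} (hφ : IsSmooth n φ)
    {e : OpenPartialHomeomorph X (Fin n → ℂ)} (he : e ∈ atlas (Fin n → ℂ) X)
    {z : Fin n → ℂ} (hz : z ∈ e.target) : ContDiffAt ℝ ∞ (fun w => φ (e.symm w)) z := by
  have : IsManifold 𝓘(ℝ, Fin n → ℂ) ∞ X := isManifold_real
  rw [← contMDiffAt_iff_contDiffAt]
  have h1 : ContMDiffAt 𝓘(ℝ, Fin n → ℂ) 𝓘(ℝ, Fin n → ℂ) ∞ e.symm z :=
    (contMDiffOn_symm_of_mem_maximalAtlas (IsManifold.subset_maximalAtlas he)).contMDiffAt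
      (e.open_target.mem_nhds hz)
  exact (hφ (e.symm z)).comp z h1

theorem isSmooth_of_contDiffAt {φ : X → ℝ}
    (h : ∀ e ∈ atlas (Fin n → ℂ) X, ∀ z ∈ e.target, ContDiffAt ℝ ∞ (fun w => φ (e.symm w)) z) :
    IsSmooth n φ := by
  have : IsManifold 𝓘(ℝ, Fin n → ℂ) ∞ X := isManifold_real
  intro x
  set e := chartAt (Fin n → ℂ) x
  have hx : x ∈ e.source := mem_chart_source _ x
  have h1 : ContMDiffAt 𝓘(ℝ, Fin n → ℂ) 𝓘(ℝ, Fin n → ℂ) ∞ e x :=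
    (contMDiffOn_of_mem_maximalAtlas (IsManifold.subset_maximalAtlas
      (chart_mem_atlas _ x))).contMDiffAt (e.open_source.mem_nhds hx)
  have h2 := (contMDiffAt_iff_contDiffAt.2 (h e (chart_mem_atlas _ x) (e x) (e.map_source hx))).comp x h1
  refine h2.congr_of_eventuallyEq ?_
  filter_upwards [e.open_source.mem_nhds hx] with y hy
  simp [e.left_inv hy]

theorem IsSmooth.continuous {φ : X → ℝ} (hφ : IsSmooth n φ) : Continuous φ :=
  ContMDiff.continuous hφ

theorem IsSmooth.add {φ ψ : X → ℝ} (hφ : IsSmooth n φ) (hψ : IsSmooth n ψ) :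
    IsSmooth n fun x => φ x + ψ x :=
  isSmooth_of_contDiffAt fun _ he _ hz => (hφ.contDiffAt he hz).add (hψ.contDiffAt he hz)

theorem IsSmooth.mul {φ ψ : X → ℝ} (hφ : IsSmooth n φ) (hψ : IsSmooth n ψ) :
    IsSmooth n fun x => φ x * ψ x :=
  isSmooth_of_contDiffAt fun _ he _ hz => (hφ.contDiffAt he hz).mul (hψ.contDiffAt he hz)

theorem IsSmooth.sub {φ ψ : X → ℝ} (hφ : IsSmooth n φ) (hψ : IsSmooth n ψ) :
    IsSmooth n fun x => φ x - ψ x :=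
  isSmooth_of_contDiffAt fun _ he _ hz => (hφ.contDiffAt he hz).sub (hψ.contDiffAt he hz)

theorem isSmooth_const (c : ℝ) : IsSmooth n fun _ : X => c :=
  isSmooth_of_contDiffAt fun _ _ _ _ => contDiffAt_const

/-! ### Pullback of forms -/

theorem complexJacobian_comp {f g : (Fin n → ℂ) → (Fin n → ℂ)} {z : Fin n → ℂ}
    (hf : DifferentiableAt ℂ f (g z)) (hg : DifferentiableAt ℂ g z) :
    complexJacobian (fun w => f (g w)) z = complexJacobian f (g z) * complexJacobian g z := by
  ext k i
  have : fderiv ℂ (fun w => f (g w)) z = (fderiv ℂ f (g z)).comp (fderiv ℂ g z) :=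
    fderiv_comp z hf hg
  simp only [complexJacobian, Matrix.mul_apply, Matrix.of_apply, this,
    ContinuousLinearMap.comp_apply]
  conv_lhs => rw [sum_smul_single (fderiv ℂ g z (Pi.single i 1))]
  simp [mul_comm]

theorem complexJacobian_congr {f g : (Fin n → ℂ) → (Fin n → ℂ)} {z : Fin n → ℂ}
    (h : f =ᶠ[nhds z] g) : complexJacobian f z = complexJacobian g z := by
  ext; simp [complexJacobian, h.fderiv_eq]

/-- The jacobians of two composable maps in charts. -/
theorem complexJacobian_chart_comp {σ τ : X → X} (hσ : IsHolo n σ) (hτ : IsHolo n τ)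
    {e e' e'' : OpenPartialHomeomorph X (Fin n → ℂ)} (he : e ∈ atlas (Fin n → ℂ) X)
    (he' : e' ∈ atlas (Fin n → ℂ) X) (he'' : e'' ∈ atlas (Fin n → ℂ) X)
    {z : Fin n → ℂ} (hz : z ∈ e.target) (hz' : τ (e.symm z) ∈ e'.source)
    (hz'' : σ (τ (e.symm z)) ∈ e''.source) :
    complexJacobian (fun w => e'' (σ (τ (e.symm w)))) z =
      complexJacobian (fun w => e'' (σ (e'.symm w))) (e' (τ (e.symm z))) *
        complexJacobian (fun w => e' (τ (e.symm w))) z := by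
  rw [← complexJacobian_comp (f := fun w => e'' (σ (e'.symm w))) (g := fun w => e' (τ (e.symm w)))]
  · refine complexJacobian_congr ?_
    have hc : ContinuousAt (fun w => τ (e.symm w)) z :=
      hτ.continuous.continuousAt.comp (e.continuousAt_symm hz)
    filter_upwards [hc.eventually (e'.open_source.mem_nhds hz')] with y hy
    simp [e'.left_inv hy]
  · refine (hσ.contDiffAt he' he'' (e'.map_source hz') ?_).differentiableAt (by simp)
    rwa [e'.left_inv hz']
  · exact (hτ.contDiffAt he he' hz hz').differentiableAt (by simp)

/-- Every point has a chart around its image, and there the pullback formula prescribes the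
coefficients. -/
theorem IsPullback.unique {σ : X → X} {h h₁ h₂ : CoeffForm n X}
    (H₁ : IsPullback σ h h₁) (H₂ : IsPullback σ h h₂)
    {e : OpenPartialHomeomorph X (Fin n → ℂ)} (he : e ∈ atlas (Fin n → ℂ) X)
    {z : Fin n → ℂ} (hz : z ∈ e.target) : h₁ e z = h₂ e z := by
  rw [H₁ e he _ (chart_mem_atlas _ (σ (e.symm z))) z hz (mem_chart_source _ _),
    H₂ e he _ (chart_mem_atlas _ (σ (e.symm z))) z hz (mem_chart_source _ _)]

theorem isPullback_ddbar {σ : X → X} (hσ : IsHolo n σ) {φ : X → ℝ} (hφ : IsSmooth n φ) :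
    IsPullback σ (ddbar φ : CoeffForm n X) (ddbar fun x => φ (σ x)) := by
  intro e he e' he' z hz hz'
  have h2 : ContDiffAt ℝ 2 (fun w => φ (e'.symm w)) (e' (σ (e.symm z))) :=
    (hφ.contDiffAt he' (e'.map_source hz')).of_le (nat_le_infty 2)
  have h1 : ContDiffAt ℂ 2 (fun w => e' (σ (e.symm w))) z :=
    (hσ.contDiffAt he he' hz hz').of_le le_top
  simp only [ddbar]
  rw [← complexHessian_comp (τ := fun w => e' (σ (e.symm w))) h2 h1]
  refine complexHessian_congr ?_
  have hc : ContinuousAt (fun w => σ (e.symm w)) z :=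
    hσ.continuous.continuousAt.comp (e.continuousAt_symm hz)
  filter_upwards [hc.eventually (e'.open_source.mem_nhds hz')] with y hy
  simp [e'.left_inv hy]

theorem IsPullback.add {σ : X → X} {h h' k k' : CoeffForm n X}
    (H : IsPullback σ h h') (K : IsPullback σ k k') :
    IsPullback σ (fun e z => h e z + k e z) (fun e z => h' e z + k' e z) := by
  intro e he e' he' z hz hz'
  simp only
  rw [H e he e' he' z hz hz', K e he e' he' z hz hz']
  simp only [Matrix.mul_add, Matrix.add_mul]

theorem IsPullback.det {σ : X → X} {h h' : CoeffForm n X} (H : IsPullback σ h h')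
    {e e' : OpenPartialHomeomorph X (Fin n → ℂ)} (he : e ∈ atlas (Fin n → ℂ) X)
    (he' : e' ∈ atlas (Fin n → ℂ) X) {z : Fin n → ℂ} (hz : z ∈ e.target)
    (hz' : σ (e.symm z) ∈ e'.source) :
    (h' e z).det = Complex.normSq (complexJacobian (fun w => e' (σ (e.symm w))) z).det *
      (h e' (e' (σ (e.symm z)))).det := by
  have h1 : ∀ J : Matrix (Fin n) (Fin n) ℂ, (J.map star).det = star J.det := fun J => by
    have := (starRingEnd ℂ).map_det J
    simpa [RingHom.mapMatrix_apply] using this.symm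
  rw [H e he e' he' z hz hz']
  simp only [Matrix.det_mul, Matrix.det_transpose, h1]
  rw [Complex.normSq_eq_conj_mul_self]
  simp only [RCLike.star_def]
  ring

end Charts

/-! ### Measures defined by local densities -/

section Density

variable {n : ℕ} {X : Type*} [TopologicalSpace X] [ChartedSpace (Fin n → ℂ) X]
  [IsManifold 𝓘(ℂ, Fin n → ℂ) ω X] [MeasurableSpace X] [BorelSpace X]

/-- Local densities with respect to Lebesgue measure in the charts. -/
abbrev Density (n : ℕ) (X : Type*) [TopologicalSpace X] : Type _ :=
  OpenPartialHomeomorph X (Fin n → ℂ) → (Fin n → ℂ) → ℝ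

/-- `d'` is the pullback under `σ` of the density `d`. -/
def DensityPullback (σ : X → X) (d d' : Density n X) : Prop :=
  ∀ e ∈ atlas (Fin n → ℂ) X, ∀ e' ∈ atlas (Fin n → ℂ) X, ∀ z ∈ e.target,
    σ (e.symm z) ∈ e'.source →
      d' e z = Complex.normSq (complexJacobian (fun w => e' (σ (e.symm w))) z).det *
        d e' (e' (σ (e.symm z)))

/-- The real determinant of a complex linear map is the norm from ℂ to ℝ of its complex determinant.
-/
theorem det_restrictScalars_eq_normSq (τ : (Fin n → ℂ) → (Fin n → ℂ)) (z : Fin n → ℂ) :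
    ((fderiv ℂ τ z).restrictScalars ℝ).det = Complex.normSq (complexJacobian τ z).det := by
  have h1 : LinearMap.det ((fderiv ℂ τ z : (Fin n → ℂ) →ₗ[ℂ] (Fin n → ℂ)))
      = (complexJacobian τ z).det := by
    rw [← LinearMap.det_toMatrix']
    congr 1
  have h2 := LinearMap.det_restrictScalars (R := ℝ) (f := (fderiv ℂ τ z : (Fin n → ℂ) →ₗ[ℂ] (Fin n → ℂ)))
  rw [h1, Algebra.norm_complex_apply] at h2
  exact h2

theorem measurableSet_target_inter_preimage (e : OpenPartialHomeomorph X (Fin n → ℂ)) {B : Set X}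
    (hB : MeasurableSet B) : MeasurableSet (e.target ∩ e.symm ⁻¹' B) := by
  have h1 : Continuous (e.target.domRestrict e.symm) :=
    continuousOn_iff_continuous_domRestrict.1 e.continuousOn_symm
  have h2 := e.open_target.measurableSet.subtype_image (h1.measurable hB)
  convert h2 using 1
  ext z
  simp [and_comm]

theorem aemeasurable_symm (e : OpenPartialHomeomorph X (Fin n → ℂ)) (f : (Fin n → ℂ) → ENNReal) :
    AEMeasurable e.symm ((volume.restrict e.target).withDensity f) :=
  (e.continuousOn_symm.aemeasurable e.open_target.measurableSet).mono_ac
    (withDensity_absolutelyContinuous _ _)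

/-- The contribution of one chart to `densityMeasure`. -/
def chartMeasure (d : Density n X) (e : OpenPartialHomeomorph X (Fin n → ℂ)) : Measure X :=
  ((volume.restrict e.target).withDensity fun z => ENNReal.ofReal (d e z)).map e.symm

theorem chartMeasure_apply (d : Density n X) (e : OpenPartialHomeomorph X (Fin n → ℂ)) {B : Set X}
    (hB : MeasurableSet B) :
    chartMeasure d e B = ∫⁻ z in e.target ∩ e.symm ⁻¹' B, ENNReal.ofReal (d e z) := by
  rw [chartMeasure, Measure.map_apply_of_aemeasurable (aemeasurable_symm e _) hB]
  have hm := measurableSet_target_inter_preimage e hB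
  -- Off the target the inverse chart has meaningless values, so that set is discarded as a null
  -- set.
  have h2 : (volume.restrict e.target).withDensity (fun z => ENNReal.ofReal (d e z)) (e.target)ᶜ = 0 := by
    rw [withDensity_apply _ e.open_target.measurableSet.compl,
      Measure.restrict_restrict e.open_target.measurableSet.compl]
    simp
  have h1 : (volume.restrict e.target).withDensity (fun z => ENNReal.ofReal (d e z))
      (e.symm ⁻¹' B) = (volume.restrict e.target).withDensity (fun z => ENNReal.ofReal (d e z))
      (e.target ∩ e.symm ⁻¹' B) := by
    refine le_antisymm ?_ (measure_mono inter_subset_right)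
    calc _ ≤ _ := measure_mono (t := (e.target ∩ e.symm ⁻¹' B) ∪ (e.target)ᶜ) (by
            intro z hz
            by_cases h : z ∈ e.target
            · exact Or.inl ⟨h, hz⟩
            · exact Or.inr h)
      _ ≤ _ := measure_union_le _ _
      _ = _ := by rw [h2, add_zero]
  rw [h1, withDensity_apply _ hm, Measure.restrict_restrict hm]
  congr 2
  ext z; simp; tauto

/-- Change of variables for σ read in charts: the factor |det J|² in the transformation law of
densities is the real Jacobian. The case σ = id compares two charts. -/
theorem chartMeasure_image {σ : X ≃ₜ X} (hσ : IsHolo n σ) {d d' : Density n X}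
    (H : DensityPullback σ d d') {e e' : OpenPartialHomeomorph X (Fin n → ℂ)}
    (he : e ∈ atlas (Fin n → ℂ) X) (he' : e' ∈ atlas (Fin n → ℂ) X) {B : Set X}
    (hB : MeasurableSet B) (hBe : B ⊆ e.source) (hBe' : σ '' B ⊆ e'.source) :
    chartMeasure d e' (σ '' B) = chartMeasure d' e B := by
  have hB' : MeasurableSet (σ '' B) := (σ.measurableEmbedding.measurableSet_image).2 hB
  rw [chartMeasure_apply _ _ hB, chartMeasure_apply _ _ hB']
  set S := e.target ∩ e.symm ⁻¹' B with hS
  have hSm : MeasurableSet S := measurableSet_target_inter_preimage e hB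
  set τ : (Fin n → ℂ) → (Fin n → ℂ) := fun w => e' (σ (e.symm w)) with hτ
  have hSB : ∀ z ∈ S, σ (e.symm z) ∈ e'.source := fun z hz => hBe' ⟨_, hz.2, rfl⟩
  have himg : e'.target ∩ e'.symm ⁻¹' (σ '' B) = τ '' S := by
    ext y
    constructor
    · rintro ⟨hy, x, hx, hxy⟩
      refine ⟨e x, ⟨e.map_source (hBe hx), ?_⟩, ?_⟩
      · rwa [mem_preimage, e.left_inv (hBe hx)]
      · simp only [hτ, e.left_inv (hBe hx), hxy, e'.right_inv hy]
    · rintro ⟨z, hz, rfl⟩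
      refine ⟨e'.map_source (hSB z hz), ?_⟩
      rw [mem_preimage, e'.left_inv (hSB z hz)]
      exact ⟨_, hz.2, rfl⟩
  rw [himg, lintegral_image_eq_lintegral_abs_det_fderiv_mul volume hSm
    (f' := fun z => (fderiv ℂ τ z).restrictScalars ℝ)]
  · refine setLIntegral_congr_fun hSm fun z hz => ?_
    rw [H e he e' he' z hz.1 (hSB z hz), ENNReal.ofReal_mul (Complex.normSq_nonneg _),
      det_restrictScalars_eq_normSq, abs_of_nonneg (Complex.normSq_nonneg _)]
  · intro z hz
    exact (((hσ.contDiffAt he he' hz.1 (hSB z hz)).differentiableAt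
      (by simp)).hasFDerivAt.restrictScalars ℝ).hasFDerivWithinAt
  · intro z hz w hw hzw
    have h1 := e'.injOn (hSB z hz) (hSB w hw) hzw
    exact e.symm.injOn hz.1 hw.1 (σ.injective h1)

theorem chartMeasure_congr_chart {d : Density n X} (H : DensityPullback id d d)
    {e e' : OpenPartialHomeomorph X (Fin n → ℂ)}
    (he : e ∈ atlas (Fin n → ℂ) X) (he' : e' ∈ atlas (Fin n → ℂ) X) {B : Set X}
    (hB : MeasurableSet B) (hBe : B ⊆ e.source) (hBe' : B ⊆ e'.source) :
    chartMeasure d e' B = chartMeasure d e B := by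
  have := chartMeasure_image (σ := Homeomorph.refl X) (isHolo_id (n := n)) H he he' hB hBe
    (by simpa using hBe')
  simpa using this

theorem chartMeasure_le (d : Density n X) {e : OpenPartialHomeomorph X (Fin n → ℂ)}
    (he : e ∈ atlas (Fin n → ℂ) X) : chartMeasure d e ≤ densityMeasure d :=
  le_iSup₂_of_le e he le_rfl

theorem chartMeasure_compl_source (d : Density n X) (e : OpenPartialHomeomorph X (Fin n → ℂ)) :
    chartMeasure d e (e.source)ᶜ = 0 := by
  rw [chartMeasure_apply _ _ e.open_source.measurableSet.compl]
  have : e.target ∩ e.symm ⁻¹' (e.source)ᶜ = ∅ := by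
    ext z
    simp only [mem_inter_iff, mem_preimage, mem_compl_iff, mem_empty_iff_false, iff_false, not_and,
      not_not]
    exact e.map_target
  rw [this]; simp

theorem densityMeasure_apply_of_subset {d : Density n X} (H : DensityPullback id d d)
    {e : OpenPartialHomeomorph X (Fin n → ℂ)} (he : e ∈ atlas (Fin n → ℂ) X) {B : Set X}
    (hB : MeasurableSet B) (hBe : B ⊆ e.source) :
    densityMeasure d B = chartMeasure d e B := by
  refine le_antisymm ?_ (chartMeasure_le d he B)
  have hs := e.open_source.measurableSet
  -- To bound a supremum of measures it is enough to bound each member. Inside the domain of e, the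
  -- contribution of another chart is at most that of e by compatibility; outside, it is at most the
  -- whole supremum.
  have h1 : densityMeasure d ≤ chartMeasure d e + (densityMeasure d).restrict (e.source)ᶜ := by
    refine iSup₂_le fun e' he' => ?_
    refine Measure.le_iff.2 fun A hA => ?_
    change chartMeasure d e' A ≤ _
    rw [Measure.add_apply, Measure.restrict_apply hA, ← measure_inter_add_sdiff A hs]
    refine add_le_add ?_ (chartMeasure_le d he' _)
    calc chartMeasure d e' (A ∩ e.source)
        ≤ chartMeasure d e' ((A ∩ e.source ∩ e'.source) ∪ (e'.source)ᶜ) := measure_mono (by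
            intro x hx
            by_cases h : x ∈ e'.source
            · exact Or.inl ⟨hx, h⟩
            · exact Or.inr h)
      _ ≤ chartMeasure d e' (A ∩ e.source ∩ e'.source) + 0 := by
            rw [← chartMeasure_compl_source d e']; exact measure_union_le _ _
      _ = chartMeasure d e (A ∩ e.source ∩ e'.source) := by
            rw [add_zero]
            exact chartMeasure_congr_chart H he he' ((hA.inter hs).inter e'.open_source.measurableSet)
              (fun x hx => hx.1.2) (fun x hx => hx.2)
      _ ≤ _ := measure_mono (fun x hx => hx.1.1)
  refine (h1 B).trans ?_
  rw [Measure.add_apply, Measure.restrict_apply hB]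
  have : B ∩ (e.source)ᶜ = ∅ := by
    ext x; simp only [mem_inter_iff, mem_compl_iff, mem_empty_iff_false, iff_false, not_and, not_not]
    exact fun h => hBe h
  rw [this]; simp

theorem densityMeasure_restrict_source {d : Density n X} (H : DensityPullback id d d)
    {e : OpenPartialHomeomorph X (Fin n → ℂ)} (he : e ∈ atlas (Fin n → ℂ) X) :
    (densityMeasure d).restrict e.source = chartMeasure d e := by
  ext B hB
  have hs := e.open_source.measurableSet
  rw [Measure.restrict_apply hB, densityMeasure_apply_of_subset H he (hB.inter hs) inter_subset_right]
  refine le_antisymm (measure_mono inter_subset_left) ?_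
  rw [← measure_inter_add_sdiff B hs]
  have : chartMeasure d e (B \ e.source) = 0 :=
    measure_mono_null (fun x hx => hx.2) (chartMeasure_compl_source d e)
  rw [this, add_zero]

/-- Compactness reduces the cover to a finite, hence countable one, where agreement of the
restrictions suffices. -/
theorem measure_ext_of_local [CompactSpace X] {μ ν : Measure X}
    (h : ∀ x, ∃ U ∈ nhds x, ∀ B, MeasurableSet B → B ⊆ U → μ B = ν B) : μ = ν := by
  choose U hU hμ using h
  obtain ⟨t, -, ht⟩ := isCompact_univ.elim_nhds_subcover (fun x => interior (U x))
    (fun x _ => interior_mem_nhds.2 (hU x))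
  refine (Measure.ext_iff_of_biUnion_eq_univ (s := fun x => interior (U x)) t.countable_toSet
    (univ_subset_iff.1 ht)).2 fun x _ => ?_
  ext B hB
  rw [Measure.restrict_apply hB, Measure.restrict_apply hB]
  exact hμ x _ (hB.inter isOpen_interior.measurableSet)
    (inter_subset_right.trans interior_subset)

theorem densityMeasure_map [CompactSpace X] {σ : X ≃ₜ X} (hσ : IsHolo n σ) {d d' : Density n X}
    (Hd : DensityPullback id d d) (Hd' : DensityPullback id d' d')
    (H : DensityPullback σ d d') : (densityMeasure d').map σ = densityMeasure d := by
  refine measure_ext_of_local fun y => ?_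
  set e := chartAt (Fin n → ℂ) (σ.symm y)
  set e' := chartAt (Fin n → ℂ) y
  refine ⟨e'.source ∩ σ.symm ⁻¹' e.source, Filter.inter_mem
    (e'.open_source.mem_nhds (mem_chart_source _ _)) (σ.symm.continuous.continuousAt.preimage_mem_nhds
      (e.open_source.mem_nhds (mem_chart_source _ _))), fun B hB hBU => ?_⟩
  rw [Measure.map_apply σ.continuous.measurable hB]
  have h1 : σ '' (σ ⁻¹' B) = B := σ.surjective.image_preimage B
  have hB' : MeasurableSet (σ ⁻¹' B) := σ.continuous.measurable hB
  have h2 : σ ⁻¹' B ⊆ e.source := fun x hx => by simpa using (hBU hx).2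
  have h3 : σ '' (σ ⁻¹' B) ⊆ e'.source := by rw [h1]; exact fun x hx => (hBU hx).1
  rw [densityMeasure_apply_of_subset Hd' (chart_mem_atlas _ _) hB' h2,
    densityMeasure_apply_of_subset Hd (chart_mem_atlas _ y) hB (h1 ▸ h3),
    ← chartMeasure_image hσ H (chart_mem_atlas _ _) (chart_mem_atlas _ y) hB' h2 h3, h1]

theorem densityMeasure_eq_withDensity [CompactSpace X] {d d₀ : Density n X}
    (Hd : DensityPullback id d d) (Hd₀ : DensityPullback id d₀ d₀)
    (hc : ∀ e ∈ atlas (Fin n → ℂ) X, ContinuousOn (d₀ e) e.target)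
    (h0 : ∀ e ∈ atlas (Fin n → ℂ) X, ∀ z ∈ e.target, 0 ≤ d₀ e z)
    {q : X → ℝ} (hq : Continuous q)
    (hdq : ∀ e ∈ atlas (Fin n → ℂ) X, ∀ z ∈ e.target, d e z = q (e.symm z) * d₀ e z) :
    densityMeasure d = (densityMeasure d₀).withDensity fun x => ENNReal.ofReal (q x) := by
  refine measure_ext_of_local fun x => ?_
  set e := chartAt (Fin n → ℂ) x
  have he : e ∈ atlas (Fin n → ℂ) X := chart_mem_atlas _ x
  refine ⟨e.source, e.open_source.mem_nhds (mem_chart_source _ _), fun B hB hBe => ?_⟩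
  have hqm : Measurable fun x => ENNReal.ofReal (q x) := hq.measurable.ennreal_ofReal
  rw [densityMeasure_apply_of_subset Hd he hB hBe, withDensity_apply _ hB,
    ← inter_eq_self_of_subset_left hBe, ← Measure.restrict_restrict hB,
    densityMeasure_restrict_source Hd₀ he, inter_eq_self_of_subset_left hBe,
    chartMeasure_apply _ _ hB, ← lintegral_indicator hB, chartMeasure,
    lintegral_map' (hqm.indicator hB).aemeasurable (aemeasurable_symm e _)]
  have hm := measurableSet_target_inter_preimage e hB
  have hd0m : AEMeasurable (fun z => ENNReal.ofReal (d₀ e z)) (volume.restrict e.target) :=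
    ((hc e he).aemeasurable e.open_target.measurableSet).ennreal_ofReal
  have hqe : AEMeasurable (fun z => B.indicator (fun x => ENNReal.ofReal (q x)) (e.symm z))
      (volume.restrict e.target) :=
    (hqm.indicator hB).comp_aemeasurable (e.continuousOn_symm.aemeasurable e.open_target.measurableSet)
  rw [lintegral_withDensity_eq_lintegral_mul₀ hd0m hqe, inter_comm, ← Measure.restrict_restrict' e.open_target.measurableSet,
    ← lintegral_indicator₀]
  · refine setLIntegral_congr_fun e.open_target.measurableSet fun z hz => ?_
    by_cases h : e.symm z ∈ B
    · simp only [indicator, mem_preimage, h, if_true, Pi.mul_apply]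
      rw [hdq e he z hz, mul_comm, ENNReal.ofReal_mul (h0 e he z hz)]
    · simp [indicator, h]
  · exact (e.continuousOn_symm.aemeasurable e.open_target.measurableSet).nullMeasurableSet_preimage hB

theorem setIntegral_densityMeasure {d : Density n X} (H : DensityPullback id d d)
    (hc : ∀ e ∈ atlas (Fin n → ℂ) X, ContinuousOn (d e) e.target)
    (h0 : ∀ e ∈ atlas (Fin n → ℂ) X, ∀ z ∈ e.target, 0 ≤ d e z)
    {e : OpenPartialHomeomorph X (Fin n → ℂ)} (he : e ∈ atlas (Fin n → ℂ) X)
    {f : X → ℝ} (hf : Continuous f) :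
    ∫ x in e.source, f x ∂(densityMeasure d) = ∫ z in e.target, d e z * f (e.symm z) := by
  rw [densityMeasure_restrict_source H he, chartMeasure,
    integral_map (aemeasurable_symm e _) hf.aestronglyMeasurable]
  rw [integral_withDensity_eq_integral_toReal_smul₀]
  · refine setIntegral_congr_fun e.open_target.measurableSet fun z hz => ?_
    simp only [smul_eq_mul, ENNReal.toReal_ofReal (h0 e he z hz)]
  · exact ((hc e he).aemeasurable e.open_target.measurableSet).ennreal_ofReal
  · exact Filter.Eventually.of_forall fun z => ENNReal.ofReal_lt_top

/-- A continuous density is bounded on a compact neighbourhood inside a chart, so the measure is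
locally finite, and X is compact. -/
theorem isFiniteMeasure_densityMeasure [CompactSpace X] {d : Density n X}
    (H : DensityPullback id d d)
    (hc : ∀ e ∈ atlas (Fin n → ℂ) X, ContinuousOn (d e) e.target) :
    IsFiniteMeasure (densityMeasure d) := by
  have : IsLocallyFiniteMeasure (densityMeasure d) := by
    refine ⟨fun x => ?_⟩
    set e := chartAt (Fin n → ℂ) x
    have he : e ∈ atlas (Fin n → ℂ) X := chart_mem_atlas _ x
    have hx : x ∈ e.source := mem_chart_source _ x
    obtain ⟨K, hK, hKx, hKe⟩ := exists_compact_between (isCompact_singleton (x := e x))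
      e.open_target (by simpa using e.map_source hx)
    have hU : IsOpen (e.source ∩ e ⁻¹' interior K) := e.isOpen_inter_preimage isOpen_interior
    refine ⟨e.source ∩ e ⁻¹' interior K, hU.mem_nhds ⟨hx, hKx rfl⟩, ?_⟩
    rw [densityMeasure_apply_of_subset H he hU.measurableSet inter_subset_left,
      chartMeasure_apply _ _ hU.measurableSet]
    calc _ ≤ ∫⁻ z in K, ENNReal.ofReal (d e z) := by
            refine lintegral_mono_set fun z hz => ?_
            have := hz.2.2
            rw [mem_preimage, e.right_inv hz.1] at this
            exact interior_subset this
      _ < ⊤ := by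
            have hi : IntegrableOn (d e) K := ((hc e he).mono hKe).integrableOn_compact hK
            exact hi.lintegral_lt_top
  exact ⟨isCompact_univ.measure_lt_top⟩

theorem isOpenPosMeasure_densityMeasure {d : Density n X} (H : DensityPullback id d d)
    (hc : ∀ e ∈ atlas (Fin n → ℂ) X, ContinuousOn (d e) e.target)
    (h0 : ∀ e ∈ atlas (Fin n → ℂ) X, ∀ z ∈ e.target, 0 < d e z) :
    (densityMeasure d).IsOpenPosMeasure := by
  refine ⟨fun U hU ⟨x, hx⟩ hzero => ?_⟩
  set e := chartAt (Fin n → ℂ) x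
  have he : e ∈ atlas (Fin n → ℂ) X := chart_mem_atlas _ x
  have hxe : x ∈ e.source := mem_chart_source _ x
  have hV : IsOpen (U ∩ e.source) := hU.inter e.open_source
  have h1 : densityMeasure d (U ∩ e.source) = 0 := measure_mono_null inter_subset_left hzero
  rw [densityMeasure_apply_of_subset H he hV.measurableSet inter_subset_right,
    chartMeasure_apply _ _ hV.measurableSet] at h1
  have hO : IsOpen (e.target ∩ e.symm ⁻¹' (U ∩ e.source)) := e.isOpen_inter_preimage_symm hV
  rw [lintegral_eq_zero_iff'] at h1
  · have h2 : ∀ᵐ z ∂(volume.restrict (e.target ∩ e.symm ⁻¹' (U ∩ e.source))), False := by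
      filter_upwards [h1, ae_restrict_mem hO.measurableSet] with z hz hz'
      have := h0 e he z hz'.1
      simp only [Pi.zero_apply, ENNReal.ofReal_eq_zero] at hz
      linarith
    rw [Filter.eventually_false_iff_eq_bot, ae_eq_bot, Measure.restrict_eq_zero] at h2
    have := (hO.measure_eq_zero_iff (volume : Measure (Fin n → ℂ))).1 h2
    have hm : e x ∈ e.target ∩ e.symm ⁻¹' (U ∩ e.source) :=
      ⟨e.map_source hxe, by rw [mem_preimage, e.left_inv hxe]; exact ⟨hx, hxe⟩⟩
    rw [this] at hm
    exact hm
  · exact (((hc e he).mono inter_subset_left).aemeasurable hO.measurableSet).ennreal_ofReal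

end Density

/-! ### Commuting and conjugating Wirtinger derivatives -/

section WirtingerCommute

variable {n : ℕ}

theorem dzbar_dz_comm {H : (Fin n → ℂ) → ℂ} {z : Fin n → ℂ} (hH : ContDiffAt ℝ 2 H z)
    (i k : Fin n) : dzbar k (dz i H) z = dz i (dzbar k H) z := by
  have hD := ContDiffAt.differentiableAt_fderiv hH
  have hs := hH.isSymmSndFDerivAt (by simp)
  have h2 : ∀ b : Fin n → ℂ, HasFDerivAt (fun w => fderiv ℝ H w b)
      ((fderiv ℝ (fderiv ℝ H) z).flip b) z := fun b => by
    simpa using hD.hasFDerivAt.clm_apply (hasFDerivAt_const b z)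
  have h3 : ∀ i, fderiv ℝ (dz i H) z = _ := fun i =>
    (((h2 (Pi.single i 1)).sub ((h2 (Pi.single i Complex.I)).const_mul Complex.I)).mul_const
      (2 : ℂ)⁻¹).fderiv
  have h4 : ∀ i, fderiv ℝ (dzbar i H) z = _ := fun i =>
    (((h2 (Pi.single i 1)).add ((h2 (Pi.single i Complex.I)).const_mul Complex.I)).mul_const
      (2 : ℂ)⁻¹).fderiv
  simp only [dz.eq_1 _ (dzbar _ H), dzbar.eq_1 _ (dz _ H), h3, h4]
  simp only [smul_apply, sub_apply, add_apply, ContinuousLinearMap.flip_apply, smul_eq_mul]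
  rw [hs (Pi.single k 1) (Pi.single i 1), hs (Pi.single k 1) (Pi.single i Complex.I),
    hs (Pi.single k Complex.I) (Pi.single i 1), hs (Pi.single k Complex.I) (Pi.single i Complex.I)]
  ring

theorem contDiffAt_dz {H : (Fin n → ℂ) → ℂ} {z : Fin n → ℂ} (hH : ContDiffAt ℝ ∞ H z)
    (i : Fin n) : ContDiffAt ℝ ∞ (dz i H) z := by
  have h : ContDiffAt ℝ ∞ (fderiv ℝ H) z := hH.fderiv_right (by simp)
  exact ((h.clm_apply contDiffAt_const).sub (contDiffAt_const.mul
    (h.clm_apply contDiffAt_const))).div_const _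

theorem contDiffAt_dzbar {H : (Fin n → ℂ) → ℂ} {z : Fin n → ℂ} (hH : ContDiffAt ℝ ∞ H z)
    (i : Fin n) : ContDiffAt ℝ ∞ (dzbar i H) z := by
  have h : ContDiffAt ℝ ∞ (fderiv ℝ H) z := hH.fderiv_right (by simp)
  exact ((h.clm_apply contDiffAt_const).add (contDiffAt_const.mul
    (h.clm_apply contDiffAt_const))).div_const _

theorem contDiffAt_ofReal {E : Type*} [NormedAddCommGroup E] [NormedSpace ℝ E]
    {N : WithTop ℕ∞} {f : E → ℝ} {z : E} (hf : ContDiffAt ℝ N f z) :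
    ContDiffAt ℝ N (fun w => (f w : ℂ)) z :=
  Complex.ofRealCLM.contDiff.contDiffAt.comp z hf

theorem contDiffAt_wd {f : (Fin n → ℂ) → ℝ} {z : Fin n → ℂ} (hf : ContDiffAt ℝ ∞ f z)
    (a : Fin n → ℂ) : ContDiffAt ℝ ∞ (fun w => wd f w a) z := by
  have h : ContDiffAt ℝ ∞ (fderiv ℝ f) z := hf.fderiv_right (by simp)
  exact ((contDiffAt_ofReal (h.clm_apply contDiffAt_const)).sub (contDiffAt_const.mul
    (contDiffAt_ofReal (h.clm_apply contDiffAt_const)))).div_const _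

theorem dzbar_wd {f : (Fin n → ℂ) → ℝ} {z : Fin n → ℂ} (hf : ContDiffAt ℝ ∞ f z) (i j : Fin n) :
    dzbar j (fun w => wd f w (Pi.single i 1)) z = complexHessian f z i j := by
  have h1 : (fun w => wd f w (Pi.single i 1)) =ᶠ[nhds z] dz i (fun w => (f w : ℂ)) := by
    have hf1 : ContDiffAt ℝ 1 f z := hf.of_le (nat_le_infty 1)
    filter_upwards [hf1.eventually (by simp)] with y hy
    exact (dz_ofReal (hy.differentiableAt (by norm_num)) i).symm
  rw [complexHessian, Matrix.of_apply, ← dzbar_dz_comm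
    ((contDiffAt_ofReal hf).of_le (nat_le_infty 2)), dzbar.eq_1, h1.fderiv_eq]
  rfl

theorem dz_star {f : (Fin n → ℂ) → ℂ} {z : Fin n → ℂ} (hf : DifferentiableAt ℝ f z) (j : Fin n) :
    dz j (fun w => star (f w)) z = star (dzbar j f z) := by
  have h1 : fderiv ℝ (fun w => star (f w)) z = (Complex.conjCLE : ℂ →L[ℝ] ℂ).comp (fderiv ℝ f z) :=
    ((Complex.conjCLE : ℂ →L[ℝ] ℂ).hasFDerivAt.comp z hf.hasFDerivAt).fderiv
  simp only [dz, dzbar, h1]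
  simp
  ring

end WirtingerCommute

/-! ### Closed (1,1)-forms and the densities built from them -/

section ClosedForms

variable {n : ℕ} {X : Type*} [TopologicalSpace X] [ChartedSpace (Fin n → ℂ) X]
  [IsManifold 𝓘(ℂ, Fin n → ℂ) ω X]

/-- Smooth closed real (1,1)-forms. -/
structure IsClosedForm (h : CoeffForm n X) : Prop where
  smooth : ∀ e ∈ atlas (Fin n → ℂ) X, ∀ z ∈ e.target, ∀ i j, ContDiffAt ℝ ∞ (fun z => h e z i j) z
  compatible : IsPullback id h h
  hermitian : ∀ e ∈ atlas (Fin n → ℂ) X, ∀ z ∈ e.target, (h e z).IsHermitian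
  closed : ∀ e ∈ atlas (Fin n → ℂ) X, ∀ z ∈ e.target, ∀ i j k,
    dz k (fun w => h e w i j) z = dz i (fun w => h e w k j) z

theorem IsKahlerForm.isClosedForm {h : CoeffForm n X} (H : IsKahlerForm h) : IsClosedForm h where
  smooth e he _ hz i j := (H.smooth e he i j).contDiffAt (e.open_target.mem_nhds hz)
  compatible := H.compatible
  hermitian e he _ hz := (H.positive e he _ hz).isHermitian
  closed := H.closed

theorem IsSmooth.contDiffAt_ddbar {φ : X → ℝ} (hφ : IsSmooth n φ)
    {e : OpenPartialHomeomorph X (Fin n → ℂ)} (he : e ∈ atlas (Fin n → ℂ) X)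
    {z : Fin n → ℂ} (hz : z ∈ e.target) (i j : Fin n) :
    ContDiffAt ℝ ∞ (fun w => (ddbar φ : CoeffForm n X) e w i j) z :=
  contDiffAt_dz (contDiffAt_dzbar (contDiffAt_ofReal (hφ.contDiffAt he hz)) j) i

theorem isClosedForm_ddbar {φ : X → ℝ} (hφ : IsSmooth n φ) :
    IsClosedForm (ddbar φ : CoeffForm n X) where
  smooth e he z hz i j := hφ.contDiffAt_ddbar he hz i j
  compatible := isPullback_ddbar isHolo_id hφ
  hermitian e he z hz := complexHessian_isHermitian
    ((hφ.contDiffAt he hz).of_le (nat_le_infty 2))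
  closed e he z hz i j k := by
    simp only [ddbar, complexHessian, Matrix.of_apply]
    exact dz_comm ((contDiffAt_dzbar (contDiffAt_ofReal (hφ.contDiffAt he hz)) j).of_le
      (nat_le_infty 2)) i k

theorem dz_add {f g : (Fin n → ℂ) → ℂ} {z : Fin n → ℂ} (hf : DifferentiableAt ℝ f z)
    (hg : DifferentiableAt ℝ g z) (j : Fin n) :
    dz j (fun w => f w + g w) z = dz j f z + dz j g z := by
  simp only [dz, fderiv_fun_add hf hg, add_apply]
  ring

theorem IsClosedForm.add {h k : CoeffForm n X} (H : IsClosedForm h) (K : IsClosedForm k) :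
    IsClosedForm (fun e z => h e z + k e z : CoeffForm n X) where
  smooth e he z hz i j := (H.smooth e he z hz i j).add (K.smooth e he z hz i j)
  compatible := H.compatible.add K.compatible
  hermitian e he z hz := (H.hermitian e he z hz).add (K.hermitian e he z hz)
  closed e he z hz i j k := by
    simp only [Matrix.add_apply]
    rw [dz_add ((H.smooth e he z hz i j).differentiableAt (by simp))
      ((K.smooth e he z hz i j).differentiableAt (by simp)),
      dz_add ((H.smooth e he z hz k j).differentiableAt (by simp))
      ((K.smooth e he z hz k j).differentiableAt (by simp)), H.closed e he z hz, K.closed e he z hz]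

theorem IsClosedForm.perturb {h : CoeffForm n X} (H : IsClosedForm h) {φ : X → ℝ}
    (hφ : IsSmooth n φ) : IsClosedForm (perturb h φ) := H.add (isClosedForm_ddbar hφ)

/-- Closedness is assumed for ∂ only; conjugating, with h Hermitian, turns it into the ∂̄ version
that the Piola identity uses. -/
theorem IsClosedForm.closed_dzbar {h : CoeffForm n X} (H : IsClosedForm h)
    {e : OpenPartialHomeomorph X (Fin n → ℂ)} (he : e ∈ atlas (Fin n → ℂ) X)
    {z : Fin n → ℂ} (hz : z ∈ e.target) (i j k : Fin n) :
    dzbar k (fun w => h e w i j) z = dzbar j (fun w => h e w i k) z := by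
  have h1 : ∀ a b, (fun w => h e w a b) =ᶠ[nhds z] fun w => star (h e w b a) := fun a b => by
    filter_upwards [e.open_target.mem_nhds hz] with w hw
    exact ((H.hermitian e he w hw).apply a b).symm
  have hd : ∀ a b, DifferentiableAt ℝ (fun w => h e w a b) z := fun a b =>
    (H.smooth e he z hz a b).differentiableAt (by simp)
  have h2 : ∀ a b c, dzbar c (fun w => h e w a b) z = star (dz c (fun w => h e w b a) z) := by
    intro a b c
    have h3 : dz c (fun w => h e w b a) z = dz c (fun w => star (h e w a b)) z := by
      simp only [dz, (h1 b a).fderiv_eq]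
    rw [h3, dz_star (hd a b), star_star]
  rw [h2, h2, H.closed e he z hz]

theorem det_re_eq {A : Matrix (Fin n) (Fin n) ℂ} (hA : A.IsHermitian) : (A.det.re : ℂ) = A.det := by
  have h : star A.det = A.det := by rw [← Matrix.det_conjTranspose, hA.eq]
  exact Complex.conj_eq_iff_re.1 h

theorem PosDef_det_re_pos {A : Matrix (Fin n) (Fin n) ℂ} (hA : A.PosDef) : 0 < A.det.re :=
  (Complex.lt_def.1 hA.det_pos).1

/-- `∂v ⊗ ∂̄u`. -/
def gradForm (v u : X → ℝ) : CoeffForm n X := fun e z => Matrix.of fun i j =>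
  wd (fun w => v (e.symm w)) z (Pi.single i 1) * star (wd (fun w => u (e.symm w)) z (Pi.single j 1))

/-- The density `det h` of the top power of `h`. -/
def detDensity (h : CoeffForm n X) : Density n X := fun e z => (h e z).det.re

/-- The density of `k ∧ hⁿ⁻¹`, the derivative of `det h` in the direction `k`. -/
def traceDensity (h k : CoeffForm n X) : Density n X :=
  fun e z => ((h e z).adjugate * k e z).trace.re

theorem wd_chart {σ : X → X} (hσ : IsHolo n σ) {v : X → ℝ} (hv : IsSmooth n v)
    {e e' : OpenPartialHomeomorph X (Fin n → ℂ)} (he : e ∈ atlas (Fin n → ℂ) X)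
    (he' : e' ∈ atlas (Fin n → ℂ) X) {z : Fin n → ℂ} (hz : z ∈ e.target)
    (hz' : σ (e.symm z) ∈ e'.source) (a : Fin n → ℂ) :
    wd (fun w => v (σ (e.symm w))) z a =
      wd (fun w => v (e'.symm w)) (e' (σ (e.symm z)))
        (fderiv ℂ (fun w => e' (σ (e.symm w))) z a) := by
  have h1 := (hσ.contDiffAt he he' hz hz').differentiableAt (by simp)
  have h2 := (hv.contDiffAt he' (e'.map_source hz')).differentiableAt (by simp)
  rw [← wd_comp (τ := fun w => e' (σ (e.symm w))) h2 h1]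
  have hc : ContinuousAt (fun w => σ (e.symm w)) z :=
    hσ.continuous.continuousAt.comp (e.continuousAt_symm hz)
  have h3 : (fun w => v (σ (e.symm w))) =ᶠ[nhds z] fun w => v (e'.symm (e' (σ (e.symm w)))) := by
    filter_upwards [hc.eventually (e'.open_source.mem_nhds hz')] with y hy
    simp [e'.left_inv hy]
  simp only [wd, h3.fderiv_eq]

theorem isPullback_gradForm {u v : X → ℝ} (hu : IsSmooth n u)
    (hv : IsSmooth n v) : IsPullback id (gradForm v u : CoeffForm n X) (gradForm v u) := by
  intro e he e' he' z hz hz'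
  have h1 := fun a => wd_chart isHolo_id hu he he' hz hz' a
  have h2 := fun a => wd_chart isHolo_id hv he he' hz hz' a
  ext i j
  simp only [id] at h1 h2 ⊢
  simp only [gradForm, Matrix.mul_apply, Matrix.of_apply, Matrix.transpose_apply, Matrix.map_apply,
    h1, h2, complexJacobian]
  rw [wd_eq_sum, wd_eq_sum _ _ (fderiv ℂ _ _ (Pi.single j 1)), star_sum, Finset.sum_mul_sum,
    Finset.sum_comm]
  refine Finset.sum_congr rfl fun k _ => ?_
  rw [Finset.sum_mul]
  refine Finset.sum_congr rfl fun l _ => ?_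
  rw [star_mul']
  ring

theorem map_star_det (J : Matrix (Fin n) (Fin n) ℂ) : (J.map star).det = star J.det := by
  have := (starRingEnd ℂ).map_det J
  simpa [RingHom.mapMatrix_apply] using this.symm

theorem IsPullback.densityPullback_det {σ : X → X} {h h' : CoeffForm n X} (H : IsPullback σ h h') :
    DensityPullback σ (detDensity h) (detDensity h') := by
  intro e he e' he' z hz hz'
  simp only [detDensity]
  rw [H.det he he' hz hz', Complex.re_ofReal_mul]

/-- The adjugate reverses products, so the inner adj(Jᵗ)·Jᵗ collapses to det J, and cyclicity of the
trace produces the conjugate factor. Together they form |det J|². -/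
theorem IsPullback.densityPullback_trace {σ : X → X} {h h' k k' : CoeffForm n X}
    (H : IsPullback σ h h') (K : IsPullback σ k k') :
    DensityPullback σ (traceDensity h k) (traceDensity h' k') := by
  intro e he e' he' z hz hz'
  simp only [traceDensity]
  rw [H e he e' he' z hz hz', K e he e' he' z hz hz']
  simp only
  set J := complexJacobian (fun w => e' (σ (e.symm w))) z
  set A := h e' (e' (σ (e.symm z)))
  set B := k e' (e' (σ (e.symm z)))
  have h1 : (J.transpose * A * J.map star).adjugate * (J.transpose * B * J.map star) =
      J.det • ((J.map star).adjugate * (A.adjugate * B * J.map star)) := by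
    rw [Matrix.adjugate_mul_distrib, Matrix.adjugate_mul_distrib]
    calc _ = (J.map star).adjugate * (A.adjugate * ((J.transpose.adjugate * J.transpose) *
              (B * J.map star))) := by simp only [Matrix.mul_assoc]
      _ = _ := by
        rw [Matrix.adjugate_mul, Matrix.det_transpose]
        simp only [Matrix.smul_mul, Matrix.one_mul, Matrix.mul_smul, Matrix.mul_assoc]
  rw [h1, Matrix.trace_smul, Matrix.trace_mul_comm, Matrix.mul_assoc, Matrix.mul_adjugate,
    map_star_det, Matrix.mul_smul, Matrix.mul_one, Matrix.trace_smul, smul_eq_mul, smul_eq_mul,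
    ← mul_assoc]
  have : J.det * star J.det = (Complex.normSq J.det : ℂ) := Complex.mul_conj _
  rw [this, Complex.re_ofReal_mul]

theorem DensityPullback.add {σ : X → X} {d d' k k' : Density n X} (H : DensityPullback σ d d')
    (K : DensityPullback σ k k') :
    DensityPullback σ (fun e z => d e z + k e z) (fun e z => d' e z + k' e z) := by
  intro e he e' he' z hz hz'
  simp only
  rw [H e he e' he' z hz hz', K e he e' he' z hz hz']; ring

theorem DensityPullback.mul {σ : X → X} {d d' : Density n X} (H : DensityPullback σ d d')
    (f : X → ℝ) :
    DensityPullback σ (fun e z => f (e.symm z) * d e z)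
      (fun e z => f (σ (e.symm z)) * d' e z) := by
  intro e he e' he' z hz hz'
  simp only
  rw [H e he e' he' z hz hz', e'.left_inv hz']; ring

/-- The function `d / ω₀ⁿ` on `X`. -/
def ratio (ω₀ : CoeffForm n X) (d : Density n X) (x : X) : ℝ :=
  d (chartAt (Fin n → ℂ) x) (chartAt (Fin n → ℂ) x x) /
    (ω₀ (chartAt (Fin n → ℂ) x) (chartAt (Fin n → ℂ) x x)).det.re

/-- Numerator and denominator acquire the same Jacobian factor, so the quotient taken in the
preferred chart may be computed in any chart. That factor is nonzero because it relates positive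
determinants of ω₀. -/
theorem ratio_symm {ω₀ : CoeffForm n X} (hω₀ : IsKahlerForm ω₀) {d : Density n X}
    (hd : DensityPullback id d d) {e : OpenPartialHomeomorph X (Fin n → ℂ)}
    (he : e ∈ atlas (Fin n → ℂ) X) {z : Fin n → ℂ} (hz : z ∈ e.target) :
    ratio ω₀ d (e.symm z) = d e z / (ω₀ e z).det.re := by
  set x := e.symm z
  set e' := chartAt (Fin n → ℂ) x
  have he' : e' ∈ atlas (Fin n → ℂ) X := chart_mem_atlas _ x
  have hx : x ∈ e'.source := mem_chart_source _ x
  have h1 := hd e he e' he' z hz hx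
  have h2 := hω₀.compatible.densityPullback_det e he e' he' z hz hx
  simp only [detDensity] at h2
  have hp := PosDef_det_re_pos (hω₀.positive e he z hz)
  rw [h2] at hp
  have hJ : Complex.normSq (complexJacobian (fun w => e' (id (e.symm w))) z).det ≠ 0 := by
    intro h; rw [h, zero_mul] at hp; exact lt_irrefl _ hp
  rw [ratio, h1, h2, mul_div_mul_left _ _ hJ]
  rfl

/-- The preferred chart jumps from point to point, so continuity is checked in one fixed chart near
the point. The parameter serves families of potentials under an integral sign. -/
theorem continuousAt_ratio {P : Type*} [TopologicalSpace P] {ω₀ : CoeffForm n X}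
    (hω₀ : IsKahlerForm ω₀) {d : P → Density n X}
    (hd : ∀ p, DensityPullback id (d p) (d p))
    (hc : ∀ e ∈ atlas (Fin n → ℂ) X, ∀ p, ∀ z ∈ e.target,
      ContinuousAt (fun q : P × (Fin n → ℂ) => d q.1 e q.2) (p, z)) :
    Continuous fun q : P × X => ratio ω₀ (d q.1) q.2 := by
  refine continuous_iff_continuousAt.2 fun ⟨p, x⟩ => ?_
  set e := chartAt (Fin n → ℂ) x
  have he : e ∈ atlas (Fin n → ℂ) X := chart_mem_atlas _ x
  have hx : x ∈ e.source := mem_chart_source _ x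
  have h1 : (fun q : P × X => ratio ω₀ (d q.1) q.2) =ᶠ[nhds (p, x)]
      fun q => d q.1 e (e q.2) / (ω₀ e (e q.2)).det.re := by
    filter_upwards [(continuousAt_snd (p := (p, x))).eventually (e.open_source.mem_nhds hx)] with q hq
    rw [← ratio_symm hω₀ (hd q.1) he (e.map_source hq), e.left_inv hq]
  refine ContinuousAt.congr ?_ h1.symm
  have hex : ContinuousAt (fun q : P × X => e q.2) (p, x) :=
    (e.continuousAt hx).comp (f := Prod.snd) continuousAt_snd
  refine ContinuousAt.div ?_ ?_ (PosDef_det_re_pos (hω₀.positive e he _ (e.map_source hx))).ne'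
  · exact ContinuousAt.comp (g := fun q : P × (Fin n → ℂ) => d q.1 e q.2)
      (f := fun q : P × X => (q.1, e q.2)) (hc e he p _ (e.map_source hx))
      (continuousAt_fst.prodMk hex)
  · have h2 : ContinuousAt (fun w => (ω₀ e w).det.re) (e x) :=
      Complex.continuous_re.continuousAt.comp (contDiffAt_det
        (hω₀.isClosedForm.smooth e he _ (e.map_source hx))).continuousAt
    exact ContinuousAt.comp (f := fun q : P × X => e q.2) h2 hex

theorem continuous_ratio {ω₀ : CoeffForm n X}
    (hω₀ : IsKahlerForm ω₀) {d : Density n X} (hd : DensityPullback id d d)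
    (hc : ∀ e ∈ atlas (Fin n → ℂ) X, ∀ z ∈ e.target, ContinuousAt (d e) z) :
    Continuous (ratio ω₀ d) := by
  have := continuousAt_ratio (P := Unit) hω₀ (d := fun _ => d) (fun _ => hd)
    (fun e he p z hz => ContinuousAt.comp (f := Prod.snd) (hc e he z hz) continuousAt_snd)
  exact this.comp (continuous_const.prodMk continuous_id : Continuous fun x : X => ((), x))

end ClosedForms

/-! ### Divergences of compactly supported fields on ℂⁿ -/

section CompactlySupported

variable {n : ℕ}

/-- Integration by parts against the constant function 1. -/
theorem integral_fderiv_apply_eq_zero {f : (Fin n → ℂ) → ℂ} (hf : ContDiff ℝ 1 f)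
    (hc : HasCompactSupport f) (a : Fin n → ℂ) : ∫ z, fderiv ℝ f z a = 0 := by
  have hd : Continuous fun z => fderiv ℝ f z a :=
    (hf.continuous_fderiv (by norm_num)).clm_apply continuous_const
  have hcd : HasCompactSupport fun z => fderiv ℝ f z a :=
    hc.fderiv_apply ℝ a
  have h := integral_bilinear_fderiv_right_eq_neg_left_of_integrable (μ := volume)
    (f := fun _ : Fin n → ℂ => (1 : ℂ)) (g := f) (v := a)
    (B := ContinuousLinearMap.mul ℝ ℂ) (by simp)
    (by simpa using hd.integrable_of_hasCompactSupport hcd)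
    (by simpa using hf.continuous.integrable_of_hasCompactSupport hc)
    (by simp) (fun x _ => hf.differentiable (by norm_num) x)
  simpa using h

theorem integral_dzbar_eq_zero {f : (Fin n → ℂ) → ℂ} (hf : ContDiff ℝ 1 f)
    (hc : HasCompactSupport f) (j : Fin n) :
    Integrable (dzbar j f) ∧ ∫ z, dzbar j f z = 0 := by
  have hi : ∀ a, Integrable fun z => fderiv ℝ f z a := fun a =>
    ((hf.continuous_fderiv (by norm_num)).clm_apply continuous_const).integrable_of_hasCompactSupport
      (hc.fderiv_apply ℝ a)
  refine ⟨((hi _).add ((hi _).const_mul _)).div_const _, ?_⟩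
  simp only [dzbar]
  rw [integral_div, integral_add (hi _) ((hi _).const_mul _), integral_const_mul,
    integral_fderiv_apply_eq_zero hf hc, integral_fderiv_apply_eq_zero hf hc]
  simp

end CompactlySupported

/-! ### Volume measures of forms relative to ω₀ⁿ -/

section Volume

variable {n : ℕ} {X : Type*} [TopologicalSpace X] [ChartedSpace (Fin n → ℂ) X]
  [IsManifold 𝓘(ℂ, Fin n → ℂ) ω X] [MeasurableSpace X] [BorelSpace X]

/-- The density of `hⁿ`. -/
def volDensity (h : CoeffForm n X) : Density n X :=
  fun e z => 2 ^ n * (n.factorial : ℝ) * (h e z).det.re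

theorem volConst_pos (n : ℕ) : (0 : ℝ) < 2 ^ n * (n.factorial : ℝ) := by positivity

theorem IsPullback.densityPullback_vol {σ : X → X} {h h' : CoeffForm n X} (H : IsPullback σ h h') :
    DensityPullback σ (volDensity h) (volDensity h') := by
  intro e he e' he' z hz hz'
  have := H.densityPullback_det e he e' he' z hz hz'
  simp only [detDensity, volDensity] at this ⊢
  rw [this]; ring

theorem IsClosedForm.continuousAt_det {h : CoeffForm n X} (H : IsClosedForm h)
    {e : OpenPartialHomeomorph X (Fin n → ℂ)} (he : e ∈ atlas (Fin n → ℂ) X)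
    {z : Fin n → ℂ} (hz : z ∈ e.target) : ContinuousAt (fun w => (h e w).det.re) z :=
  Complex.continuous_re.continuousAt.comp (contDiffAt_det (H.smooth e he z hz)).continuousAt

theorem IsClosedForm.continuousOn_volDensity {h : CoeffForm n X} (H : IsClosedForm h)
    {e : OpenPartialHomeomorph X (Fin n → ℂ)} (he : e ∈ atlas (Fin n → ℂ) X) :
    ContinuousOn (volDensity h e) e.target := fun _ hz =>
  (continuousAt_const.mul (H.continuousAt_det he hz)).continuousWithinAt

theorem IsPositive.volDensity_pos {h : CoeffForm n X} (H : IsPositive h)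
    {e : OpenPartialHomeomorph X (Fin n → ℂ)} (he : e ∈ atlas (Fin n → ℂ) X)
    {z : Fin n → ℂ} (hz : z ∈ e.target) : 0 < volDensity h e z :=
  mul_pos (volConst_pos n) (PosDef_det_re_pos (H e he z hz))

theorem isFiniteMeasure_vol [CompactSpace X] {h : CoeffForm n X} (H : IsClosedForm h) :
    IsFiniteMeasure (vol h) :=
  isFiniteMeasure_densityMeasure H.compatible.densityPullback_vol fun _ he =>
    H.continuousOn_volDensity he

theorem isOpenPosMeasure_vol {h : CoeffForm n X} (H : IsClosedForm h) (hp : IsPositive h) :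
    (vol h).IsOpenPosMeasure :=
  isOpenPosMeasure_densityMeasure H.compatible.densityPullback_vol
    (fun _ he => H.continuousOn_volDensity he) fun _ he _ hz => hp.volDensity_pos he hz

theorem integral_vol_pullback [CompactSpace X] {σ : X ≃ₜ X} (hσ : IsHolo n σ) {h h' : CoeffForm n X}
    (H : IsPullback id h h) (H' : IsPullback id h' h') (hp : IsPullback σ h h') (f : X → ℝ) :
    ∫ x, f (σ x) ∂(vol h') = ∫ x, f x ∂(vol h) := by
  have := densityMeasure_map hσ H.densityPullback_vol H'.densityPullback_vol hp.densityPullback_vol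
  change _ = ∫ x, f x ∂(densityMeasure (volDensity h))
  rw [← this]
  exact (integral_map_equiv σ.toMeasurableEquiv f).symm

variable {ω₀ : CoeffForm n X}

theorem IsClosedForm.continuous_ratio_det (hω₀ : IsKahlerForm ω₀) {h : CoeffForm n X}
    (H : IsClosedForm h) : Continuous (ratio ω₀ (detDensity h)) :=
  continuous_ratio hω₀ H.compatible.densityPullback_det fun _ he _ hz => H.continuousAt_det he hz

theorem ratio_det_pos (hω₀ : IsKahlerForm ω₀) {h : CoeffForm n X} (hp : IsPositive h) (x : X) :
    0 < ratio ω₀ (detDensity h) x :=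
  div_pos (PosDef_det_re_pos (hp _ (chart_mem_atlas _ x) _ (mem_chart_target _ x)))
    (PosDef_det_re_pos (hω₀.positive _ (chart_mem_atlas _ x) _ (mem_chart_target _ x)))

theorem vol_eq_withDensity [CompactSpace X] (hω₀ : IsKahlerForm ω₀) {h : CoeffForm n X}
    (H : IsClosedForm h) :
    vol h = (vol ω₀).withDensity fun x => ENNReal.ofReal (ratio ω₀ (detDensity h) x) := by
  refine densityMeasure_eq_withDensity H.compatible.densityPullback_vol
    hω₀.compatible.densityPullback_vol (fun e he => hω₀.isClosedForm.continuousOn_volDensity he)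
    (fun e he z hz => (hω₀.positive.volDensity_pos he hz).le) (H.continuous_ratio_det hω₀)
    fun e he z hz => ?_
  rw [ratio_symm hω₀ H.compatible.densityPullback_det he hz, detDensity]
  have := PosDef_det_re_pos (hω₀.positive e he z hz)
  simp only [volDensity]
  field_simp

/-- Moves integrals onto the fixed measure ω₀ⁿ, so that a varying potential appears only in the
integrand and can be differentiated under the integral sign. -/
theorem integral_vol [CompactSpace X] (hω₀ : IsKahlerForm ω₀) {h : CoeffForm n X}
    (H : IsClosedForm h) (hp : IsPositive h) (f : X → ℝ) :
    ∫ x, f x ∂(vol h) = ∫ x, f x * ratio ω₀ (detDensity h) x ∂(vol ω₀) := by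
  rw [vol_eq_withDensity hω₀ H, integral_withDensity_eq_integral_toReal_smul
    (H.continuous_ratio_det hω₀).measurable.ennreal_ofReal
    (Filter.Eventually.of_forall fun _ => ENNReal.ofReal_lt_top)]
  refine integral_congr_ae (Filter.Eventually.of_forall fun x => ?_)
  simp only [ENNReal.toReal_ofReal (ratio_det_pos hω₀ hp x).le, smul_eq_mul, mul_comm]

theorem integrable_of_continuous [CompactSpace X] (hω₀ : IsKahlerForm ω₀) {f : X → ℝ}
    (hf : Continuous f) : Integrable f (vol ω₀) := by
  have := isFiniteMeasure_vol hω₀.isClosedForm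
  exact hf.integrable_of_hasCompactSupport (HasCompactSupport.of_compactSpace f)

end Volume

/-! ### Integration by parts on X -/

section Stokes

variable {n : ℕ} {X : Type*} [TopologicalSpace X] [ChartedSpace (Fin n → ℂ) X]
  [IsManifold 𝓘(ℂ, Fin n → ℂ) ω X] [MeasurableSpace X] [BorelSpace X] {ω₀ : CoeffForm n X}

/-- The density of the exact form `√-1 ∂̄(u ∂v) ∧ hⁿ⁻¹`. -/
def exactDensity (h : CoeffForm n X) (v u : X → ℝ) : Density n X := fun e z =>
  u (e.symm z) * traceDensity h (ddbar v) e z + traceDensity h (gradForm v u) e z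

theorem densityPullback_exactDensity {h : CoeffForm n X} (H : IsClosedForm h) {u v : X → ℝ}
    (hu : IsSmooth n u) (hv : IsSmooth n v) :
    DensityPullback id (exactDensity h v u) (exactDensity h v u) :=
  DensityPullback.add
    ((H.compatible.densityPullback_trace (isClosedForm_ddbar hv).compatible).mul u)
    (H.compatible.densityPullback_trace (isPullback_gradForm hu hv))

/-- The vector field whose divergence is `exactDensity`. -/
def exactField (h : CoeffForm n X) (v u : X → ℝ) (e : OpenPartialHomeomorph X (Fin n → ℂ))
    (j : Fin n) (z : Fin n → ℂ) : ℂ :=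
  (u (e.symm z) : ℂ) * ∑ i, (h e z).adjugate j i * wd (fun w => v (e.symm w)) z (Pi.single i 1)

theorem contDiffAt_exactField {h : CoeffForm n X} (H : IsClosedForm h) {u v : X → ℝ}
    (hu : IsSmooth n u) (hv : IsSmooth n v) {e : OpenPartialHomeomorph X (Fin n → ℂ)}
    (he : e ∈ atlas (Fin n → ℂ) X) {z : Fin n → ℂ} (hz : z ∈ e.target) (j : Fin n) :
    ContDiffAt ℝ ∞ (exactField h v u e j) z :=
  (contDiffAt_ofReal (hu.contDiffAt he hz)).mul (ContDiffAt.sum fun i _ =>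
    (contDiffAt_adjugate (H.smooth e he z hz) j i).mul (contDiffAt_wd (hv.contDiffAt he hz) _))

/-- In the product rule for u · adj h · ∂v, the terms that differentiate adj h cancel by the Piola
identity. What remains is u tr(adj h ∂∂̄v) plus the gradient term. -/
theorem sum_dzbar_exactField {h : CoeffForm n X} (H : IsClosedForm h) {u v : X → ℝ}
    (hu : IsSmooth n u) (hv : IsSmooth n v) {e : OpenPartialHomeomorph X (Fin n → ℂ)}
    (he : e ∈ atlas (Fin n → ℂ) X) {z : Fin n → ℂ} (hz : z ∈ e.target) :
    exactDensity h v u e z = (∑ j, dzbar j (exactField h v u e j) z).re := by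
  have hu' : DifferentiableAt ℝ (fun w => u (e.symm w)) z :=
    (hu.contDiffAt he hz).differentiableAt (by simp)
  have hud : DifferentiableAt ℝ (fun w => (u (e.symm w) : ℂ)) z :=
    (contDiffAt_ofReal (hu.contDiffAt he hz)).differentiableAt (by simp)
  have hMd : ∀ i j, DifferentiableAt ℝ (fun w => h e w i j) z := fun i j =>
    (H.smooth e he z hz i j).differentiableAt (by simp)
  have hAd : ∀ i j, DifferentiableAt ℝ (fun w => (h e w).adjugate i j) z :=
    differentiableAt_adjugate hMd
  have hvd : ∀ i, DifferentiableAt ℝ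
      (fun w => wd (fun w => v (e.symm w)) w (Pi.single i 1)) z := fun i =>
    (contDiffAt_wd (hv.contDiffAt he hz) _).differentiableAt (by simp)
  have hP := piola (M := h e) hMd (fun i j k => H.closed_dzbar he hz i j k)
  set p : Fin n → ℂ := fun i => wd (fun w => v (e.symm w)) z (Pi.single i 1) with hp
  have h1 : ∀ j, dzbar j (exactField h v u e j) z =
      star (wd (fun w => u (e.symm w)) z (Pi.single j 1)) * ∑ i, (h e z).adjugate j i * p i +
      (u (e.symm z) : ℂ) * (∑ i, (dzbar j (fun w => (h e w).adjugate j i) z * p i +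
        (h e z).adjugate j i * (ddbar v : CoeffForm n X) e z i j)) := by
    intro j
    unfold exactField
    rw [dzbar_mul hud (DifferentiableAt.fun_sum fun i _ => (hAd j i).fun_mul (hvd i)),
      dzbar_ofReal hu', dzbar_sum _ fun i _ => (hAd j i).fun_mul (hvd i)]
    congr 2
    refine Finset.sum_congr rfl fun i _ => ?_
    rw [dzbar_mul (hAd j i) (hvd i), dzbar_wd (hv.contDiffAt he hz)]
    rfl
  have h2 : ∑ j, dzbar j (exactField h v u e j) z =
      (u (e.symm z) : ℂ) * ((h e z).adjugate * (ddbar v : CoeffForm n X) e z).trace +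
        ((h e z).adjugate * gradForm v u e z).trace := by
    simp only [h1, Finset.sum_add_distrib, ← Finset.mul_sum, mul_add]
    have e1 : ∑ j, ∑ i, dzbar j (fun w => (h e w).adjugate j i) z * p i = 0 := by
      rw [Finset.sum_comm]
      refine Finset.sum_eq_zero fun i _ => ?_
      rw [← Finset.sum_mul, hP i, zero_mul]
    have e2 : ∑ j, ∑ i, (h e z).adjugate j i * (ddbar v : CoeffForm n X) e z i j =
        ((h e z).adjugate * (ddbar v : CoeffForm n X) e z).trace := by
      simp [Matrix.trace, Matrix.mul_apply]
    have e3 : ∑ j, star (wd (fun w => u (e.symm w)) z (Pi.single j 1)) *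
        ∑ i, (h e z).adjugate j i * p i = ((h e z).adjugate * gradForm v u e z).trace := by
      simp only [Matrix.trace, Matrix.diag, Matrix.mul_apply, gradForm, Matrix.of_apply,
        Finset.mul_sum]
      refine Finset.sum_congr rfl fun j _ => Finset.sum_congr rfl fun i _ => ?_
      simp only [hp]; ring
    rw [e1, e2, e3]; ring
  rw [h2, Complex.add_re, Complex.re_ofReal_mul]
  rfl

theorem continuousAt_exactDensity {h : CoeffForm n X} (H : IsClosedForm h) {u v : X → ℝ}
    (hu : IsSmooth n u) (hv : IsSmooth n v) {e : OpenPartialHomeomorph X (Fin n → ℂ)}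
    (he : e ∈ atlas (Fin n → ℂ) X) {z : Fin n → ℂ} (hz : z ∈ e.target) :
    ContinuousAt (exactDensity h v u e) z := by
  have h1 : ContinuousAt (fun z => (∑ j, dzbar j (exactField h v u e j) z).re) z :=
    Complex.continuous_re.continuousAt.comp (tendsto_finsetSum _ fun j _ =>
      (contDiffAt_dzbar (contDiffAt_exactField H hu hv he hz j) j).continuousAt)
  refine h1.congr ?_
  filter_upwards [e.open_target.mem_nhds hz] with w hw
  exact (sum_dzbar_exactField H hu hv he hw).symm

theorem continuous_ratio_exactDensity (hω₀ : IsKahlerForm ω₀) {h : CoeffForm n X}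
    (H : IsClosedForm h) {u v : X → ℝ} (hu : IsSmooth n u) (hv : IsSmooth n v) :
    Continuous (ratio ω₀ (exactDensity h v u)) :=
  continuous_ratio hω₀ (densityPullback_exactDensity H hu hv) fun _ he _ hz =>
    continuousAt_exactDensity H hu hv he hz

theorem stokes_of_tsupport_subset [CompactSpace X] [T2Space X] (hω₀ : IsKahlerForm ω₀)
    {h : CoeffForm n X} (H : IsClosedForm h) {u v : X → ℝ} (hu : IsSmooth n u) (hv : IsSmooth n v)
    {e : OpenPartialHomeomorph X (Fin n → ℂ)} (he : e ∈ atlas (Fin n → ℂ) X)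
    (hsupp : tsupport u ⊆ e.source) :
    ∫ x, ratio ω₀ (exactDensity h v u) x ∂(vol ω₀) = 0 := by
  have hcomp := densityPullback_exactDensity H hu hv
  set K := e '' tsupport u with hK
  have hKc : IsCompact K := (isClosed_tsupport u).isCompact.image_of_continuousOn
    (e.continuousOn.mono hsupp)
  have hKe : K ⊆ e.target := by
    rintro _ ⟨x, hx, rfl⟩; exact e.map_source (hsupp hx)
  have hu0 : ∀ z ∈ e.target, z ∉ K → u (e.symm z) = 0 := by
    intro z hz hzK
    by_contra h0
    exact hzK ⟨e.symm z, subset_tsupport u h0, e.right_inv hz⟩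
  -- vanishing off the chart
  have hout : ∀ x, x ∉ e.source → ratio ω₀ (exactDensity h v u) x = 0 := by
    intro x hx
    have hx' : x ∉ tsupport u := fun h => hx (hsupp h)
    set e' := chartAt (Fin n → ℂ) x
    have hex : x ∈ e'.source := mem_chart_source _ x
    have hev : (fun w => u (e'.symm w)) =ᶠ[nhds (e' x)] fun _ => 0 := by
      have h1 : u =ᶠ[nhds x] 0 := notMem_tsupport_iff_eventuallyEq.1 hx'
      have h2 : Filter.Tendsto e'.symm (nhds (e' x)) (nhds x) := by
        have := e'.continuousAt_symm (e'.map_source hex)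
        rwa [ContinuousAt, e'.left_inv hex] at this
      exact h2.eventually h1
    have hw : ∀ a, wd (fun w => u (e'.symm w)) (e' x) a = 0 := fun a => by
      simp only [wd, hev.fderiv_eq]; simp
    have h3 : exactDensity h v u e' (e' x) = 0 := by
      have h4 : gradForm v u e' (e' x) = 0 := by
        ext i j; simp [gradForm, hw]
      have h5 : u (e'.symm (e' x)) = 0 := hev.self_of_nhds
      simp only [exactDensity, traceDensity, h4, h5]
      simp
    rw [ratio]
    change exactDensity h v u e' (e' x) / _ = 0
    rw [h3, zero_div]
  -- the compactly supported vector field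
  set f : Fin n → (Fin n → ℂ) → ℂ := fun j => e.target.indicator (exactField h v u e j) with hf
  have hfev : ∀ j, ∀ z ∈ e.target, f j =ᶠ[nhds z] exactField h v u e j := fun j z hz => by
    filter_upwards [e.open_target.mem_nhds hz] with w hw
    simp [hf, hw]
  have hfK : ∀ j, ∀ z ∉ K, f j z = 0 := fun j z hz => by
    by_cases h1 : z ∈ e.target
    · simp [hf, h1, exactField, hu0 z h1 hz]
    · simp [hf, h1]
  have hf0 : ∀ j, ∀ z ∉ K, f j =ᶠ[nhds z] fun _ => 0 := fun j z hz => by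
    filter_upwards [hKc.isClosed.isOpen_compl.mem_nhds hz] with w hw
    exact hfK j w hw
  -- The field vanishes off the compact set K inside the target, so the extension by zero is smooth
  -- also at the boundary of the target.
  have hfc : ∀ j, ContDiff ℝ 1 (f j) := fun j => contDiff_iff_contDiffAt.2 fun z => by
    by_cases hz : z ∈ e.target
    · exact ((contDiffAt_exactField H hu hv he hz j).of_le (nat_le_infty 1)).congr_of_eventuallyEq
        (hfev j z hz)
    · exact contDiffAt_const.congr_of_eventuallyEq (hf0 j z fun h => hz (hKe h))
  have hfs : ∀ j, HasCompactSupport (f j) := fun j =>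
    HasCompactSupport.intro hKc (hfK j)
  have hsum : ∫ z, ∑ j, dzbar j (f j) z = 0 := by
    rw [integral_finsetSum _ fun j _ => (integral_dzbar_eq_zero (hfc j) (hfs j) j).1]
    exact Finset.sum_eq_zero fun j _ => (integral_dzbar_eq_zero (hfc j) (hfs j) j).2
  have hint : Integrable fun z => ∑ j, dzbar j (f j) z :=
    integrable_finsetSum _ fun j _ => (integral_dzbar_eq_zero (hfc j) (hfs j) j).1
  rw [← setIntegral_eq_integral_of_forall_compl_eq_zero (s := e.source) hout]
  have := setIntegral_densityMeasure hω₀.compatible.densityPullback_vol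
    (fun e he => hω₀.isClosedForm.continuousOn_volDensity he)
    (fun e he z hz => (hω₀.positive.volDensity_pos he hz).le) he
    (continuous_ratio_exactDensity hω₀ H hu hv)
  change ∫ x in e.source, _ ∂(densityMeasure (volDensity ω₀)) = 0
  rw [this]
  -- The density of ω₀ⁿ cancels the denominator of `ratio`, leaving the constant 2ⁿ n! times a
  -- divergence.
  have h6 : ∀ z ∈ e.target, volDensity ω₀ e z * ratio ω₀ (exactDensity h v u) (e.symm z) =
      2 ^ n * (n.factorial : ℝ) * (∑ j, dzbar j (f j) z).re := by
    intro z hz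
    have hpos := PosDef_det_re_pos (hω₀.positive e he z hz)
    have h7 : ∑ j, dzbar j (f j) z = ∑ j, dzbar j (exactField h v u e j) z :=
      Finset.sum_congr rfl fun j _ => by simp only [dzbar, (hfev j z hz).fderiv_eq]
    rw [ratio_symm hω₀ hcomp he hz, h7, ← sum_dzbar_exactField H hu hv he hz, volDensity]
    field_simp
  rw [setIntegral_congr_fun e.open_target.measurableSet h6, integral_const_mul,
    setIntegral_eq_integral_of_forall_compl_eq_zero (s := e.target)]
  · have h8 := integral_re hint
    simp only [RCLike.re_to_complex] at h8
    rw [h8, hsum]; simp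
  · intro z hz
    have : ∀ j, dzbar j (f j) z = 0 := fun j => by
      simp only [dzbar, (hf0 j z fun h => hz (hKe h)).fderiv_eq]; simp
    simp [this]

theorem ratio_exactDensity_sum {h : CoeffForm n X}
    {ι : Type*} (s : Finset ι) {u : ι → X → ℝ} (v : X → ℝ) (hu : ∀ i, IsSmooth n (u i)) (x : X) :
    ratio ω₀ (exactDensity h v fun x => ∑ i ∈ s, u i x) x =
      ∑ i ∈ s, ratio ω₀ (exactDensity h v (u i)) x := by
  unfold ratio
  rw [← Finset.sum_div]
  congr 1
  set e := chartAt (Fin n → ℂ) x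
  have hd : ∀ i ∈ s, DifferentiableAt ℝ (fun w => u i (e.symm w)) (e x) := fun i _ =>
    ((hu i).contDiffAt (chart_mem_atlas _ x) (mem_chart_target _ x)).differentiableAt (by simp)
  have hw : ∀ a, wd (fun w => ∑ i ∈ s, u i (e.symm w)) (e x) a =
      ∑ i ∈ s, wd (fun w => u i (e.symm w)) (e x) a := fun a => by
    simp only [wd, fderiv_fun_sum hd, sum_apply]
    push_cast
    rw [Finset.mul_sum, ← Finset.sum_sub_distrib, Finset.sum_div]
  have hg : (gradForm v (fun x => ∑ i ∈ s, u i x) : CoeffForm n X) e (e x) =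
      ∑ i ∈ s, gradForm v (u i) e (e x) := by
    ext i j
    simp only [gradForm, Matrix.of_apply, hw, star_sum, Finset.mul_sum, Matrix.sum_apply]
  simp only [exactDensity, traceDensity, hg, Finset.sum_add_distrib, Finset.sum_mul,
    Finset.mul_sum, Matrix.trace_sum, Complex.re_sum]

/-- Integration by parts. -/
theorem stokes [CompactSpace X] [T2Space X] (hω₀ : IsKahlerForm ω₀)
    {h : CoeffForm n X} (H : IsClosedForm h) {u v : X → ℝ} (hu : IsSmooth n u) (hv : IsSmooth n v) :
    ∫ x, ratio ω₀ (exactDensity h v u) x ∂(vol ω₀) = 0 := by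
  have : IsManifold 𝓘(ℝ, Fin n → ℂ) ∞ X := isManifold_real
  -- A finite partition of unity subordinate to charts; the exact density is additive in u, so each
  -- localized piece is treated by itself.
  obtain ⟨t, -, ht⟩ := isCompact_univ.elim_nhds_subcover (fun x : X => (chartAt (Fin n → ℂ) x).source)
    (fun x _ => (chartAt (Fin n → ℂ) x).open_source.mem_nhds (mem_chart_source _ x))
  obtain ⟨χ, hχ⟩ := SmoothPartitionOfUnity.exists_isSubordinate 𝓘(ℝ, Fin n → ℂ)
    (isClosed_univ (X := X)) (fun x : t => (chartAt (Fin n → ℂ) (x : X)).source)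
    (fun x => (chartAt (Fin n → ℂ) (x : X)).open_source) (by
      intro x hx
      have := ht hx
      simp only [mem_iUnion] at this ⊢
      obtain ⟨y, hy, hxy⟩ := this
      exact ⟨⟨y, hy⟩, hxy⟩)
  have hχs : ∀ i, IsSmooth n fun x => χ i x := fun i => (χ i).contMDiff
  have hχu : ∀ i, IsSmooth n fun x => χ i x * u x := fun i => (hχs i).mul hu
  have hsum : u = fun x => ∑ i, χ i x * u x := by
    ext x
    rw [← Finset.sum_mul, ← finsum_eq_sum_of_fintype, χ.sum_eq_one (mem_univ x), one_mul]
  have h1 : ∀ x, ratio ω₀ (exactDensity h v u) x =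
      ∑ i, ratio ω₀ (exactDensity h v fun x => χ i x * u x) x := fun x => by
    conv_lhs => rw [hsum]
    exact ratio_exactDensity_sum _ v hχu x
  simp only [h1]
  rw [integral_finsetSum _ fun i _ => integrable_of_continuous hω₀
    (continuous_ratio_exactDensity hω₀ H (hχu i) hv)]
  refine Finset.sum_eq_zero fun i _ => ?_
  refine stokes_of_tsupport_subset hω₀ H (hχu i) hv (chart_mem_atlas _ (i : X)) ?_
  exact (tsupport_mul_subset_left).trans (hχ i)

end Stokes

/-! ### The exponential map of the complex torus -/

section TorusExp

variable {r : ℕ}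

theorem torusExp_zero : torusExp (0 : Fin r → ℂ) = 1 := by
  ext α; simp [torusExp]

theorem torusExp_add (w w' : Fin r → ℂ) : torusExp (w + w') = torusExp w * torusExp w' := by
  ext α; simp [torusExp, Complex.exp_add]

theorem torusExp_surjective (σ : Fin r → ℂˣ) : ∃ w, torusExp w = σ :=
  ⟨fun α => Complex.log (σ α), by ext α; simp [torusExp, Complex.exp_log]⟩

theorem torusExp_imag (b : Fin r → ℝ) :
    torusExp (fun α => (b α : ℂ) * Complex.I) = compactTorus fun α => Circle.exp (b α) := by
  ext α; simp [torusExp, compactTorus]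

end TorusExp

/-! ### The action in charts, the volume cocycle and translates of potentials -/

section Action

variable {n r : ℕ} {X : Type*} [TopologicalSpace X] [ChartedSpace (Fin n → ℂ) X]
  [IsManifold 𝓘(ℂ, Fin n → ℂ) ω X] [MulAction (Fin r → ℂˣ) X]

theorem IsHolomorphicAction.contDiffAt (hact : IsHolomorphicAction r n X)
    {e e' : OpenPartialHomeomorph X (Fin n → ℂ)} (he : e ∈ atlas (Fin n → ℂ) X)
    (he' : e' ∈ atlas (Fin n → ℂ) X) {w : Fin r → ℂ} {z : Fin n → ℂ} (hz : z ∈ e.target)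
    (hz' : torusExp w • e.symm z ∈ e'.source) :
    ContDiffAt ℂ ω (fun p : (Fin r → ℂ) × (Fin n → ℂ) => e' (torusExp p.1 • e.symm p.2)) (w, z) := by
  have h1 : ContMDiffAt 𝓘(ℂ, Fin n → ℂ) 𝓘(ℂ, Fin n → ℂ) ω e.symm z :=
    (contMDiffOn_symm_of_mem_maximalAtlas (IsManifold.subset_maximalAtlas he)).contMDiffAt
      (e.open_target.mem_nhds hz)
  have h2 : ContMDiffAt 𝓘(ℂ, Fin n → ℂ) 𝓘(ℂ, Fin n → ℂ) ω e' (torusExp w • e.symm z) :=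
    (contMDiffOn_of_mem_maximalAtlas (IsManifold.subset_maximalAtlas he')).contMDiffAt
      (e'.open_source.mem_nhds hz')
  have h3 : ContMDiffAt 𝓘(ℂ, (Fin r → ℂ) × (Fin n → ℂ))
      (𝓘(ℂ, Fin r → ℂ).prod 𝓘(ℂ, Fin n → ℂ)) ω
      (fun p : (Fin r → ℂ) × (Fin n → ℂ) => (p.1, e.symm p.2)) (w, z) := by
    refine ContMDiffAt.prodMk ?_ ?_
    · exact contDiffAt_fst.contMDiffAt
    · have h4 : ContMDiffAt 𝓘(ℂ, (Fin r → ℂ) × (Fin n → ℂ)) 𝓘(ℂ, Fin n → ℂ) ω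
        (Prod.snd : (Fin r → ℂ) × (Fin n → ℂ) → Fin n → ℂ) (w, z) := contDiffAt_snd.contMDiffAt
      exact ContMDiffAt.comp (w, z) (f := Prod.snd) (g := e.symm) h1 h4
  rw [← contMDiffAt_iff_contDiffAt]
  have h5 := ContMDiffAt.comp (w, z) (hact (w, e.symm z)) h3
  exact ContMDiffAt.comp (w, z) (f := fun p : (Fin r → ℂ) × (Fin n → ℂ) => torusExp p.1 • e.symm p.2)
    (g := e') h2 h5

theorem IsHolomorphicAction.isHolo (hact : IsHolomorphicAction r n X) (σ : Fin r → ℂˣ) :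
    IsHolo n fun x : X => σ • x := by
  obtain ⟨w, rfl⟩ := torusExp_surjective σ
  have : ContMDiff 𝓘(ℂ, Fin n → ℂ) (𝓘(ℂ, Fin r → ℂ).prod 𝓘(ℂ, Fin n → ℂ)) ω
      (fun x : X => (w, x)) := contMDiff_const.prodMk contMDiff_id
  exact ContMDiff.comp (f := fun x : X => (w, x))
    (g := fun p : (Fin r → ℂ) × X => torusExp p.1 • p.2) hact this

theorem IsHolomorphicAction.continuous_smul (hact : IsHolomorphicAction r n X) :
    Continuous fun p : (Fin r → ℂ) × X => torusExp p.1 • p.2 := ContMDiff.continuous hact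

/-- The homeomorphism of `X` given by an element of the torus. -/
def torusHomeo (hact : IsHolomorphicAction r n X) (σ : Fin r → ℂˣ) : X ≃ₜ X where
  toFun x := σ • x
  invFun x := σ⁻¹ • x
  left_inv x := inv_smul_smul σ x
  right_inv x := smul_inv_smul σ x
  continuous_toFun := (hact.isHolo σ).continuous
  continuous_invFun := (hact.isHolo σ⁻¹).continuous

theorem det_jacobian_smul_ne_zero (hact : IsHolomorphicAction r n X) (σ : Fin r → ℂˣ)
    {e e' : OpenPartialHomeomorph X (Fin n → ℂ)} (he : e ∈ atlas (Fin n → ℂ) X)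
    (he' : e' ∈ atlas (Fin n → ℂ) X) {z : Fin n → ℂ} (hz : z ∈ e.target)
    (hz' : σ • e.symm z ∈ e'.source) :
    (complexJacobian (fun w => e' (σ • e.symm w)) z).det ≠ 0 := by
  have h1 := complexJacobian_chart_comp (hact.isHolo σ⁻¹) (hact.isHolo σ) he he' he hz hz'
    (by simpa using e.map_target hz)
  have h2 : complexJacobian (fun w => e (σ⁻¹ • (σ • e.symm w))) z = 1 := by
    have h3 : (fun w => e (σ⁻¹ • (σ • e.symm w))) =ᶠ[nhds z] id := by
      filter_upwards [e.open_target.mem_nhds hz] with w hw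
      simp [e.right_inv hw]
    rw [complexJacobian_congr h3]
    ext i j
    simp [complexJacobian, Matrix.one_apply, Pi.single_apply]
  rw [h2] at h1
  intro h0
  have := congrArg Matrix.det h1
  rw [Matrix.det_mul, h0] at this
  simp at this

/-- The pullback of the density `d` under `σ`. -/
def pullbackDensity (σ : X → X) (d : Density n X) : Density n X := fun e z =>
  Complex.normSq (complexJacobian (fun w => chartAt (Fin n → ℂ) (σ (e.symm z)) (σ (e.symm w))) z).det *
    d (chartAt (Fin n → ℂ) (σ (e.symm z))) (chartAt (Fin n → ℂ) (σ (e.symm z)) (σ (e.symm z)))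

theorem densityPullback_pullbackDensity {σ : X → X} (hσ : IsHolo n σ) {d : Density n X}
    (hd : DensityPullback id d d) : DensityPullback σ d (pullbackDensity σ d) := by
  intro e he e' he' z hz hz'
  set e'' := chartAt (Fin n → ℂ) (σ (e.symm z)) with he''def
  have he'' : e'' ∈ atlas (Fin n → ℂ) X := chart_mem_atlas _ _
  have hz'' : σ (e.symm z) ∈ e''.source := mem_chart_source _ _
  have h1 := hd e'' he'' e' he' (e'' (σ (e.symm z))) (e''.map_source hz'')
    (by simpa [e''.left_inv hz''] using hz')
  have h2 := complexJacobian_chart_comp isHolo_id hσ he he'' he' hz hz'' hz'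
  simp only [id, e''.left_inv hz''] at h1 h2
  rw [pullbackDensity, ← he''def, h1, h2, Matrix.det_mul, Complex.normSq_mul]
  ring

/-- A pulled-back density is again a density: comparing two source charts through the same target
chart, the chain rule splits off the Jacobian of the transition. -/
theorem DensityPullback.target_compatible {σ : X → X} (hσ : IsHolo n σ) {d d' : Density n X}
    (H : DensityPullback σ d d') : DensityPullback id d' d' := by
  intro e he e₁ he₁ z hz hz₁
  rw [id] at hz₁
  set e' := chartAt (Fin n → ℂ) (σ (e.symm z))
  have he' : e' ∈ atlas (Fin n → ℂ) X := chart_mem_atlas _ _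
  have hz' : σ (e.symm z) ∈ e'.source := mem_chart_source _ _
  have h1 := H e he e' he' z hz hz'
  have h2 := H e₁ he₁ e' he' (e₁ (e.symm z)) (e₁.map_source hz₁) (by
    rwa [e₁.left_inv hz₁])
  have h3 := complexJacobian_chart_comp hσ isHolo_id he he₁ he' hz hz₁ hz'
  simp only [id] at h1 h2 h3 ⊢
  rw [e₁.left_inv hz₁] at h2
  rw [h1, h2, h3, Matrix.det_mul, Complex.normSq_mul]
  ring

variable (ω₀ : CoeffForm n X) (ρ₀ : X → ℝ)

/-- The logarithm of the local density of `e^{ρ₀} ω₀ⁿ`. -/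
def logVol (e : OpenPartialHomeomorph X (Fin n → ℂ)) (z : Fin n → ℂ) : ℝ :=
  Real.log (ω₀ e z).det.re + ρ₀ (e.symm z)

/-- The function `log (σ^*Ω / Ω)` for the volume form `Ω = e^{ρ₀} ω₀ⁿ`. -/
def logCocycle (σ : Fin r → ℂˣ) (x : X) : ℝ :=
  Real.log (ratio ω₀ (pullbackDensity (fun x => σ • x) (detDensity ω₀)) x) + ρ₀ (σ • x) - ρ₀ x

/-- The translate `σ[φ]` of a potential, normalized by `e^{-σ[φ]} Ω = σ^*(e^{-φ} Ω)`. -/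
def translate (σ : Fin r → ℂˣ) (φ : X → ℝ) (x : X) : ℝ :=
  φ (σ • x) - logCocycle ω₀ ρ₀ σ x

variable {ω₀ ρ₀}

theorem ratio_pullback_det (hact : IsHolomorphicAction r n X) (hω₀ : IsKahlerForm ω₀)
    (σ : Fin r → ℂˣ) {e e' : OpenPartialHomeomorph X (Fin n → ℂ)} (he : e ∈ atlas (Fin n → ℂ) X)
    (he' : e' ∈ atlas (Fin n → ℂ) X) {z : Fin n → ℂ} (hz : z ∈ e.target)
    (hz' : σ • e.symm z ∈ e'.source) :
    ratio ω₀ (pullbackDensity (fun x => σ • x) (detDensity ω₀)) (e.symm z) =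
      Complex.normSq (complexJacobian (fun w => e' (σ • e.symm w)) z).det *
        (ω₀ e' (e' (σ • e.symm z))).det.re / (ω₀ e z).det.re := by
  have h1 := densityPullback_pullbackDensity (hact.isHolo σ) hω₀.compatible.densityPullback_det
  rw [ratio_symm hω₀ (h1.target_compatible (hact.isHolo σ)) he hz, h1 e he e' he' z hz hz']
  rfl

/-- In coordinates c_σ is a difference of local potentials log Ω plus log|det J|² with J
holomorphic. Only the first part contributes to √-1∂∂̄. -/
theorem logCocycle_symm (hact : IsHolomorphicAction r n X) (hω₀ : IsKahlerForm ω₀)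
    (σ : Fin r → ℂˣ) {e e' : OpenPartialHomeomorph X (Fin n → ℂ)} (he : e ∈ atlas (Fin n → ℂ) X)
    (he' : e' ∈ atlas (Fin n → ℂ) X) {z : Fin n → ℂ} (hz : z ∈ e.target)
    (hz' : σ • e.symm z ∈ e'.source) :
    logCocycle ω₀ ρ₀ σ (e.symm z) = logVol ω₀ ρ₀ e' (e' (σ • e.symm z)) +
      Real.log (Complex.normSq (complexJacobian (fun w => e' (σ • e.symm w)) z).det) -
        logVol ω₀ ρ₀ e z := by
  have hJ := det_jacobian_smul_ne_zero hact σ he he' hz hz'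
  have hp := PosDef_det_re_pos (hω₀.positive e he z hz)
  have hp' := PosDef_det_re_pos (hω₀.positive e' he' _ (e'.map_source hz'))
  have hJ' : Complex.normSq (complexJacobian (fun w => e' (σ • e.symm w)) z).det ≠ 0 :=
    (map_ne_zero _).2 hJ
  rw [logCocycle, ratio_pullback_det hact hω₀ σ he he' hz hz', Real.log_div (mul_ne_zero hJ' hp'.ne') hp.ne',
    Real.log_mul hJ' hp'.ne', logVol, logVol, e'.left_inv hz']
  ring

/-- The chain rule for Jacobians; the local potentials at the intermediate point cancel. -/
theorem logCocycle_mul (hact : IsHolomorphicAction r n X) (hω₀ : IsKahlerForm ω₀)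
    (σ τ : Fin r → ℂˣ) (x : X) :
    logCocycle ω₀ ρ₀ (σ * τ) x = logCocycle ω₀ ρ₀ σ (τ • x) + logCocycle ω₀ ρ₀ τ x := by
  set e := chartAt (Fin n → ℂ) x
  set e' := chartAt (Fin n → ℂ) (τ • x)
  set e'' := chartAt (Fin n → ℂ) (σ • τ • x)
  have he : e ∈ atlas (Fin n → ℂ) X := chart_mem_atlas _ _
  have he' : e' ∈ atlas (Fin n → ℂ) X := chart_mem_atlas _ _
  have he'' : e'' ∈ atlas (Fin n → ℂ) X := chart_mem_atlas _ _
  have hx : x ∈ e.source := mem_chart_source _ _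
  have hx' : τ • x ∈ e'.source := mem_chart_source _ _
  have hx'' : σ • τ • x ∈ e''.source := mem_chart_source _ _
  have hex : e.symm (e x) = x := e.left_inv hx
  have hex' : e'.symm (e' (τ • x)) = τ • x := e'.left_inv hx'
  have h1 := logCocycle_symm (ρ₀ := ρ₀) hact hω₀ τ he he' (e.map_source hx) (by rwa [hex])
  have h2 := logCocycle_symm (ρ₀ := ρ₀) hact hω₀ σ he' he'' (e'.map_source hx') (by rwa [hex'])
  have h3 := logCocycle_symm (ρ₀ := ρ₀) hact hω₀ (σ * τ) he he'' (e.map_source hx)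
    (by rwa [hex, mul_smul])
  have h4 := complexJacobian_chart_comp (hact.isHolo σ) (hact.isHolo τ) he he' he''
    (e.map_source hx) (by rwa [hex]) (by rwa [hex])
  have hJ := det_jacobian_smul_ne_zero hact τ he he' (e.map_source hx) (by rwa [hex])
  have hJ' := det_jacobian_smul_ne_zero hact σ he' he'' (e'.map_source hx') (by rwa [hex'])
  simp only [mul_smul] at h3
  rw [h4] at h3
  simp only [hex, hex', Matrix.det_mul, Complex.normSq_mul] at h1 h2 h3
  rw [Real.log_mul ((map_ne_zero _).2 hJ') ((map_ne_zero _).2 hJ)] at h3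
  rw [h1, h2, h3]; ring

/-- The cocycle identity makes translation a right action with no additive ambiguity. Exact equality
is what turns the change of energy into a homomorphism. -/
theorem translate_mul (hact : IsHolomorphicAction r n X) (hω₀ : IsKahlerForm ω₀)
    (σ τ : Fin r → ℂˣ) (φ : X → ℝ) :
    translate ω₀ ρ₀ (σ * τ) φ = translate ω₀ ρ₀ τ (translate ω₀ ρ₀ σ φ) := by
  ext x
  simp only [translate, logCocycle_mul hact hω₀, mul_smul]; ring

theorem logCocycle_one (hact : IsHolomorphicAction r n X) (hω₀ : IsKahlerForm ω₀) (x : X) :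
    logCocycle ω₀ ρ₀ (1 : Fin r → ℂˣ) x = 0 := by
  have := logCocycle_mul (ρ₀ := ρ₀) hact hω₀ 1 1 x
  simp only [mul_one, one_smul] at this
  linarith

theorem translate_one (hact : IsHolomorphicAction r n X) (hω₀ : IsKahlerForm ω₀) (φ : X → ℝ) :
    translate ω₀ ρ₀ (1 : Fin r → ℂˣ) φ = φ := by
  ext x; simp [translate, logCocycle_one hact hω₀]

end Action

/-! ### The Levi form of translation in the torus and space variables jointly -/

section Master

variable {n r : ℕ} {X : Type*} [TopologicalSpace X] [ChartedSpace (Fin n → ℂ) X]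
  [IsManifold 𝓘(ℂ, Fin n → ℂ) ω X] [MulAction (Fin r → ℂˣ) X] [MeasurableSpace X]
  {ω₀ : CoeffForm n X} {ρ₀ : X → ℝ}

/-- The sesquilinear form of a matrix. -/
def sform (M : Matrix (Fin n) (Fin n) ℂ) (a b : Fin n → ℂ) : ℂ :=
  ∑ i, ∑ j, a i * M i j * star (b j)

theorem contDiffAt_logVol (hω₀ : IsKahlerForm ω₀) (hρ₀ : IsRicciPotential ω₀ ρ₀)
    {e : OpenPartialHomeomorph X (Fin n → ℂ)} (he : e ∈ atlas (Fin n → ℂ) X)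
    {z : Fin n → ℂ} (hz : z ∈ e.target) : ContDiffAt ℝ ∞ (logVol ω₀ ρ₀ e) z := by
  refine ContDiffAt.add (ContDiffAt.log ?_ (PosDef_det_re_pos (hω₀.positive e he z hz)).ne')
    (hρ₀.smooth.contDiffAt he hz)
  exact Complex.reCLM.contDiff.contDiffAt.comp z (contDiffAt_det (hω₀.isClosedForm.smooth e he z hz))

/-- The Ricci potential equation, restated: Ω = e^{ρ₀}ω₀ⁿ is a metric on -K_X with curvature ω₀. -/
theorem levi_logVol (hω₀ : IsKahlerForm ω₀) (hρ₀ : IsRicciPotential ω₀ ρ₀)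
    {e : OpenPartialHomeomorph X (Fin n → ℂ)} (he : e ∈ atlas (Fin n → ℂ) X)
    {z : Fin n → ℂ} (hz : z ∈ e.target) (a b : Fin n → ℂ) :
    levi (logVol ω₀ ρ₀ e) z a b = - sform (ω₀ e z) a b := by
  have h1 : ContDiffAt ℝ ∞ (fun w => Real.log (ω₀ e w).det.re) z := by
    refine ContDiffAt.log ?_ (PosDef_det_re_pos (hω₀.positive e he z hz)).ne'
    exact Complex.reCLM.contDiff.contDiffAt.comp z
      (contDiffAt_det (hω₀.isClosedForm.smooth e he z hz))
  have h2 := hρ₀.smooth.contDiffAt he hz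
  have h3 : complexHessian (logVol ω₀ ρ₀ e) z = - ω₀ e z := by
    have := hρ₀.eq e he z hz
    simp only [ricciForm, ddbar] at this
    change complexHessian (fun w => Real.log (ω₀ e w).det.re + ρ₀ (e.symm w)) z = _
    rw [complexHessian_add (h1.of_le (nat_le_infty 2)) (h2.of_le (nat_le_infty 2)), ← this]
    abel
  rw [levi_eq_sum ((contDiffAt_logVol hω₀ hρ₀ he hz).of_le (nat_le_infty 2)), h3]
  simp [sform]

/-- The local expression of the translate. -/
theorem translate_local (hact : IsHolomorphicAction r n X) (hω₀ : IsKahlerForm ω₀)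
    (hρ₀ : IsRicciPotential ω₀ ρ₀) {φ : X → ℝ} (hφ : IsSmooth n φ)
    {e e' : OpenPartialHomeomorph X (Fin n → ℂ)} (he : e ∈ atlas (Fin n → ℂ) X)
    (he' : e' ∈ atlas (Fin n → ℂ) X) {w : Fin r → ℂ} {z : Fin n → ℂ} (hz : z ∈ e.target)
    (hz' : torusExp w • e.symm z ∈ e'.source) :
    ContDiffAt ℝ ∞ (fun p : (Fin r → ℂ) × (Fin n → ℂ) =>
        translate ω₀ ρ₀ (torusExp p.1) φ (e.symm p.2)) (w, z) ∧
      ∀ a b : (Fin r → ℂ) × (Fin n → ℂ),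
        levi (fun p : (Fin r → ℂ) × (Fin n → ℂ) =>
          translate ω₀ ρ₀ (torusExp p.1) φ (e.symm p.2)) (w, z) a b =
        sform (perturb ω₀ φ e' (e' (torusExp w • e.symm z)))
          (fderiv ℂ (fun p : (Fin r → ℂ) × (Fin n → ℂ) => e' (torusExp p.1 • e.symm p.2)) (w, z) a)
          (fderiv ℂ (fun p : (Fin r → ℂ) × (Fin n → ℂ) => e' (torusExp p.1 • e.symm p.2)) (w, z) b)
        - sform (ω₀ e z) a.2 b.2 := by
  set Φ : (Fin r → ℂ) × (Fin n → ℂ) → (Fin n → ℂ) := fun p => e' (torusExp p.1 • e.symm p.2) with hΦ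
  have hΦd : ContDiffAt ℂ ω Φ (w, z) := hact.contDiffAt he he' hz hz'
  have hΦt : Φ (w, z) ∈ e'.target := e'.map_source hz'
  have hev : ∀ᶠ p : (Fin r → ℂ) × (Fin n → ℂ) in nhds (w, z),
      p.2 ∈ e.target ∧ torusExp p.1 • e.symm p.2 ∈ e'.source := by
    refine Filter.Eventually.and ?_ ?_
    · exact (continuousAt_snd (p := (w, z))).eventually (e.open_target.mem_nhds hz)
    · have hc : ContinuousAt (fun p : (Fin r → ℂ) × (Fin n → ℂ) => torusExp p.1 • e.symm p.2) (w, z) := by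
        refine ContinuousAt.comp (f := fun p : (Fin r → ℂ) × (Fin n → ℂ) => (p.1, e.symm p.2))
          (g := fun p : (Fin r → ℂ) × X => torusExp p.1 • p.2) hact.continuous_smul.continuousAt ?_
        exact continuousAt_fst.prodMk ((e.continuousAt_symm hz).comp (f := Prod.snd) (x := (w, z))
          continuousAt_snd)
      exact hc.eventually (e'.open_source.mem_nhds hz')
  set f0 : (Fin n → ℂ) → ℝ := fun y => φ (e'.symm y) - logVol ω₀ ρ₀ e' y with hf0
  have hf0d : ContDiffAt ℝ ∞ f0 (Φ (w, z)) :=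
    (hφ.contDiffAt he' hΦt).sub (contDiffAt_logVol hω₀ hρ₀ he' hΦt)
  -- The Jacobian determinant in the X-directions only, regarded as a holomorphic function of w and
  -- z together; this makes log|F|² pluriharmonic on the product.
  set F : (Fin r → ℂ) × (Fin n → ℂ) → ℂ := fun p =>
    (Matrix.of fun k i => fderiv ℂ Φ p (0, Pi.single i 1) k).det with hF
  have hFd : ContDiffAt ℂ ω F (w, z) := by
    refine contDiffAt_det_complex fun k i => ?_
    have h1 : ContDiffAt ℂ ω (fderiv ℂ Φ) (w, z) := hΦd.fderiv_right (by simp)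
    have h2 := h1.clm_apply (contDiffAt_const (c := ((0 : Fin r → ℂ), (Pi.single i 1 : Fin n → ℂ))))
    exact contDiffAt_pi.1 h2 k
  have hJF : ∀ᶠ p : (Fin r → ℂ) × (Fin n → ℂ) in nhds (w, z),
      (complexJacobian (fun y => e' (torusExp p.1 • e.symm y)) p.2).det = F p := by
    filter_upwards [hev] with p hp
    have h1 := (hact.contDiffAt he he' hp.1 hp.2).differentiableAt (by simp)
    have h2 : HasFDerivAt (fun y : Fin n → ℂ => (p.1, y))
        (ContinuousLinearMap.inr ℂ (Fin r → ℂ) (Fin n → ℂ)) p.2 := hasFDerivAt_prodMk_right _ _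
    have h3 := (HasFDerivAt.comp p.2 (f := fun y : Fin n → ℂ => (p.1, y)) h1.hasFDerivAt h2).fderiv
    have h4 : (Φ ∘ fun y : Fin n → ℂ => (p.1, y)) = fun y => e' (torusExp p.1 • e.symm y) := rfl
    change fderiv ℂ (Φ ∘ fun y : Fin n → ℂ => (p.1, y)) p.2 = _ at h3
    rw [h4] at h3
    simp only [hF, complexJacobian, h3]
    rfl
  have hF0 : F (w, z) ≠ 0 := by
    rw [← hJF.self_of_nhds]
    exact det_jacobian_smul_ne_zero hact _ he he' hz hz'
  -- Three terms: (φ - log Ω) pulled back by the action map, which yields the pullback of ω_φ; a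
  -- pluriharmonic term; and log Ω in the variable z alone, which yields -ω₀.
  have hloc : (fun p : (Fin r → ℂ) × (Fin n → ℂ) =>
      translate ω₀ ρ₀ (torusExp p.1) φ (e.symm p.2)) =ᶠ[nhds (w, z)]
      fun p => f0 (Φ p) - Real.log (Complex.normSq (F p)) + logVol ω₀ ρ₀ e p.2 := by
    filter_upwards [hev, hJF] with p hp hp'
    rw [translate, logCocycle_symm hact hω₀ _ he he' hp.1 hp.2, hp']
    simp only [hf0, hΦ, e'.left_inv hp.2]
    ring
  have hΦr : ContDiffAt ℝ ∞ Φ (w, z) := (hΦd.restrict_scalars ℝ).of_le le_top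
  have hA : ContDiffAt ℝ ∞ (fun p => f0 (Φ p)) (w, z) := hf0d.comp (w, z) hΦr
  have hB : ContDiffAt ℝ ∞ (fun p => Real.log (Complex.normSq (F p))) (w, z) := by
    refine ContDiffAt.log ?_ ((map_ne_zero _).2 hF0)
    have hFr : ContDiffAt ℝ ∞ F (w, z) := (hFd.restrict_scalars ℝ).of_le le_top
    simp only [Complex.normSq_apply]
    have h1 : ContDiffAt ℝ ∞ (fun p => (F p).re) (w, z) :=
      Complex.reCLM.contDiff.contDiffAt.comp (w, z) hFr
    have h2 : ContDiffAt ℝ ∞ (fun p => (F p).im) (w, z) :=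
      Complex.imCLM.contDiff.contDiffAt.comp (w, z) hFr
    exact (h1.mul h1).add (h2.mul h2)
  have hC : ContDiffAt ℝ ∞ (fun p : (Fin r → ℂ) × (Fin n → ℂ) => logVol ω₀ ρ₀ e p.2) (w, z) :=
    (contDiffAt_logVol hω₀ hρ₀ he hz).comp (w, z) contDiffAt_snd
  refine ⟨((hA.sub hB).add hC).congr_of_eventuallyEq hloc, fun a b => ?_⟩
  have h2 := nat_le_infty 2
  rw [levi_congr hloc, levi_add ((hA.sub hB).of_le h2) (hC.of_le h2),
    levi_sub (hA.of_le h2) (hB.of_le h2), levi_comp (hf0d.of_le h2) (hΦd.of_le le_top),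
    levi_log_normSq (hFd.of_le le_top) hF0]
  have h5 := levi_comp (f := logVol ω₀ ρ₀ e) (τ := (Prod.snd : (Fin r → ℂ) × (Fin n → ℂ) → _))
    (z := (w, z)) ((contDiffAt_logVol hω₀ hρ₀ he hz).of_le h2) contDiffAt_snd a b
  rw [h5, levi_logVol hω₀ hρ₀ he hz, fderiv_snd,
    levi_sub ((hφ.contDiffAt he' hΦt).of_le h2) ((contDiffAt_logVol hω₀ hρ₀ he' hΦt).of_le h2),
    levi_logVol hω₀ hρ₀ he' hΦt, levi_eq_sum ((hφ.contDiffAt he' hΦt).of_le h2)]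
  simp only [sform, perturb, Matrix.add_apply, mul_add, add_mul, Finset.sum_add_distrib, ddbar]
  simp only [ContinuousLinearMap.coe_snd']
  ring

end Master

/-! ### Functions with vanishing gradient or vanishing ∂∂̄ are constant -/

section Constancy

variable {n : ℕ} {X : Type*} [TopologicalSpace X] [ChartedSpace (Fin n → ℂ) X]
  [IsManifold 𝓘(ℂ, Fin n → ℂ) ω X]

theorem fderiv_eq_zero_of_wd {f : (Fin n → ℂ) → ℝ} {z : Fin n → ℂ}
    (h : ∀ i, wd f z (Pi.single i 1) = 0) : fderiv ℝ f z = 0 := by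
  ext a
  have h1 : wd f z a = 0 := by rw [wd_eq_sum]; simp [h]
  have h2 : (wd f z a).re = fderiv ℝ f z a / 2 := by simp [wd]
  rw [h1, Complex.zero_re] at h2
  change fderiv ℝ f z a = 0
  linarith

theorem IsSmooth.eq_of_wd_eq_zero [PreconnectedSpace X] {f : X → ℝ} (hf : IsSmooth n f)
    (h : ∀ e ∈ atlas (Fin n → ℂ) X, ∀ z ∈ e.target, ∀ i,
      wd (fun w => f (e.symm w)) z (Pi.single i 1) = 0) (x y : X) : f x = f y := by
  refine IsLocallyConstant.apply_eq_of_preconnectedSpace ?_ x y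
  rw [IsLocallyConstant.iff_eventually_eq]
  intro x
  set e := chartAt (Fin n → ℂ) x
  have he : e ∈ atlas (Fin n → ℂ) X := chart_mem_atlas _ _
  have hx : x ∈ e.source := mem_chart_source _ _
  obtain ⟨ε, hε, hball⟩ := Metric.isOpen_iff.1 e.open_target (e x) (e.map_source hx)
  have hnear : ∀ᶠ y in nhds x, y ∈ e.source ∧ e y ∈ Metric.ball (e x) ε :=
    Filter.Eventually.and (e.open_source.mem_nhds hx) ((e.continuousAt hx).eventually (Metric.ball_mem_nhds _ hε))
  filter_upwards [hnear] with y hy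
  have hd : DifferentiableOn ℝ (fun w => f (e.symm w)) (Metric.ball (e x) ε) := fun w hw =>
    ((hf.contDiffAt he (hball hw)).differentiableAt (by simp)).differentiableWithinAt
  have hz : ∀ w ∈ Metric.ball (e x) ε, fderivWithin ℝ (fun w => f (e.symm w)) (Metric.ball (e x) ε) w = 0 := by
    intro w hw
    rw [fderivWithin_of_isOpen Metric.isOpen_ball hw]
    exact fderiv_eq_zero_of_wd (h e he w (hball hw))
  have := (convex_ball (e x) ε).is_const_of_fderivWithin_eq_zero hd hz hy.2 (Metric.mem_ball_self hε)
  simpa [e.left_inv hx, e.left_inv hy.1] using this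

theorem posDef_adjugate {A : Matrix (Fin n) (Fin n) ℂ} (hA : A.PosDef) : A.adjugate.PosDef := by
  have h0 : A.det ≠ 0 := hA.det_pos.ne'
  have h1 : A.adjugate = A.det • A⁻¹ := by
    rw [Matrix.inv_def, smul_smul, Ring.mul_inverse_cancel _ (isUnit_iff_ne_zero.2 h0), one_smul]
  rw [h1]
  exact hA.inv.smul hA.det_pos

theorem trace_gradForm (A : Matrix (Fin n) (Fin n) ℂ) (v : X → ℝ)
    (e : OpenPartialHomeomorph X (Fin n → ℂ)) (z : Fin n → ℂ) :
    (A * gradForm v v e z).trace =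
      dotProduct (star fun i => wd (fun w => v (e.symm w)) z (Pi.single i 1))
        (A.mulVec fun i => wd (fun w => v (e.symm w)) z (Pi.single i 1)) := by
  simp only [Matrix.trace, Matrix.diag, Matrix.mul_apply, gradForm, Matrix.of_apply, dotProduct,
    Matrix.mulVec, Pi.star_apply, Finset.mul_sum]
  refine Finset.sum_congr rfl fun j _ => Finset.sum_congr rfl fun i _ => ?_
  ring

theorem traceDensity_gradForm_nonneg {h : CoeffForm n X} (hp : IsPositive h) (v : X → ℝ)
    {e : OpenPartialHomeomorph X (Fin n → ℂ)} (he : e ∈ atlas (Fin n → ℂ) X)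
    {z : Fin n → ℂ} (hz : z ∈ e.target) : 0 ≤ traceDensity h (gradForm v v) e z := by
  rw [traceDensity, trace_gradForm]
  exact (Complex.le_def.1 ((posDef_adjugate (hp e he z hz)).posSemidef.dotProduct_mulVec_nonneg _)).1

theorem wd_eq_zero_of_traceDensity {h : CoeffForm n X} (hp : IsPositive h) {v : X → ℝ}
    {e : OpenPartialHomeomorph X (Fin n → ℂ)} (he : e ∈ atlas (Fin n → ℂ) X)
    {z : Fin n → ℂ} (hz : z ∈ e.target) (h0 : traceDensity h (gradForm v v) e z = 0) (i : Fin n) :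
    wd (fun w => v (e.symm w)) z (Pi.single i 1) = 0 := by
  by_contra hne
  have hne' : (fun i => wd (fun w => v (e.symm w)) z (Pi.single i 1)) ≠ 0 := fun h =>
    hne (congrFun h i)
  have := (posDef_adjugate (hp e he z hz)).dotProduct_mulVec_pos hne'
  rw [traceDensity, trace_gradForm] at h0
  exact ne_of_gt (Complex.lt_def.1 this).1 h0

/-- A pluriharmonic function on a compact connected Kähler manifold is constant. -/
theorem IsSmooth.eq_of_ddbar_eq_zero [MeasurableSpace X] [BorelSpace X] [CompactSpace X]
    [T2Space X] [PreconnectedSpace X] {ω₀ : CoeffForm n X} (hω₀ : IsKahlerForm ω₀) {f : X → ℝ}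
    (hf : IsSmooth n f)
    (h : ∀ e ∈ atlas (Fin n → ℂ) X, ∀ z ∈ e.target, (ddbar f : CoeffForm n X) e z = 0)
    (x y : X) : f x = f y := by
  refine hf.eq_of_wd_eq_zero (fun e he z hz i => ?_) x y
  refine wd_eq_zero_of_traceDensity hω₀.positive he hz ?_ i
  -- Integrating by parts against f itself: since ∂∂̄f = 0, the exact density is |∂f|², a continuous
  -- nonnegative function with integral zero, hence identically zero.
  have h1 := stokes hω₀ hω₀.isClosedForm hf hf
  have hcont := continuous_ratio_exactDensity hω₀ hω₀.isClosedForm hf hf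
  have hloc : ∀ e ∈ atlas (Fin n → ℂ) X, ∀ z ∈ e.target, exactDensity ω₀ f f e z =
      traceDensity ω₀ (gradForm f f) e z := fun e he z hz => by
    simp [exactDensity, traceDensity, h e he z hz]
  have hnn : 0 ≤ ratio ω₀ (exactDensity ω₀ f f) := fun x => by
    refine div_nonneg ?_ (PosDef_det_re_pos
      (hω₀.positive _ (chart_mem_atlas _ x) _ (mem_chart_target _ x))).le
    rw [hloc _ (chart_mem_atlas _ x) _ (mem_chart_target _ x)]
    exact traceDensity_gradForm_nonneg hω₀.positive f (chart_mem_atlas _ x) (mem_chart_target _ x)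
  have := isOpenPosMeasure_vol hω₀.isClosedForm hω₀.positive
  have h2 := (integral_eq_zero_iff_of_nonneg hnn (integrable_of_continuous hω₀ hcont)).1 h1
  have h3 := (hcont.ae_eq_iff_eq (vol ω₀) continuous_const).1 h2
  have h4 : ratio ω₀ (exactDensity ω₀ f f) (e.symm z) = 0 := congrFun h3 (e.symm z)
  rw [ratio_symm hω₀ (densityPullback_exactDensity hω₀.isClosedForm hf hf) he hz, hloc e he z hz,
    div_eq_zero_iff] at h4
  exact h4.resolve_right (PosDef_det_re_pos (hω₀.positive e he z hz)).ne'

end Constancy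

/-! ### Translates of potentials and invariance of Ω under the compact torus -/

section Translate

variable {n r : ℕ} {X : Type*} [TopologicalSpace X] [ChartedSpace (Fin n → ℂ) X]
  [IsManifold 𝓘(ℂ, Fin n → ℂ) ω X] [MulAction (Fin r → ℂˣ) X] [MeasurableSpace X]
  {ω₀ : CoeffForm n X} {ρ₀ : X → ℝ}

theorem sform_single (M : Matrix (Fin n) (Fin n) ℂ) (i j : Fin n) :
    sform M (Pi.single i 1) (Pi.single j 1) = M i j := by
  simp [sform, Pi.single_apply, apply_ite]

theorem sform_single_right (M : Matrix (Fin n) (Fin n) ℂ) (a : Fin n → ℂ) (j : Fin n) :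
    sform M a (Pi.single j 1) = ∑ i, a i * M i j := by
  simp [sform, Pi.single_apply, apply_ite]

theorem isSmooth_translate (hact : IsHolomorphicAction r n X) (hω₀ : IsKahlerForm ω₀)
    (hρ₀ : IsRicciPotential ω₀ ρ₀) {φ : X → ℝ} (hφ : IsSmooth n φ) (σ : Fin r → ℂˣ) :
    IsSmooth n (translate ω₀ ρ₀ σ φ) := by
  obtain ⟨w, rfl⟩ := torusExp_surjective σ
  refine isSmooth_of_contDiffAt fun e he z hz => ?_
  have h1 := (translate_local hact hω₀ hρ₀ hφ he (chart_mem_atlas _ (torusExp w • e.symm z)) hz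
    (mem_chart_source _ _)).1
  exact h1.comp (f := fun y => (w, y)) z (contDiffAt_const.prodMk contDiffAt_id)

theorem fderiv_slice {F : Type*} [NormedAddCommGroup F] [NormedSpace ℂ F]
    {Φ : (Fin r → ℂ) × (Fin n → ℂ) → F} {w : Fin r → ℂ} {z : Fin n → ℂ}
    (hΦ : DifferentiableAt ℂ Φ (w, z)) (a : Fin n → ℂ) :
    fderiv ℂ (fun y => Φ (w, y)) z a = fderiv ℂ Φ (w, z) (0, a) := by
  have h2 : HasFDerivAt (fun y : Fin n → ℂ => (w, y))
      (ContinuousLinearMap.inr ℂ (Fin r → ℂ) (Fin n → ℂ)) z := hasFDerivAt_prodMk_right _ _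
  have h3 := (HasFDerivAt.comp z (f := fun y : Fin n → ℂ => (w, y)) hΦ.hasFDerivAt h2).fderiv
  change fderiv ℂ (Φ ∘ fun y : Fin n → ℂ => (w, y)) z a = _
  rw [h3]; rfl

/-- The restriction of the joint Levi form to the slice of constant w, where the action map is σ
itself. -/
theorem isPullback_translate (hact : IsHolomorphicAction r n X) (hω₀ : IsKahlerForm ω₀)
    (hρ₀ : IsRicciPotential ω₀ ρ₀) {φ : X → ℝ} (hφ : IsSmooth n φ) (σ : Fin r → ℂˣ) :
    IsPullback (fun x => σ • x) (perturb ω₀ φ) (perturb ω₀ (translate ω₀ ρ₀ σ φ)) := by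
  obtain ⟨w, rfl⟩ := torusExp_surjective σ
  intro e he e' he' z hz hz'
  obtain ⟨h1, h2⟩ := translate_local hact hω₀ hρ₀ hφ he he' hz hz'
  have hsl : ContDiffAt ℂ 2 (fun y : Fin n → ℂ => (w, y)) z := contDiffAt_const.prodMk contDiffAt_id
  have hd := (isSmooth_translate hact hω₀ hρ₀ hφ (torusExp w)).contDiffAt he hz
  have hΦ := (hact.contDiffAt he he' hz hz').differentiableAt (by simp)
  ext i j
  have h3 : (ddbar (translate ω₀ ρ₀ (torusExp w) φ) : CoeffForm n X) e z i j =
      levi (fun p : (Fin r → ℂ) × (Fin n → ℂ) =>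
          translate ω₀ ρ₀ (torusExp p.1) φ (e.symm p.2)) (w, z) (0, Pi.single i 1)
          (0, Pi.single j 1) := by
    rw [ddbar, complexHessian_apply (hd.of_le (nat_le_infty 2)),
      levi_comp (f := fun p : (Fin r → ℂ) × (Fin n → ℂ) =>
          translate ω₀ ρ₀ (torusExp p.1) φ (e.symm p.2)) (τ := fun y : Fin n → ℂ => (w, y))
          (h1.of_le (nat_le_infty 2)) hsl]
    have : fderiv ℂ (fun y : Fin n → ℂ => (w, y)) z = ContinuousLinearMap.inr ℂ _ _ :=
      (hasFDerivAt_prodMk_right _ _).fderiv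
    rw [this]; rfl
  simp only [perturb, Matrix.add_apply, h3, h2, sform_single]
  rw [← fderiv_slice hΦ, ← fderiv_slice hΦ]
  simp only [add_sub_cancel]
  simp only [sform, Matrix.mul_apply, Matrix.transpose_apply, Matrix.map_apply, complexJacobian,
    Matrix.of_apply, Finset.sum_mul]
  exact Finset.sum_comm

theorem perturb_zero (ω₀ : CoeffForm n X) : perturb ω₀ (fun _ => (0 : ℝ)) = ω₀ := by
  ext e z i j
  simp [perturb, ddbar, complexHessian_const]

theorem IsPullback.isPositive_translate (hact : IsHolomorphicAction r n X) {σ : Fin r → ℂˣ}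
    {h h' : CoeffForm n X} (H : IsPullback (fun x => σ • x) h h') (hp : IsPositive h) :
    IsPositive h' := by
  intro e he z hz
  set e' := chartAt (Fin n → ℂ) (σ • e.symm z)
  have he' : e' ∈ atlas (Fin n → ℂ) X := chart_mem_atlas _ _
  have hz' : σ • e.symm z ∈ e'.source := mem_chart_source _ _
  rw [H e he e' he' z hz hz']
  have hJ := det_jacobian_smul_ne_zero hact σ he he' hz hz'
  set J := complexJacobian (fun w => e' (σ • e.symm w)) z with hJdef
  have h1 : J.transpose = (J.map star).conjTranspose := by ext; simp
  have h2 : IsUnit (J.map star) := by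
    rw [Matrix.isUnit_iff_isUnit_det, map_star_det, isUnit_iff_ne_zero]
    exact star_ne_zero.2 hJ
  have h3 := (hp e' he' _ (e'.map_source hz')).conjTranspose_mul_mul_same
    (Matrix.mulVec_injective_of_isUnit h2)
  rw [← h1] at h3
  exact h3

variable [BorelSpace X] [CompactSpace X] [T2Space X] [PreconnectedSpace X]

theorem ratio_pullback_invariant (hact : IsHolomorphicAction r n X) (hω₀ : IsKahlerForm ω₀)
    (hinv : IsInvariantForm r ω₀) (u : Fin r → Circle) (x : X) :
    ratio ω₀ (pullbackDensity (fun x => compactTorus u • x) (detDensity ω₀)) x = 1 := by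
  set e := chartAt (Fin n → ℂ) x
  have he : e ∈ atlas (Fin n → ℂ) X := chart_mem_atlas _ _
  have hx : x ∈ e.source := mem_chart_source _ _
  set e' := chartAt (Fin n → ℂ) (compactTorus u • x)
  have he' : e' ∈ atlas (Fin n → ℂ) X := chart_mem_atlas _ _
  have hx' : compactTorus u • x ∈ e'.source := mem_chart_source _ _
  have hex : e.symm (e x) = x := e.left_inv hx
  have h1 := ratio_pullback_det hact hω₀ (compactTorus u) he he' (e.map_source hx) (by rwa [hex])
  have h2 := (hinv u).densityPullback_det e he e' he' (e x) (e.map_source hx) (by rwa [hex])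
  simp only [detDensity] at h2
  rw [← h2, hex] at h1
  rw [h1, div_self (ne_of_gt (PosDef_det_re_pos (hω₀.positive e he _ (e.map_source hx))))]

/-- The volume form `e^{ρ₀} ω₀ⁿ` is invariant under the compact torus. -/
theorem logCocycle_compactTorus (hact : IsHolomorphicAction r n X) (hω₀ : IsKahlerForm ω₀)
    (hinv : IsInvariantForm r ω₀) (hρ₀ : IsRicciPotential ω₀ ρ₀) (u : Fin r → Circle) (x : X) :
    logCocycle ω₀ ρ₀ (compactTorus u) x = 0 := by
  have h1 : ∀ x, logCocycle ω₀ ρ₀ (compactTorus u) x = ρ₀ (compactTorus u • x) - ρ₀ x := fun x => by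
    rw [logCocycle, ratio_pullback_invariant hact hω₀ hinv]; simp
  have hsm := isSmooth_translate hact hω₀ hρ₀ (isSmooth_const (0 : ℝ)) (compactTorus u)
  have hpb := isPullback_translate hact hω₀ hρ₀ (isSmooth_const (0 : ℝ)) (compactTorus u)
  rw [perturb_zero] at hpb
  -- As ω₀ is invariant, the translate of 0 has ∂∂̄ = 0, so the cocycle is a constant.
  have hc : ∀ x y, logCocycle ω₀ ρ₀ (compactTorus u) x = logCocycle ω₀ ρ₀ (compactTorus u) y := by
    intro x y
    have := hsm.eq_of_ddbar_eq_zero hω₀ (fun e he z hz => by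
      have := IsPullback.unique hpb (hinv u) he hz
      simpa [perturb] using this) x y
    simpa [translate] using this
  have : Nonempty X := ⟨x⟩
  -- The constant equals ρ₀(u·x) - ρ₀(x) at every x: it is ≤ 0 at a maximum of ρ₀ and ≥ 0 at a
  -- minimum.
  obtain ⟨p, hp⟩ := isCompact_univ.exists_isMaxOn univ_nonempty hρ₀.smooth.continuous.continuousOn
  obtain ⟨q, hq⟩ := isCompact_univ.exists_isMinOn univ_nonempty hρ₀.smooth.continuous.continuousOn
  have hp' := hp.2 (mem_univ (compactTorus u • p))
  have hq' := hq.2 (mem_univ (compactTorus u • q))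
  simp only [mem_ofPred_eq] at hp' hq'
  have h2 := h1 p
  have h3 := h1 q
  rw [hc p x] at h2
  rw [hc q x] at h3
  linarith

end Translate

/-! ### Hamilton functions as derivatives of translates, and concavity of the cocycle -/

section Hamiltonian

variable {n r : ℕ} {X : Type*} [TopologicalSpace X] [ChartedSpace (Fin n → ℂ) X]
  [IsManifold 𝓘(ℂ, Fin n → ℂ) ω X] [MulAction (Fin r → ℂˣ) X] [MeasurableSpace X]

/-- A holomorphic torus action and an invariant Kähler form with its Ricci potential. -/
structure TorusKahler (r : ℕ) [MulAction (Fin r → ℂˣ) X] (ω₀ : CoeffForm n X) (ρ₀ : X → ℝ) :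
    Prop where
  act : IsHolomorphicAction r n X
  kahler : IsKahlerForm ω₀
  invariant : IsInvariantForm r ω₀
  ricci : IsRicciPotential ω₀ ρ₀

/-- Smooth functions invariant under the compact torus. -/
structure IsSmoothInvariant (n r : ℕ) {X : Type*} [TopologicalSpace X]
    [ChartedSpace (Fin n → ℂ) X] [MulAction (Fin r → ℂˣ) X] (φ : X → ℝ) : Prop where
  smooth : IsSmooth n φ
  invariant : ∀ (u : Fin r → Circle) (x : X), φ (compactTorus u • x) = φ x

variable {ω₀ : CoeffForm n X} {ρ₀ : X → ℝ}

theorem IsPotential.isSmoothInvariant {φ : X → ℝ} (h : IsPotential r ω₀ φ) :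
    IsSmoothInvariant n r φ := ⟨h.smooth, h.invariant⟩

theorem isSmoothInvariant_const (c : ℝ) : IsSmoothInvariant n r fun _ : X => c :=
  ⟨isSmooth_const c, fun _ _ => rfl⟩

theorem IsSmoothInvariant.add {φ ψ : X → ℝ} (hφ : IsSmoothInvariant n r φ)
    (hψ : IsSmoothInvariant n r ψ) : IsSmoothInvariant n r fun x => φ x + ψ x :=
  ⟨hφ.smooth.add hψ.smooth, fun u x => by rw [hφ.invariant, hψ.invariant]⟩

theorem IsSmoothInvariant.sub {φ ψ : X → ℝ} (hφ : IsSmoothInvariant n r φ)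
    (hψ : IsSmoothInvariant n r ψ) : IsSmoothInvariant n r fun x => φ x - ψ x :=
  ⟨hφ.smooth.sub hψ.smooth, fun u x => by rw [hφ.invariant, hψ.invariant]⟩

theorem IsSmoothInvariant.const_mul {φ : X → ℝ} (hφ : IsSmoothInvariant n r φ) (c : ℝ) :
    IsSmoothInvariant n r fun x => c * φ x :=
  ⟨(isSmooth_const c).mul hφ.smooth, fun u x => by rw [hφ.invariant]⟩

/-- The function `(w, z) ↦ σ[φ](z)`, `σ = exp w`, in the chart `e`. -/
def translateChart (ω₀ : CoeffForm n X) (ρ₀ : X → ℝ) (r : ℕ) [MulAction (Fin r → ℂˣ) X] (φ : X → ℝ)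
    (e : OpenPartialHomeomorph X (Fin n → ℂ)) (p : (Fin r → ℂ) × (Fin n → ℂ)) : ℝ :=
  translate ω₀ ρ₀ (torusExp p.1) φ (e.symm p.2)

/-- The Hamilton function of the `α`-th generator with respect to `ω_φ`. -/
def ham (ω₀ : CoeffForm n X) (ρ₀ : X → ℝ) {r : ℕ} [MulAction (Fin r → ℂˣ) X] (φ : X → ℝ)
    (α : Fin r) (x : X) : ℝ :=
  deriv (fun s : ℝ => translate ω₀ ρ₀ (torusExp (s • Pi.single α (1 : ℂ))) φ x) 0 / 2

/-- The derivative of `v` along the `α`-th generator. -/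
def genDeriv {r : ℕ} [MulAction (Fin r → ℂˣ) X] (v : X → ℝ) (α : Fin r) (x : X) : ℝ :=
  deriv (fun s : ℝ => v (torusExp (s • Pi.single α (1 : ℂ)) • x)) 0 / 2

theorem contDiffAt_translateChart (D : TorusKahler r ω₀ ρ₀) {φ : X → ℝ} (hφ : IsSmooth n φ)
    {e : OpenPartialHomeomorph X (Fin n → ℂ)} (he : e ∈ atlas (Fin n → ℂ) X)
    (w : Fin r → ℂ) {z : Fin n → ℂ} (hz : z ∈ e.target) :
    ContDiffAt ℝ ∞ (translateChart ω₀ ρ₀ r φ e) (w, z) :=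
  (translate_local D.act D.kahler D.ricci hφ he (chart_mem_atlas _ (torusExp w • e.symm z)) hz
    (mem_chart_source _ _)).1

theorem hasDerivAt_line {f : (Fin r → ℂ) × (Fin n → ℂ) → ℝ} {a : Fin r → ℂ} {s : ℝ} {z : Fin n → ℂ}
    (hf : DifferentiableAt ℝ f (s • a, z)) :
    HasDerivAt (fun s : ℝ => f (s • a, z)) (fderiv ℝ f (s • a, z) (a, 0)) s := by
  have h1 : HasDerivAt (fun s : ℝ => (s • a, z)) (a, 0) s := by
    refine HasDerivAt.prodMk ?_ (hasDerivAt_const s z)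
    simpa using (hasDerivAt_id s).smul_const a
  exact hf.hasFDerivAt.comp_hasDerivAt s h1

theorem hasDerivAt_translate (D : TorusKahler r ω₀ ρ₀) {φ : X → ℝ} (hφ : IsSmooth n φ)
    {e : OpenPartialHomeomorph X (Fin n → ℂ)} (he : e ∈ atlas (Fin n → ℂ) X)
    {z : Fin n → ℂ} (hz : z ∈ e.target) (a : Fin r → ℂ) (s : ℝ) :
    HasDerivAt (fun s : ℝ => translate ω₀ ρ₀ (torusExp (s • a)) φ (e.symm z))
      (fderiv ℝ (translateChart ω₀ ρ₀ r φ e) (s • a, z) (a, 0)) s :=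
  hasDerivAt_line ((contDiffAt_translateChart D hφ he (s • a) hz).differentiableAt (by simp))

theorem ham_symm (D : TorusKahler r ω₀ ρ₀) {φ : X → ℝ} (hφ : IsSmooth n φ)
    {e : OpenPartialHomeomorph X (Fin n → ℂ)} (he : e ∈ atlas (Fin n → ℂ) X)
    {z : Fin n → ℂ} (hz : z ∈ e.target) (α : Fin r) :
    ham ω₀ ρ₀ φ α (e.symm z) =
      fderiv ℝ (translateChart ω₀ ρ₀ r φ e) (0, z) (Pi.single α 1, 0) / 2 := by
  have := (hasDerivAt_translate D hφ he hz (Pi.single α 1) 0).deriv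
  rw [ham, this, zero_smul]

theorem contDiffAt_fderiv_slice {f : (Fin r → ℂ) × (Fin n → ℂ) → ℝ} {w : Fin r → ℂ} {z : Fin n → ℂ}
    (hf : ContDiffAt ℝ ∞ f (w, z)) (a : (Fin r → ℂ) × (Fin n → ℂ)) :
    ContDiffAt ℝ ∞ (fun z => fderiv ℝ f (w, z) a) z := by
  have h : ContDiffAt ℝ ∞ (fderiv ℝ f) (w, z) := hf.fderiv_right (by simp)
  exact (h.clm_apply contDiffAt_const).comp (f := fun y => (w, y)) z
    (contDiffAt_const.prodMk contDiffAt_id)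

theorem isSmooth_ham (D : TorusKahler r ω₀ ρ₀) {φ : X → ℝ} (hφ : IsSmooth n φ) (α : Fin r) :
    IsSmooth n (ham ω₀ ρ₀ φ α) := by
  refine isSmooth_of_contDiffAt fun e he z hz => ?_
  refine ((contDiffAt_fderiv_slice (contDiffAt_translateChart D hφ he 0 hz)
    (Pi.single α 1, 0)).div_const 2).congr_of_eventuallyEq ?_
  filter_upwards [e.open_target.mem_nhds hz] with y hy
  exact ham_symm D hφ he hy α

theorem contDiffAt_comp_action (hact : IsHolomorphicAction r n X) {v : X → ℝ} (hv : IsSmooth n v)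
    {e : OpenPartialHomeomorph X (Fin n → ℂ)} (he : e ∈ atlas (Fin n → ℂ) X)
    (w : Fin r → ℂ) {z : Fin n → ℂ} (hz : z ∈ e.target) :
    ContDiffAt ℝ ∞ (fun p : (Fin r → ℂ) × (Fin n → ℂ) => v (torusExp p.1 • e.symm p.2)) (w, z) := by
  set e' := chartAt (Fin n → ℂ) (torusExp w • e.symm z)
  have he' : e' ∈ atlas (Fin n → ℂ) X := chart_mem_atlas _ _
  have hz' : torusExp w • e.symm z ∈ e'.source := mem_chart_source _ _
  have h1 : ContDiffAt ℝ ∞ _ (w, z) := ((hact.contDiffAt he he' hz hz').restrict_scalars ℝ).of_le le_top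
  have h2 := (hv.contDiffAt he' (e'.map_source hz')).comp (w, z) h1
  refine h2.congr_of_eventuallyEq ?_
  have hc : ContinuousAt (fun p : (Fin r → ℂ) × (Fin n → ℂ) => torusExp p.1 • e.symm p.2) (w, z) := by
    refine ContinuousAt.comp (f := fun p : (Fin r → ℂ) × (Fin n → ℂ) => (p.1, e.symm p.2))
      (g := fun p : (Fin r → ℂ) × X => torusExp p.1 • p.2) hact.continuous_smul.continuousAt ?_
    exact continuousAt_fst.prodMk ((e.continuousAt_symm hz).comp (f := Prod.snd) (x := (w, z))
      continuousAt_snd)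
  filter_upwards [hc.eventually (e'.open_source.mem_nhds hz')] with p hp
  simp [e'.left_inv hp]

theorem hasDerivAt_comp_action (hact : IsHolomorphicAction r n X) {v : X → ℝ} (hv : IsSmooth n v)
    {e : OpenPartialHomeomorph X (Fin n → ℂ)} (he : e ∈ atlas (Fin n → ℂ) X)
    {z : Fin n → ℂ} (hz : z ∈ e.target) (a : Fin r → ℂ) (s : ℝ) :
    HasDerivAt (fun s : ℝ => v (torusExp (s • a) • e.symm z))
      (fderiv ℝ (fun p : (Fin r → ℂ) × (Fin n → ℂ) => v (torusExp p.1 • e.symm p.2))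
        (s • a, z) (a, 0)) s :=
  hasDerivAt_line ((contDiffAt_comp_action hact hv he (s • a) hz).differentiableAt (by simp))

theorem generator_eq_fderiv (hact : IsHolomorphicAction r n X)
    {e : OpenPartialHomeomorph X (Fin n → ℂ)} (he : e ∈ atlas (Fin n → ℂ) X)
    {z : Fin n → ℂ} (hz : z ∈ e.target) (α : Fin r) :
    fderiv ℂ (fun p : (Fin r → ℂ) × (Fin n → ℂ) => e (torusExp p.1 • e.symm p.2)) (0, z)
      (Pi.single α 1, 0) = generator r α e z := by
  have h0 : torusExp (0 : Fin r → ℂ) • e.symm z ∈ e.source := by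
    rw [torusExp_zero, one_smul]; exact e.map_target hz
  have hd := (hact.contDiffAt he he hz h0).differentiableAt (by simp)
  have h1 : HasDerivAt (fun w : ℂ => (Pi.single α w, z) : ℂ → (Fin r → ℂ) × (Fin n → ℂ))
      (Pi.single α 1, 0) 0 := by
    refine HasDerivAt.prodMk ?_ (hasDerivAt_const _ z)
    have h2 : (fun w : ℂ => (Pi.single α w : Fin r → ℂ)) = fun w => w • Pi.single α (1 : ℂ) := by
      ext w β; simp [Pi.single_apply]
    change HasDerivAt (fun w : ℂ => (Pi.single α w : Fin r → ℂ)) _ _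
    rw [h2]
    simpa using (hasDerivAt_id (0 : ℂ)).smul_const (Pi.single α (1 : ℂ) : Fin r → ℂ)
  have h3 : (0, z) = ((Pi.single α (0 : ℂ), z) : (Fin r → ℂ) × (Fin n → ℂ)) := by simp
  rw [h3] at hd ⊢
  have h4 := hd.hasFDerivAt.comp_hasDerivAt (0 : ℂ) h1
  ext i
  have h5 := (hasDerivAt_pi.1 h4 i).deriv
  rw [generator]
  exact h5.symm

/-- The real flow s ↦ exp(s) differentiates v along 2 Re ξ_α, hence the factor ½ in the definition.
-/
theorem genDeriv_symm (hact : IsHolomorphicAction r n X) {v : X → ℝ} (hv : IsSmooth n v)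
    {e : OpenPartialHomeomorph X (Fin n → ℂ)} (he : e ∈ atlas (Fin n → ℂ) X)
    {z : Fin n → ℂ} (hz : z ∈ e.target) (α : Fin r) :
    genDeriv v α (e.symm z) = (wd (fun y => v (e.symm y)) z (generator r α e z)).re := by
  have h0 : torusExp (0 : Fin r → ℂ) • e.symm z ∈ e.source := by
    rw [torusExp_zero, one_smul]; exact e.map_target hz
  have hd := (hact.contDiffAt he he hz h0).differentiableAt (by simp)
  have hΦ0 : e (torusExp (0 : Fin r → ℂ) • e.symm z) = z := by
    rw [torusExp_zero, one_smul, e.right_inv hz]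
  have h1 := (hasDerivAt_comp_action hact hv he hz (Pi.single α 1) 0).deriv
  have h2 : (fun p : (Fin r → ℂ) × (Fin n → ℂ) => v (torusExp p.1 • e.symm p.2)) =ᶠ[nhds (0, z)]
      fun p => (fun y => v (e.symm y)) (e (torusExp p.1 • e.symm p.2)) := by
    have hc : ContinuousAt (fun p : (Fin r → ℂ) × (Fin n → ℂ) => torusExp p.1 • e.symm p.2) (0, z) := by
      refine ContinuousAt.comp (f := fun p : (Fin r → ℂ) × (Fin n → ℂ) => (p.1, e.symm p.2))
        (g := fun p : (Fin r → ℂ) × X => torusExp p.1 • p.2) hact.continuous_smul.continuousAt ?_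
      exact continuousAt_fst.prodMk ((e.continuousAt_symm hz).comp (f := Prod.snd) (x := (0, z))
        continuousAt_snd)
    filter_upwards [hc.eventually (e.open_source.mem_nhds h0)] with p hp
    simp [e.left_inv hp]
  have hvd : DifferentiableAt ℝ (fun y => v (e.symm y)) (e (torusExp (0 : Fin r → ℂ) • e.symm z)) := by
    rw [hΦ0]; exact (hv.contDiffAt he hz).differentiableAt (by simp)
  have h3 := (HasFDerivAt.comp ((0 : Fin r → ℂ), z) hvd.hasFDerivAt
    (hd.hasFDerivAt.restrictScalars ℝ)).fderiv
  rw [zero_smul, h2.fderiv_eq] at h1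
  rw [genDeriv, h1]
  change fderiv ℝ ((fun y => v (e.symm y)) ∘ fun p : (Fin r → ℂ) × (Fin n → ℂ) =>
    e (torusExp p.1 • e.symm p.2)) (0, z) _ / 2 = _
  rw [h3, hΦ0, ContinuousLinearMap.comp_apply, ContinuousLinearMap.coe_restrictScalars',
    generator_eq_fderiv hact he hz]
  simp [wd]

theorem isSmooth_genDeriv (hact : IsHolomorphicAction r n X) {v : X → ℝ} (hv : IsSmooth n v)
    (α : Fin r) : IsSmooth n (genDeriv v α) := by
  refine isSmooth_of_contDiffAt fun e he z hz => ?_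
  refine ((contDiffAt_fderiv_slice (contDiffAt_comp_action hact hv he 0 hz)
    (Pi.single α 1, 0)).div_const 2).congr_of_eventuallyEq ?_
  filter_upwards [e.open_target.mem_nhds hz] with y hy
  have := (hasDerivAt_comp_action hact hv he hy (Pi.single α 1) 0).deriv
  rw [genDeriv, this, zero_smul]

theorem ham_add_mul (D : TorusKahler r ω₀ ρ₀) {φ v : X → ℝ} (hφ : IsSmooth n φ)
    (hv : IsSmooth n v) (c : ℝ) (α : Fin r) (x : X) :
    ham ω₀ ρ₀ (fun x => φ x + c * v x) α x = ham ω₀ ρ₀ φ α x + c * genDeriv v α x := by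
  set e := chartAt (Fin n → ℂ) x
  have he : e ∈ atlas (Fin n → ℂ) X := chart_mem_atlas _ _
  have hx : x ∈ e.source := mem_chart_source _ _
  have h1 := hasDerivAt_translate D hφ he (e.map_source hx) (Pi.single α 1) 0
  have h2 := hasDerivAt_comp_action D.act hv he (e.map_source hx) (Pi.single α 1) 0
  rw [e.left_inv hx] at h1 h2
  have h3 := h1.add (h2.const_mul c)
  have h4 : (fun s : ℝ => translate ω₀ ρ₀ (torusExp (s • Pi.single α (1 : ℂ)))
      (fun x => φ x + c * v x) x) = (fun s : ℝ => translate ω₀ ρ₀ (torusExp (s • Pi.single α (1 : ℂ)))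
      φ x) + fun s : ℝ => c * v (torusExp (s • Pi.single α (1 : ℂ)) • x) := by
    ext s; simp only [translate, Pi.add_apply]; ring
  rw [ham, ham, genDeriv, h4, h3.deriv, h1.deriv, h2.deriv]
  ring

/-- The torus is commutative, so translating by σ first only moves the base point and adds a term
independent of s. -/
theorem ham_translate (D : TorusKahler r ω₀ ρ₀) (φ : X → ℝ) (σ : Fin r → ℂˣ) (α : Fin r) (x : X) :
    ham ω₀ ρ₀ (translate ω₀ ρ₀ σ φ) α x = ham ω₀ ρ₀ φ α (σ • x) := by
  rw [ham, ham]
  congr 1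
  have : (fun s : ℝ => translate ω₀ ρ₀ (torusExp (s • Pi.single α (1 : ℂ))) (translate ω₀ ρ₀ σ φ) x)
      = fun s : ℝ => translate ω₀ ρ₀ (torusExp (s • Pi.single α (1 : ℂ))) φ (σ • x)
        - logCocycle ω₀ ρ₀ σ x := by
    ext s
    rw [← translate_mul D.act D.kahler, mul_comm, translate_mul D.act D.kahler, translate]
  rw [this, deriv_sub_const]

variable [BorelSpace X] [CompactSpace X] [T2Space X] [PreconnectedSpace X]

/-- For invariant φ the translate depends only on the real part of the logarithm of σ, so all
derivatives in imaginary torus directions vanish. -/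
theorem translate_compactTorus_mul (D : TorusKahler r ω₀ ρ₀) {φ : X → ℝ}
    (hφ : IsSmoothInvariant n r φ) (u : Fin r → Circle) (σ : Fin r → ℂˣ) :
    translate ω₀ ρ₀ (compactTorus u * σ) φ = translate ω₀ ρ₀ σ φ := by
  rw [translate_mul D.act D.kahler]
  congr 1
  ext x
  rw [translate, hφ.invariant, logCocycle_compactTorus D.act D.kahler D.invariant D.ricci, sub_zero]

theorem isSmoothInvariant_translate (D : TorusKahler r ω₀ ρ₀) {φ : X → ℝ}
    (hφ : IsSmoothInvariant n r φ) (σ : Fin r → ℂˣ) :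
    IsSmoothInvariant n r (translate ω₀ ρ₀ σ φ) := by
  refine ⟨isSmooth_translate D.act D.kahler D.ricci hφ.smooth σ, fun u x => ?_⟩
  have h1 := congrFun (translate_compactTorus_mul D hφ u σ) x
  rw [mul_comm, translate_mul D.act D.kahler, translate,
    logCocycle_compactTorus D.act D.kahler D.invariant D.ricci, sub_zero] at h1
  exact h1

theorem isPotential_translate (D : TorusKahler r ω₀ ρ₀) {φ : X → ℝ}
    (hφ : IsPotential r ω₀ φ) (σ : Fin r → ℂˣ) : IsPotential r ω₀ (translate ω₀ ρ₀ σ φ) :=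
  have h := isSmoothInvariant_translate D hφ.isSmoothInvariant σ
  ⟨h.smooth, (isPullback_translate D.act D.kahler D.ricci hφ.smooth σ).isPositive_translate D.act
    hφ.positive, h.invariant⟩

theorem isTranslate_translate (D : TorusKahler r ω₀ ρ₀) {φ : X → ℝ}
    (hφ : IsPotential r ω₀ φ) (σ : Fin r → ℂˣ) : IsTranslate ω₀ σ φ (translate ω₀ ρ₀ σ φ) :=
  ⟨isPotential_translate D hφ σ, isPullback_translate D.act D.kahler D.ricci hφ.smooth σ⟩

theorem translateChart_add_imag (D : TorusKahler r ω₀ ρ₀) {φ : X → ℝ}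
    (hφ : IsSmoothInvariant n r φ) (e : OpenPartialHomeomorph X (Fin n → ℂ)) (b : Fin r → ℝ)
    (w : Fin r → ℂ) (z : Fin n → ℂ) :
    translateChart ω₀ ρ₀ r φ e ((fun α => (b α : ℂ) * Complex.I) + w, z) =
      translateChart ω₀ ρ₀ r φ e (w, z) := by
  simp only [translateChart]
  rw [torusExp_add, torusExp_imag, translate_compactTorus_mul D hφ]

theorem fderiv_translateChart_imag (D : TorusKahler r ω₀ ρ₀) {φ : X → ℝ}
    (hφ : IsSmoothInvariant n r φ) {e : OpenPartialHomeomorph X (Fin n → ℂ)}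
    (he : e ∈ atlas (Fin n → ℂ) X) (b : Fin r → ℝ) (w : Fin r → ℂ) {z : Fin n → ℂ}
    (hz : z ∈ e.target) :
    fderiv ℝ (translateChart ω₀ ρ₀ r φ e) (w, z) (fun α => (b α : ℂ) * Complex.I, 0) = 0 := by
  have hd := (contDiffAt_translateChart D hφ.smooth he w hz).differentiableAt (by simp)
  have h1 := hd.hasFDerivAt.hasLineDerivAt (fun α => (b α : ℂ) * Complex.I, 0)
  have h2 : HasDerivAt (fun t : ℝ => translateChart ω₀ ρ₀ r φ e
      ((w, z) + t • ((fun α => (b α : ℂ) * Complex.I), (0 : Fin n → ℂ)))) 0 0 := by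
    have : (fun t : ℝ => translateChart ω₀ ρ₀ r φ e
      ((w, z) + t • ((fun α => (b α : ℂ) * Complex.I), (0 : Fin n → ℂ)))) =
        fun _ => translateChart ω₀ ρ₀ r φ e (w, z) := by
      ext t
      rw [← translateChart_add_imag D hφ e (fun α => t * b α) w z]
      congr 1
      refine Prod.ext ?_ ?_
      · ext α; simp; ring
      · simp
    rw [this]; exact hasDerivAt_const _ _
  exact HasDerivAt.unique h1 h2

theorem fderiv2_translateChart_imag (D : TorusKahler r ω₀ ρ₀) {φ : X → ℝ}
    (hφ : IsSmoothInvariant n r φ) {e : OpenPartialHomeomorph X (Fin n → ℂ)}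
    (he : e ∈ atlas (Fin n → ℂ) X) (b : Fin r → ℝ) (w : Fin r → ℂ) {z : Fin n → ℂ}
    (hz : z ∈ e.target) (A : (Fin r → ℂ) × (Fin n → ℂ)) :
    fderiv ℝ (fderiv ℝ (translateChart ω₀ ρ₀ r φ e)) (w, z) (fun α => (b α : ℂ) * Complex.I, 0) A = 0 := by
  have hc := (contDiffAt_translateChart D hφ.smooth he w hz).of_le (nat_le_infty 2)
  have hs := hc.isSymmSndFDerivAt (by simp)
  rw [hs]
  have hD := ContDiffAt.differentiableAt_fderiv hc
  have h1 : fderiv ℝ (fun p => fderiv ℝ (translateChart ω₀ ρ₀ r φ e) p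
      ((fun α => (b α : ℂ) * Complex.I), (0 : Fin n → ℂ))) (w, z) A =
      fderiv ℝ (fderiv ℝ (translateChart ω₀ ρ₀ r φ e)) (w, z) A (fun α => (b α : ℂ) * Complex.I, 0) := by
    rw [fderiv_clm_apply hD (differentiableAt_const _)]
    simp
  rw [← h1]
  have h2 : (fun p => fderiv ℝ (translateChart ω₀ ρ₀ r φ e) p
      ((fun α => (b α : ℂ) * Complex.I), (0 : Fin n → ℂ))) =ᶠ[nhds (w, z)] fun _ => 0 := by
    filter_upwards [(continuousAt_snd (p := (w, z))).eventually (e.open_target.mem_nhds hz)] with p hp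
    exact fderiv_translateChart_imag D hφ he b p.1 hp
  rw [h2.fderiv_eq]; simp

theorem I_smul_real (b : Fin r → ℝ) :
    Complex.I • ((fun α => (b α : ℂ), 0) : (Fin r → ℂ) × (Fin n → ℂ)) =
      (fun α => (b α : ℂ) * Complex.I, 0) := by
  refine Prod.ext ?_ ?_
  · ext α; simp [mul_comm]
  · simp

/-- The mixed part of the joint Levi form at w = 0, with one vector along the torus and one along X.
There the action map has derivative ξ_α in the torus direction and the identity on X, and the ω₀
term is absent. As imaginary torus derivatives vanish, the left vector reduces to half a real
derivative, which is the Hamilton function. -/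
theorem dzbar_ham (D : TorusKahler r ω₀ ρ₀) {φ : X → ℝ} (hφ : IsSmoothInvariant n r φ)
    {e : OpenPartialHomeomorph X (Fin n → ℂ)} (he : e ∈ atlas (Fin n → ℂ) X)
    {z : Fin n → ℂ} (hz : z ∈ e.target) (α : Fin r) (j : Fin n) :
    ∑ i, generator r α e z i * perturb ω₀ φ e z i j =
      dzbar j (fun w => (ham ω₀ ρ₀ φ α (e.symm w) : ℂ)) z := by
  have h0 : torusExp (0 : Fin r → ℂ) • e.symm z ∈ e.source := by
    rw [torusExp_zero, one_smul]; exact e.map_target hz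
  have hΦ0 : e (torusExp (0 : Fin r → ℂ) • e.symm z) = z := by
    rw [torusExp_zero, one_smul, e.right_inv hz]
  have hL := (translate_local D.act D.kahler D.ricci hφ.smooth he he hz h0).2
    (Pi.single α 1, 0) (0, Pi.single j 1)
  have hd := (D.act.contDiffAt he he hz h0).differentiableAt (by simp)
  have hslice : fderiv ℂ (fun p : (Fin r → ℂ) × (Fin n → ℂ) => e (torusExp p.1 • e.symm p.2)) (0, z)
      (0, Pi.single j 1) = Pi.single j 1 := by
    rw [← fderiv_slice hd]
    have : (fun y => e (torusExp (0 : Fin r → ℂ) • e.symm y)) =ᶠ[nhds z] id := by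
      filter_upwards [e.open_target.mem_nhds hz] with y hy
      simp [torusExp_zero, e.right_inv hy]
    simp only [this.fderiv_eq, fderiv_id]
    rfl
  rw [generator_eq_fderiv D.act he hz, hslice, hΦ0, sform_single_right] at hL
  have hz2 : sform (ω₀ e z) ((Pi.single α 1, 0) : (Fin r → ℂ) × (Fin n → ℂ)).2
      ((0, Pi.single j 1) : (Fin r → ℂ) × (Fin n → ℂ)).2 = 0 := by simp [sform]
  rw [hz2, sub_zero] at hL
  rw [← hL]
  have hc := contDiffAt_translateChart D hφ.smooth he (0 : Fin r → ℂ) hz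
  have hc2 := hc.of_le (nat_le_infty 2)
  have hs := hc2.isSymmSndFDerivAt (by simp)
  have hD := ContDiffAt.differentiableAt_fderiv hc2
  set f := translateChart ω₀ ρ₀ r φ e with hf
  change levi f (0, z) _ _ = _
  have hA : ((Pi.single α 1, 0) : (Fin r → ℂ) × (Fin n → ℂ)) =
      (fun β => (((Pi.single α 1 : Fin r → ℝ) β : ℝ) : ℂ), 0) := by
    refine Prod.ext ?_ rfl
    ext β; by_cases h : β = α
    · subst h; simp
    · simp [h]
  have hI : Complex.I • ((Pi.single α 1, 0) : (Fin r → ℂ) × (Fin n → ℂ)) =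
      (fun β => (((Pi.single α 1 : Fin r → ℝ) β : ℝ) : ℂ) * Complex.I, 0) := by
    rw [hA, I_smul_real]
  have hzero := fun A => fderiv2_translateChart_imag D hφ he (Pi.single α 1) (0 : Fin r → ℂ) hz A
  rw [← hf] at hzero
  -- the derivative of the Hamilton function
  have hev : (fun w => ham ω₀ ρ₀ φ α (e.symm w)) =ᶠ[nhds z]
      fun y => fderiv ℝ f (0, y) (Pi.single α 1, 0) / 2 := by
    filter_upwards [e.open_target.mem_nhds hz] with y hy
    exact ham_symm D hφ.smooth he hy α
  have hder : ∀ a : Fin n → ℂ, fderiv ℝ (fun w => ham ω₀ ρ₀ φ α (e.symm w)) z a =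
      fderiv ℝ (fderiv ℝ f) (0, z) (0, a) (Pi.single α 1, 0) / 2 := by
    intro a
    rw [hev.fderiv_eq]
    have h1 : HasFDerivAt (fun y : Fin n → ℂ => ((0 : Fin r → ℂ), y))
      (ContinuousLinearMap.inr ℝ (Fin r → ℂ) (Fin n → ℂ)) z := hasFDerivAt_prodMk_right _ _
    have h2 : HasFDerivAt (fun y => fderiv ℝ f (0, y) (Pi.single α 1, 0)) _ z :=
      (HasFDerivAt.comp z (f := fun y : Fin n → ℂ => ((0 : Fin r → ℂ), y)) hD.hasFDerivAt h1).clm_apply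
        (hasFDerivAt_const _ z)
    have h3 := (h2.mul_const (2 : ℝ)⁻¹).fderiv
    simp only [← div_eq_mul_inv] at h3
    rw [h3]
    simp [div_eq_inv_mul]
  have hdiff : DifferentiableAt ℝ (fun w => ham ω₀ ρ₀ φ α (e.symm w)) z :=
    ((isSmooth_ham D hφ.smooth α).contDiffAt he hz).differentiableAt (by simp)
  have hIb : Complex.I • ((0, Pi.single j 1) : (Fin r → ℂ) × (Fin n → ℂ)) =
      (0, Complex.I • Pi.single j 1) := by
    refine Prod.ext ?_ ?_ <;> simp
  rw [dzbar, fderiv_ofReal hdiff, fderiv_ofReal hdiff, hder, hder, single_I, levi, hI, hzero, hzero,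
    hIb, hs (Pi.single α 1, 0), hs (Pi.single α 1, 0)]
  push_cast
  ring

/-- `log (σ^*Ω / Ω)` is concave along one-parameter groups `σ = exp (s b)`. -/
theorem concaveOn_logCocycle (D : TorusKahler r ω₀ ρ₀) (b : Fin r → ℝ) (x : X) :
    ConcaveOn ℝ univ fun s : ℝ => logCocycle ω₀ ρ₀ (torusExp (s • fun α => (b α : ℂ))) x := by
  set e := chartAt (Fin n → ℂ) x
  have he : e ∈ atlas (Fin n → ℂ) X := chart_mem_atlas _ _
  have hx : x ∈ e.source := mem_chart_source _ _
  have hz := e.map_source hx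
  set f := translateChart ω₀ ρ₀ r (fun _ => (0 : ℝ)) e with hf
  set a : Fin r → ℂ := fun α => (b α : ℂ) with ha
  have h0 := isSmoothInvariant_const (n := n) (r := r) (X := X) (0 : ℝ)
  set K : ℝ → ℝ := fun s => translate ω₀ ρ₀ (torusExp (s • a)) (fun _ => (0 : ℝ)) x with hK
  have hK1 : ∀ s, HasDerivAt K (fderiv ℝ f (s • a, e x) (a, 0)) s := fun s => by
    have := hasDerivAt_translate D h0.smooth he hz a s
    rwa [e.left_inv hx] at this
  have hK1' : deriv K = fun s => fderiv ℝ f (s • a, e x) (a, 0) := by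
    ext s; exact (hK1 s).deriv
  have hK2 : ∀ s, HasDerivAt (deriv K) (fderiv ℝ (fderiv ℝ f) (s • a, e x) (a, 0) (a, 0)) s := by
    intro s
    rw [hK1']
    have hc := (contDiffAt_translateChart D h0.smooth he (s • a) hz).of_le (nat_le_infty 2)
    have hD := ContDiffAt.differentiableAt_fderiv hc
    have h1 : HasDerivAt (fun s : ℝ => (s • a, e x)) (a, 0) s := by
      refine HasDerivAt.prodMk ?_ (hasDerivAt_const s _)
      simpa using (hasDerivAt_id s).smul_const a
    have h2 := hD.hasFDerivAt.comp_hasDerivAt s h1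
    have h3 := h2.clm_apply (hasDerivAt_const s ((a, 0) : (Fin r → ℂ) × (Fin n → ℂ)))
    simpa using h3
  -- With imaginary torus derivatives zero, the Levi form in a real torus direction is a quarter of
  -- the second derivative in s. It equals the squared ω₀-length of the velocity of the orbit.
  have hnn : ∀ s : ℝ, 0 ≤ fderiv ℝ (fderiv ℝ f) (s • a, e x) (a, 0) (a, 0) := by
    intro s
    set e' := chartAt (Fin n → ℂ) (torusExp (s • a) • e.symm (e x))
    have he' : e' ∈ atlas (Fin n → ℂ) X := chart_mem_atlas _ _
    have hx' : torusExp (s • a) • e.symm (e x) ∈ e'.source := mem_chart_source _ _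
    have hL := (translate_local D.act D.kahler D.ricci h0.smooth he he' hz hx').2 (a, 0) (a, 0)
    have hz2 : sform (ω₀ e (e x)) ((a, 0) : (Fin r → ℂ) × (Fin n → ℂ)).2
      ((a, 0) : (Fin r → ℂ) × (Fin n → ℂ)).2 = 0 := by simp [sform]
    rw [hz2, sub_zero, perturb_zero] at hL
    change levi f (s • a, e x) (a, 0) (a, 0) = _ at hL
    have hzero := fun A => fderiv2_translateChart_imag D h0 he b (s • a) hz A
    rw [← hf] at hzero
    have hc := (contDiffAt_translateChart D h0.smooth he (s • a) hz).of_le (nat_le_infty 2)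
    have hs := hc.isSymmSndFDerivAt (by simp)
    rw [← hf] at hs
    have hIa : Complex.I • ((a, 0) : (Fin r → ℂ) × (Fin n → ℂ)) =
        (fun α => (b α : ℂ) * Complex.I, 0) := I_smul_real b
    rw [levi, hIa, hzero, hzero, hs (a, 0) (fun α => (b α : ℂ) * Complex.I, 0), hzero] at hL
    set c := fderiv ℂ (fun p : (Fin r → ℂ) × (Fin n → ℂ) => e' (torusExp p.1 • e.symm p.2))
      (s • a, e x) (a, 0)
    have hpos : 0 ≤ sform (ω₀ e' (e' (torusExp (s • a) • e.symm (e x)))) c c := by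
      have := (D.kahler.positive e' he' _ (e'.map_source hx')).posSemidef.dotProduct_mulVec_nonneg
        (star c)
      convert this using 1
      simp only [sform, dotProduct, Matrix.mulVec, Pi.star_apply, star_star, Finset.mul_sum]
      exact Finset.sum_congr rfl fun i _ => Finset.sum_congr rfl fun j _ => by ring
    have hre := congrArg Complex.re hL
    have hpos' := (Complex.le_def.1 hpos).1
    rw [← hre] at hpos'
    simp at hpos'
    linarith
  have hconv : ConvexOn ℝ univ K := by
    refine convexOn_univ_of_deriv2_nonneg (fun s => (hK1 s).differentiableAt)
      (fun s => (hK2 s).differentiableAt) fun s => ?_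
    rw [Function.iterate_succ, Function.iterate_one, Function.comp_apply, (hK2 s).deriv]
    exact hnn s
  have hneg := hconv.neg
  have hKeq : (fun s : ℝ => logCocycle ω₀ ρ₀ (torusExp (s • fun α => (b α : ℂ))) x) = -K := by
    ext s
    simp [hK, ha, translate]
  rw [hKeq]
  exact hneg

end Hamiltonian

/-! ### Differentiation under the integral sign over compact spaces -/

section ParametricIntegral

variable {Y : Type*} [TopologicalSpace Y] [MeasurableSpace Y] [OpensMeasurableSpace Y]
  {μ : Measure Y} [IsFiniteMeasure μ]

/-- Differentiation under the integral sign over a compact set. -/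
theorem hasDerivAt_setIntegral_of_continuous {K : Set Y} (hK : IsCompact K) (hKm : MeasurableSet K)
    {F F' : ℝ → Y → ℝ} (hF : ∀ s, Continuous (F s)) (hF' : Continuous (Function.uncurry F'))
    (h : ∀ s y, HasDerivAt (fun s => F s y) (F' s y) s) (s₀ : ℝ) :
    HasDerivAt (fun s => ∫ y in K, F s y ∂μ) (∫ y in K, F' s₀ y ∂μ) s₀ := by
  obtain ⟨M, hM⟩ := ((isCompact_Icc (a := s₀ - 1) (b := s₀ + 1)).prod hK).bddAbove_image
    hF'.norm.continuousOn
  have hcont : ∀ s, IntegrableOn (F s) K μ := fun s =>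
    (hF s).continuousOn.integrableOn_of_subset_isCompact hK hKm subset_rfl (measure_ne_top _ _)
  refine (hasDerivAt_integral_of_dominated_loc_of_deriv_le (μ := μ.restrict K)
    (F := F) (F' := F') (bound := fun _ => M) (s := Icc (s₀ - 1) (s₀ + 1))
    (Icc_mem_nhds (by linarith) (by linarith)) ?_ (hcont s₀) ?_ ?_ (integrable_const _) ?_).2
  · exact Filter.Eventually.of_forall fun s => (hcont s).aestronglyMeasurable
  · have : Continuous (F' s₀) := hF'.comp (continuous_const.prodMk continuous_id)
    exact (this.continuousOn.integrableOn_of_subset_isCompact hK hKm subset_rfl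
      (measure_ne_top _ _)).aestronglyMeasurable
  · refine (ae_restrict_iff' hKm).2 (Filter.Eventually.of_forall fun y hy s hs => ?_)
    exact hM ⟨(s, y), ⟨hs, hy⟩, rfl⟩
  · exact Filter.Eventually.of_forall fun y s _ => h s y

theorem hasDerivAt_integral_of_continuous [CompactSpace Y]
    {F F' : ℝ → Y → ℝ} (hF : ∀ s, Continuous (F s)) (hF' : Continuous (Function.uncurry F'))
    (h : ∀ s y, HasDerivAt (fun s => F s y) (F' s y) s) (s₀ : ℝ) :
    HasDerivAt (fun s => ∫ y, F s y ∂μ) (∫ y, F' s₀ y ∂μ) s₀ := by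
  simpa using hasDerivAt_setIntegral_of_continuous (μ := μ) isCompact_univ MeasurableSet.univ hF hF' h s₀

theorem continuous_integral_of_continuous [CompactSpace Y] {P : Type*} [TopologicalSpace P]
    [FirstCountableTopology P] [LocallyCompactSpace P]
    {F : P → Y → ℝ} (hF : Continuous (Function.uncurry F)) : Continuous fun p => ∫ y, F p y ∂μ := by
  simpa using continuous_parametric_integral_of_continuous (μ := μ) hF isCompact_univ

end ParametricIntegral

/-! ### Two-parameter linear families of potentials -/

section Family

variable {n : ℕ} {X : Type*} [TopologicalSpace X] [ChartedSpace (Fin n → ℂ) X]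
  [IsManifold 𝓘(ℂ, Fin n → ℂ) ω X] {ω₀ : CoeffForm n X}

theorem ddbar_comb {φ v : X → ℝ} (hφ : IsSmooth n φ) (hv : IsSmooth n v) (a b : ℝ)
    {e : OpenPartialHomeomorph X (Fin n → ℂ)} (he : e ∈ atlas (Fin n → ℂ) X)
    {z : Fin n → ℂ} (hz : z ∈ e.target) :
    (ddbar (fun x => a * φ x + b * v x) : CoeffForm n X) e z =
      (a : ℂ) • (ddbar φ : CoeffForm n X) e z + (b : ℂ) • (ddbar v : CoeffForm n X) e z := by
  have h1 := (hφ.contDiffAt he hz).of_le (nat_le_infty 2)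
  have h2 := (hv.contDiffAt he hz).of_le (nat_le_infty 2)
  simp only [ddbar]
  rw [complexHessian_add (contDiffAt_const.mul h1) (contDiffAt_const.mul h2),
    complexHessian_const_mul h1, complexHessian_const_mul h2]

theorem contDiffAt_perturb_comb (hω₀ : IsKahlerForm ω₀) {φ v : X → ℝ} (hφ : IsSmooth n φ)
    (hv : IsSmooth n v) {e : OpenPartialHomeomorph X (Fin n → ℂ)} (he : e ∈ atlas (Fin n → ℂ) X)
    (p : ℝ × ℝ) {z : Fin n → ℂ} (hz : z ∈ e.target) (i j : Fin n) :
    ContDiffAt ℝ ∞ (fun q : (ℝ × ℝ) × (Fin n → ℂ) =>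
      perturb ω₀ (fun x => q.1.1 * φ x + q.1.2 * v x) e q.2 i j) (p, z) := by
  have h1 : ContDiffAt ℝ ∞ (fun q : (ℝ × ℝ) × (Fin n → ℂ) => ω₀ e q.2 i j +
      ((q.1.1 : ℂ) * (ddbar φ : CoeffForm n X) e q.2 i j +
        (q.1.2 : ℂ) * (ddbar v : CoeffForm n X) e q.2 i j)) (p, z) := by
    have ha : ContDiffAt ℝ ∞ (fun q : (ℝ × ℝ) × (Fin n → ℂ) => (q.1.1 : ℂ)) (p, z) :=
      contDiffAt_ofReal (contDiffAt_fst.fst)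
    have hb : ContDiffAt ℝ ∞ (fun q : (ℝ × ℝ) × (Fin n → ℂ) => (q.1.2 : ℂ)) (p, z) :=
      contDiffAt_ofReal (contDiffAt_fst.snd)
    have h0 := (hω₀.isClosedForm.smooth e he z hz i j).comp (p, z) (f := Prod.snd) contDiffAt_snd
    have h1 := (hφ.contDiffAt_ddbar he hz i j).comp (p, z) (f := Prod.snd) contDiffAt_snd
    have h2 := (hv.contDiffAt_ddbar he hz i j).comp (p, z) (f := Prod.snd) contDiffAt_snd
    exact h0.add ((ha.mul h1).add (hb.mul h2))
  refine h1.congr_of_eventuallyEq ?_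
  filter_upwards [(continuousAt_snd (p := (p, z))).eventually (e.open_target.mem_nhds hz)] with q hq
  rw [perturb, ddbar_comb hφ hv _ _ he hq]
  simp

variable [MeasurableSpace X] [BorelSpace X]

theorem IsSmooth.comb {φ v : X → ℝ} (hφ : IsSmooth n φ) (hv : IsSmooth n v) (a b : ℝ) :
    IsSmooth n fun x => a * φ x + b * v x :=
  ((isSmooth_const a).mul hφ).add ((isSmooth_const b).mul hv)

theorem continuous_ratio_det_comb (hω₀ : IsKahlerForm ω₀) {φ v : X → ℝ} (hφ : IsSmooth n φ)
    (hv : IsSmooth n v) : Continuous fun q : (ℝ × ℝ) × X =>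
      ratio ω₀ (detDensity (perturb ω₀ fun x => q.1.1 * φ x + q.1.2 * v x)) q.2 := by
  refine continuousAt_ratio hω₀ (d := fun p : ℝ × ℝ =>
    detDensity (perturb ω₀ fun x => p.1 * φ x + p.2 * v x))
    (fun p => ((hω₀.isClosedForm.perturb (hφ.comb hv _ _)).compatible).densityPullback_det) ?_
  intro e he p z hz
  exact Complex.continuous_re.continuousAt.comp
    (contDiffAt_det (contDiffAt_perturb_comb hω₀ hφ hv he p hz)).continuousAt

theorem continuous_ratio_trace_comb (hω₀ : IsKahlerForm ω₀) {φ v : X → ℝ} (hφ : IsSmooth n φ)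
    (hv : IsSmooth n v) {k : CoeffForm n X} (hk : IsPullback id k k)
    (hks : ∀ e ∈ atlas (Fin n → ℂ) X, ∀ z ∈ e.target, ∀ i j, ContinuousAt (fun w => k e w i j) z) :
    Continuous fun q : (ℝ × ℝ) × X =>
      ratio ω₀ (traceDensity (perturb ω₀ fun x => q.1.1 * φ x + q.1.2 * v x) k) q.2 := by
  refine continuousAt_ratio hω₀ (d := fun p : ℝ × ℝ =>
    traceDensity (perturb ω₀ fun x => p.1 * φ x + p.2 * v x) k)
    (fun p => ((hω₀.isClosedForm.perturb (hφ.comb hv _ _)).compatible).densityPullback_trace hk) ?_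
  intro e he p z hz
  simp only [traceDensity, trace_adjugate_mul_eq_sum]
  refine Complex.continuous_re.continuousAt.comp ?_
  refine tendsto_finsetSum _ fun i _ => tendsto_finsetSum _ fun j _ => ?_
  refine ContinuousAt.mul (contDiffAt_adjugate
    (contDiffAt_perturb_comb hω₀ hφ hv he p hz) j i).continuousAt ?_
  exact (hks e he z hz i j).comp (f := Prod.snd) (x := (p, z)) continuousAt_snd

theorem continuousAt_gradForm {u v : X → ℝ} (hu : IsSmooth n u) (hv : IsSmooth n v)
    {e : OpenPartialHomeomorph X (Fin n → ℂ)} (he : e ∈ atlas (Fin n → ℂ) X)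
    {z : Fin n → ℂ} (hz : z ∈ e.target) (i j : Fin n) :
    ContinuousAt (fun w => (gradForm v u : CoeffForm n X) e w i j) z :=
  (contDiffAt_wd (hv.contDiffAt he hz) _).continuousAt.mul
    (continuous_star.continuousAt.comp (contDiffAt_wd (hu.contDiffAt he hz) _).continuousAt)

/-- `d/dτ det (h + τ ∂∂̄v) = tr (adj h · ∂∂̄v)`. -/
theorem hasDerivAt_ratio_det (ω₀ : CoeffForm n X) {φ v : X → ℝ} (hφ : IsSmooth n φ)
    (hv : IsSmooth n v) (a : ℝ) (τ : ℝ) (x : X) :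
    HasDerivAt (fun τ => ratio ω₀ (detDensity (perturb ω₀ fun x => a * φ x + τ * v x)) x)
      (ratio ω₀ (traceDensity (perturb ω₀ fun x => a * φ x + τ * v x) (ddbar v)) x) τ := by
  set e := chartAt (Fin n → ℂ) x
  have he : e ∈ atlas (Fin n → ℂ) X := chart_mem_atlas _ _
  have hz : e x ∈ e.target := e.map_source (mem_chart_source _ _)
  set M : ℝ → Matrix (Fin n) (Fin n) ℂ := fun τ => perturb ω₀ (fun x => a * φ x + τ * v x) e (e x)
    with hM
  have hM' : ∀ i j, HasFDerivAt (fun τ => M τ i j)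
      (ContinuousLinearMap.toSpanSingleton ℝ ((ddbar v : CoeffForm n X) e (e x) i j)) τ := by
    intro i j
    have h1 : (fun τ => M τ i j) = fun τ : ℝ => (ω₀ e (e x) i j +
        (a : ℂ) * (ddbar φ : CoeffForm n X) e (e x) i j) +
          (τ : ℂ) * (ddbar v : CoeffForm n X) e (e x) i j := by
      ext τ
      simp only [hM]
      rw [perturb, ddbar_comb hφ hv _ _ he hz]
      simp [add_assoc]
    rw [h1]
    have h2 := (Complex.ofRealCLM.hasDerivAt (x := τ)).mul_const
      ((ddbar v : CoeffForm n X) e (e x) i j)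
    have h3 := (h2.const_add (ω₀ e (e x) i j +
        (a : ℂ) * (ddbar φ : CoeffForm n X) e (e x) i j)).hasFDerivAt
    simpa using h3
  have h1 := (hasFDerivAt_det hM').hasDerivAt
  have h2 := (Complex.reCLM.hasFDerivAt.comp_hasDerivAt τ h1).div_const (ω₀ e (e x)).det.re
  have h3 : ratio ω₀ (traceDensity (perturb ω₀ fun x => a * φ x + τ * v x) (ddbar v)) x =
      Complex.reCLM ((∑ i, ∑ j, (M τ).adjugate j i • ContinuousLinearMap.toSpanSingleton ℝ
        ((ddbar v : CoeffForm n X) e (e x) i j)) 1) / (ω₀ e (e x)).det.re := by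
    simp only [ratio, traceDensity, trace_adjugate_mul_eq_sum]
    simp [hM, e]
  rw [h3]
  exact h2

end Family

/-! ### Weighted volumes and their first variation -/

section Variation

variable {n r : ℕ} {X : Type*} [TopologicalSpace X] [ChartedSpace (Fin n → ℂ) X]
  [IsManifold 𝓘(ℂ, Fin n → ℂ) ω X] [MulAction (Fin r → ℂˣ) X] [MeasurableSpace X]
  [BorelSpace X] [CompactSpace X] [T2Space X] [PreconnectedSpace X]
  {ω₀ : CoeffForm n X} {ρ₀ : X → ℝ}

/-- The moment map of `ω_φ`, shifted by the constant vector `c`. -/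
def moment (ω₀ : CoeffForm n X) (ρ₀ : X → ℝ) (c : Fin r → ℝ) (φ : X → ℝ) (x : X) : Fin r → ℝ :=
  fun α => ham ω₀ ρ₀ φ α x - c α

/-- `∫ u G(μ_φ) ω_φⁿ`. -/
def gWeight (ω₀ : CoeffForm n X) (ρ₀ : X → ℝ) (c : Fin r → ℝ) (G : (Fin r → ℝ) → ℝ)
    (φ u : X → ℝ) : ℝ :=
  ∫ x, u x * (G (moment ω₀ ρ₀ c φ x) * ratio ω₀ (detDensity (perturb ω₀ φ)) x) ∂(vol ω₀)

/-- The weighted Dirichlet form `n ∫ G(μ_φ) √-1 ∂v ∧ ∂̄u ∧ ω_φⁿ⁻¹`. -/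
def gDirichlet (ω₀ : CoeffForm n X) (ρ₀ : X → ℝ) (c : Fin r → ℝ) (G : (Fin r → ℝ) → ℝ)
    (φ v u : X → ℝ) : ℝ :=
  ∫ x, G (moment ω₀ ρ₀ c φ x) * ratio ω₀ (traceDensity (perturb ω₀ φ) (gradForm v u)) x ∂(vol ω₀)

/-- The translate is φ∘σ minus a term independent of φ, so the Hamilton functions depend affinely on
the potential. -/
theorem moment_comb (D : TorusKahler r ω₀ ρ₀) (c : Fin r → ℝ) {φ v : X → ℝ} (hφ : IsSmooth n φ)
    (hv : IsSmooth n v) (a b : ℝ) (x : X) (α : Fin r) :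
    moment ω₀ ρ₀ c (fun x => a * φ x + b * v x) x α =
      moment ω₀ ρ₀ c (fun _ => 0) x α + a * genDeriv φ α x + b * genDeriv v α x := by
  have h1 := ham_add_mul D ((isSmooth_const a).mul hφ) hv b α x
  have h2 := ham_add_mul D (isSmooth_const (0 : ℝ)) hφ a α x
  simp only [zero_add] at h2
  simp only [moment, h1, h2]
  ring

theorem continuous_moment_comb (D : TorusKahler r ω₀ ρ₀) (c : Fin r → ℝ) {φ v : X → ℝ}
    (hφ : IsSmooth n φ) (hv : IsSmooth n v) :
    Continuous fun q : (ℝ × ℝ) × X => moment ω₀ ρ₀ c (fun x => q.1.1 * φ x + q.1.2 * v x) q.2 := by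
  refine continuous_pi fun α => ?_
  simp only [moment_comb D c hφ hv]
  have h0 := (isSmooth_ham D (isSmooth_const (0 : ℝ)) α).continuous
  have h1 := (isSmooth_genDeriv D.act hφ α).continuous
  have h2 := (isSmooth_genDeriv D.act hv α).continuous
  simp only [moment]
  fun_prop

theorem contDiffAt_moment (D : TorusKahler r ω₀ ρ₀) (c : Fin r → ℝ) {φ : X → ℝ}
    (hφ : IsSmooth n φ) {e : OpenPartialHomeomorph X (Fin n → ℂ)} (he : e ∈ atlas (Fin n → ℂ) X)
    {z : Fin n → ℂ} (hz : z ∈ e.target) :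
    ContDiffAt ℝ ∞ (fun w => moment ω₀ ρ₀ c φ (e.symm w)) z :=
  contDiffAt_pi.2 fun α => ((isSmooth_ham D hφ α).contDiffAt he hz).sub contDiffAt_const

theorem isSmooth_comp_moment (D : TorusKahler r ω₀ ρ₀) (c : Fin r → ℝ) {G : (Fin r → ℝ) → ℝ}
    (hG : ContDiff ℝ ∞ G) {φ : X → ℝ} (hφ : IsSmooth n φ) :
    IsSmooth n fun x => G (moment ω₀ ρ₀ c φ x) :=
  isSmooth_of_contDiffAt fun _ he _ hz => hG.contDiffAt.comp _ (contDiffAt_moment D c hφ he hz)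

/-- By the Hamilton equation ∂̄θ_α is ω_φ contracted with ξ_α; the adjugate inverts ω_φ up to the
determinant and leaves ξ_α(v). -/
theorem trace_adjugate_gradForm_ham (D : TorusKahler r ω₀ ρ₀) {φ : X → ℝ}
    (hφ : IsSmoothInvariant n r φ) {v : X → ℝ}
    {e : OpenPartialHomeomorph X (Fin n → ℂ)} (he : e ∈ atlas (Fin n → ℂ) X)
    {z : Fin n → ℂ} (hz : z ∈ e.target) (α : Fin r) :
    ((perturb ω₀ φ e z).adjugate * gradForm v (ham ω₀ ρ₀ φ α) e z).trace =
      (perturb ω₀ φ e z).det * wd (fun y => v (e.symm y)) z (generator r α e z) := by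
  set H := perturb ω₀ φ e z
  have h1 : ∀ j, star (wd (fun w => ham ω₀ ρ₀ φ α (e.symm w)) z (Pi.single j 1)) =
      ∑ k, generator r α e z k * H k j := fun j => by
    rw [dzbar_ham D hφ he hz, dzbar_ofReal
      (((isSmooth_ham D hφ.smooth α).contDiffAt he hz).differentiableAt (by simp))]
  rw [trace_adjugate_mul_eq_sum, wd_eq_sum, Finset.mul_sum]
  have h2 : ∀ k i, ∑ j, H k j * H.adjugate j i = H.det * (1 : Matrix (Fin n) (Fin n) ℂ) k i := by
    intro k i
    have := congrFun (congrFun (Matrix.mul_adjugate H) k) i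
    simpa [Matrix.mul_apply] using this
  refine Finset.sum_congr rfl fun i _ => ?_
  simp only [gradForm, Matrix.of_apply, h1]
  calc _ = wd (fun y => v (e.symm y)) z (Pi.single i 1) *
        ∑ k, generator r α e z k * ∑ j, H k j * H.adjugate j i := by
        simp only [Finset.mul_sum]
        rw [Finset.sum_comm]
        refine Finset.sum_congr rfl fun k _ => Finset.sum_congr rfl fun j _ => ?_
        ring
    _ = _ := by
        simp only [h2, Matrix.one_apply]
        simp
        ring

theorem gradForm_comp_moment (D : TorusKahler r ω₀ ρ₀) (c : Fin r → ℝ) {G : (Fin r → ℝ) → ℝ}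
    (hG : ContDiff ℝ ∞ G) {φ v : X → ℝ} (hφ : IsSmooth n φ)
    {e : OpenPartialHomeomorph X (Fin n → ℂ)} (he : e ∈ atlas (Fin n → ℂ) X)
    {z : Fin n → ℂ} (hz : z ∈ e.target) :
    (gradForm v fun x => G (moment ω₀ ρ₀ c φ x) : CoeffForm n X) e z =
      ∑ α, ((fderiv ℝ G (moment ω₀ ρ₀ c φ (e.symm z)) (Pi.single α 1) : ℝ) : ℂ) •
        gradForm v (ham ω₀ ρ₀ φ α) e z := by
  have hd : ∀ α, DifferentiableAt ℝ (fun w => ham ω₀ ρ₀ φ α (e.symm w)) z := fun α =>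
    ((isSmooth_ham D hφ α).contDiffAt he hz).differentiableAt (by simp)
  have hm : HasFDerivAt (fun w => moment ω₀ ρ₀ c φ (e.symm w))
      (ContinuousLinearMap.pi fun α => fderiv ℝ (fun w => ham ω₀ ρ₀ φ α (e.symm w)) z) z :=
    hasFDerivAt_pi.2 fun α => (hd α).hasFDerivAt.sub_const _
  have h1 := ((hG.differentiable (by simp) _).hasFDerivAt.comp z hm).fderiv
  have h2 : ∀ a, fderiv ℝ (fun w => G (moment ω₀ ρ₀ c φ (e.symm w))) z a =
      ∑ α, fderiv ℝ G (moment ω₀ ρ₀ c φ (e.symm z)) (Pi.single α 1) *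
        fderiv ℝ (fun w => ham ω₀ ρ₀ φ α (e.symm w)) z a := by
    intro a
    change fderiv ℝ (G ∘ fun w => moment ω₀ ρ₀ c φ (e.symm w)) z a = _
    rw [h1, ContinuousLinearMap.comp_apply]
    set b : Fin r → ℝ := ContinuousLinearMap.pi
      (fun α => fderiv ℝ (fun w => ham ω₀ ρ₀ φ α (e.symm w)) z) a with hb
    have : b = ∑ α, b α • (Pi.single α 1 : Fin r → ℝ) := by
      ext β; simp [Pi.single_apply]
    rw [this, map_sum]
    refine Finset.sum_congr rfl fun α _ => ?_
    rw [map_smul, smul_eq_mul, mul_comm]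
    rfl
  ext i j
  simp only [gradForm, Matrix.of_apply, Matrix.sum_apply, Matrix.smul_apply, wd, h2, smul_eq_mul]
  push_cast
  simp only [star_div₀, star_sub, star_mul', star_sum, Complex.star_def, Complex.conj_ofReal,
    Complex.conj_I, Finset.mul_sum, map_ofNat, ← Finset.sum_sub_distrib, Finset.sum_div]
  refine Finset.sum_congr rfl fun α _ => ?_
  ring

theorem traceDensity_gradForm_comp_moment (D : TorusKahler r ω₀ ρ₀) (c : Fin r → ℝ)
    {G : (Fin r → ℝ) → ℝ} (hG : ContDiff ℝ ∞ G) {φ v : X → ℝ} (hφ : IsSmoothInvariant n r φ)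
    (hv : IsSmooth n v)
    {e : OpenPartialHomeomorph X (Fin n → ℂ)} (he : e ∈ atlas (Fin n → ℂ) X)
    {z : Fin n → ℂ} (hz : z ∈ e.target) :
    traceDensity (perturb ω₀ φ) (gradForm v fun x => G (moment ω₀ ρ₀ c φ x)) e z =
      fderiv ℝ G (moment ω₀ ρ₀ c φ (e.symm z)) (fun α => genDeriv v α (e.symm z)) *
        detDensity (perturb ω₀ φ) e z := by
  have hherm := (D.kahler.isClosedForm.perturb hφ.smooth).hermitian e he z hz
  rw [traceDensity, gradForm_comp_moment D c hG hφ.smooth he hz, Finset.mul_sum, Matrix.trace_sum,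
    Complex.re_sum]
  have h1 : (fun α => genDeriv v α (e.symm z) : Fin r → ℝ) =
      ∑ α, genDeriv v α (e.symm z) • (Pi.single α 1 : Fin r → ℝ) := by
    ext β; simp [Pi.single_apply]
  rw [h1, map_sum, Finset.sum_mul]
  refine Finset.sum_congr rfl fun α _ => ?_
  rw [Matrix.mul_smul, Matrix.trace_smul, trace_adjugate_gradForm_ham D hφ he hz, ← det_re_eq hherm,
    smul_eq_mul, ← mul_assoc, ← Complex.ofReal_mul, Complex.re_ofReal_mul,
    ← genDeriv_symm D.act hv he hz, map_smul, smul_eq_mul, detDensity]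
  ring

theorem gradForm_mul {u w v : X → ℝ} (hu : IsSmooth n u) (hw : IsSmooth n w)
    {e : OpenPartialHomeomorph X (Fin n → ℂ)} (he : e ∈ atlas (Fin n → ℂ) X)
    {z : Fin n → ℂ} (hz : z ∈ e.target) :
    (gradForm v fun x => u x * w x : CoeffForm n X) e z =
      (u (e.symm z) : ℂ) • gradForm v w e z + (w (e.symm z) : ℂ) • gradForm v u e z := by
  have h1 := ((hu.contDiffAt he hz).differentiableAt (by simp))
  have h2 := ((hw.contDiffAt he hz).differentiableAt (by simp))
  have h3 : ∀ a, fderiv ℝ (fun y => u (e.symm y) * w (e.symm y)) z a =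
      u (e.symm z) * fderiv ℝ (fun y => w (e.symm y)) z a +
        w (e.symm z) * fderiv ℝ (fun y => u (e.symm y)) z a := fun a => by
    rw [fderiv_fun_mul h1 h2]; simp
  ext i j
  simp only [gradForm, Matrix.of_apply, Matrix.add_apply, Matrix.smul_apply, wd, h3, smul_eq_mul]
  push_cast
  simp only [star_div₀, star_sub, star_add, star_mul', Complex.star_def, Complex.conj_ofReal,
    Complex.conj_I, map_ofNat]
  ring

/-- Splits the exact density for u·G(μ_φ) into u times the variation of G(μ_φ)ω_φⁿ in direction v,
plus the weighted gradient pairing. The derivative of G(μ_φ) along ∂v becomes dG(ξv), precisely the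
variation of the moment map. -/
theorem ratio_exactDensity_mul_comp_moment (D : TorusKahler r ω₀ ρ₀) (c : Fin r → ℝ)
    {G : (Fin r → ℝ) → ℝ} (hG : ContDiff ℝ ∞ G) {φ v u : X → ℝ} (hφ : IsSmoothInvariant n r φ)
    (hv : IsSmooth n v) (hu : IsSmooth n u) (x : X) :
    ratio ω₀ (exactDensity (perturb ω₀ φ) v fun x => u x * G (moment ω₀ ρ₀ c φ x)) x =
      u x * (fderiv ℝ G (moment ω₀ ρ₀ c φ x) (fun α => genDeriv v α x) *
          ratio ω₀ (detDensity (perturb ω₀ φ)) x +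
        G (moment ω₀ ρ₀ c φ x) * ratio ω₀ (traceDensity (perturb ω₀ φ) (ddbar v)) x) +
      G (moment ω₀ ρ₀ c φ x) * ratio ω₀ (traceDensity (perturb ω₀ φ) (gradForm v u)) x := by
  set e := chartAt (Fin n → ℂ) x
  have he : e ∈ atlas (Fin n → ℂ) X := chart_mem_atlas _ _
  have hx : x ∈ e.source := mem_chart_source _ _
  have hz := e.map_source hx
  have h1 := traceDensity_gradForm_comp_moment D c hG hφ hv he hz
  have h2 : traceDensity (perturb ω₀ φ) (gradForm v fun x => u x * G (moment ω₀ ρ₀ c φ x)) e (e x) =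
      u x * traceDensity (perturb ω₀ φ) (gradForm v fun x => G (moment ω₀ ρ₀ c φ x)) e (e x) +
        G (moment ω₀ ρ₀ c φ x) * traceDensity (perturb ω₀ φ) (gradForm v u) e (e x) := by
    simp only [traceDensity]
    rw [gradForm_mul hu (isSmooth_comp_moment D c hG hφ.smooth) he hz, Matrix.mul_add,
      Matrix.trace_add, Matrix.mul_smul, Matrix.mul_smul, Matrix.trace_smul, Matrix.trace_smul,
      smul_eq_mul, smul_eq_mul, Complex.add_re, Complex.re_ofReal_mul, Complex.re_ofReal_mul,
      e.left_inv hx]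
  rw [e.left_inv hx] at h1
  have hr : ∀ d : Density n X, ratio ω₀ d x = d e (e x) / (ω₀ e (e x)).det.re := fun d => rfl
  simp only [hr, exactDensity, h2, h1, e.left_inv hx]
  ring

theorem IsSmoothInvariant.comb {φ v : X → ℝ} (hφ : IsSmoothInvariant n r φ)
    (hv : IsSmoothInvariant n r v) (a b : ℝ) :
    IsSmoothInvariant n r fun x => a * φ x + b * v x :=
  (hφ.const_mul a).add (hv.const_mul b)

theorem continuous_gWeight_comb (D : TorusKahler r ω₀ ρ₀) (c : Fin r → ℝ)
    {G : (Fin r → ℝ) → ℝ} (hG : ContDiff ℝ ∞ G) {φ v u : X → ℝ} (hφ : IsSmooth n φ)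
    (hv : IsSmooth n v) (hu : Continuous u) :
    Continuous fun p : ℝ × ℝ => gWeight ω₀ ρ₀ c G (fun x => p.1 * φ x + p.2 * v x) u := by
  have := isFiniteMeasure_vol D.kahler.isClosedForm
  refine continuous_integral_of_continuous ?_
  have h1 := hG.continuous.comp (continuous_moment_comb D c hφ hv)
  have h2 := continuous_ratio_det_comb D.kahler hφ hv
  exact (hu.comp continuous_snd).mul (h1.mul h2)

theorem continuous_gDirichlet_comb (D : TorusKahler r ω₀ ρ₀) (c : Fin r → ℝ)
    {G : (Fin r → ℝ) → ℝ} (hG : ContDiff ℝ ∞ G) {φ v u w : X → ℝ} (hφ : IsSmooth n φ)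
    (hv : IsSmooth n v) (hu : IsSmooth n u) (hw : IsSmooth n w) :
    Continuous fun p : ℝ × ℝ => gDirichlet ω₀ ρ₀ c G (fun x => p.1 * φ x + p.2 * v x) w u := by
  have := isFiniteMeasure_vol D.kahler.isClosedForm
  refine continuous_integral_of_continuous ?_
  have h1 := hG.continuous.comp (continuous_moment_comb D c hφ hv)
  have h2 := continuous_ratio_trace_comb D.kahler hφ hv (isPullback_gradForm hu hw)
    fun e he z hz i j => continuousAt_gradForm hu hw he hz i j
  exact h1.mul h2

/-- The first variation of `∫ u G(μ_φ) ω_φⁿ`. -/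
theorem hasDerivAt_gWeight (D : TorusKahler r ω₀ ρ₀) (c : Fin r → ℝ)
    {G : (Fin r → ℝ) → ℝ} (hG : ContDiff ℝ ∞ G) {φ v u : X → ℝ} (hφ : IsSmoothInvariant n r φ)
    (hv : IsSmoothInvariant n r v) (hu : IsSmooth n u) (a τ : ℝ) :
    HasDerivAt (fun τ => gWeight ω₀ ρ₀ c G (fun x => a * φ x + τ * v x) u)
      (-gDirichlet ω₀ ρ₀ c G (fun x => a * φ x + τ * v x) v u) τ := by
  have := isFiniteMeasure_vol D.kahler.isClosedForm
  set ψ : ℝ → X → ℝ := fun τ x => a * φ x + τ * v x with hψ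
  have hψs : ∀ τ, IsSmoothInvariant n r (ψ τ) := fun τ => hφ.comb hv a τ
  have hi : Continuous fun q : ℝ × X => (((a, q.1), q.2) : (ℝ × ℝ) × X) := by fun_prop
  have hm : Continuous fun q : ℝ × X => moment ω₀ ρ₀ c (ψ q.1) q.2 :=
    (continuous_moment_comb D c hφ.smooth hv.smooth).comp hi
  have hdet : Continuous fun q : ℝ × X => ratio ω₀ (detDensity (perturb ω₀ (ψ q.1))) q.2 := by
    have h := (continuous_ratio_det_comb D.kahler hφ.smooth hv.smooth).comp hi
    exact h
  have htr : Continuous fun q : ℝ × X =>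
      ratio ω₀ (traceDensity (perturb ω₀ (ψ q.1)) (ddbar v)) q.2 := by
    have h := (continuous_ratio_trace_comb D.kahler hφ.smooth hv.smooth
      (isClosedForm_ddbar hv.smooth).compatible
      fun e he z hz i j => (hv.smooth.contDiffAt_ddbar he hz i j).continuousAt).comp hi
    exact h
  have hgd : Continuous fun x => (fun α => genDeriv v α x : Fin r → ℝ) :=
    continuous_pi fun α => (isSmooth_genDeriv D.act hv.smooth α).continuous
  set F' : ℝ → X → ℝ := fun τ x => u x * (fderiv ℝ G (moment ω₀ ρ₀ c (ψ τ) x)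
      (fun α => genDeriv v α x) * ratio ω₀ (detDensity (perturb ω₀ (ψ τ))) x +
        G (moment ω₀ ρ₀ c (ψ τ) x) *
          ratio ω₀ (traceDensity (perturb ω₀ (ψ τ)) (ddbar v)) x) with hF'
  have hF'c : Continuous (Function.uncurry F') := by
    have h1 : Continuous fun q : ℝ × X => fderiv ℝ G (moment ω₀ ρ₀ c (ψ q.1) q.2)
        (fun α => genDeriv v α q.2) :=
      ((hG.continuous_fderiv (by simp)).comp hm).clm_apply (hgd.comp continuous_snd)
    exact (hu.continuous.comp continuous_snd).mul
      ((h1.mul hdet).add ((hG.continuous.comp hm).mul htr))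
  have key := hasDerivAt_integral_of_continuous (μ := vol ω₀)
    (F := fun τ x => u x * (G (moment ω₀ ρ₀ c (ψ τ) x) *
      ratio ω₀ (detDensity (perturb ω₀ (ψ τ))) x)) (F' := F') ?_ hF'c ?_ τ
  -- The pointwise derivative F' is an exact density minus the gradient term, so only the Dirichlet
  -- form survives integration.
  · have hst := stokes D.kahler (D.kahler.isClosedForm.perturb (hψs τ).smooth)
      (hu.mul (isSmooth_comp_moment D c hG (hψs τ).smooth)) hv.smooth
    simp only [ratio_exactDensity_mul_comp_moment D c hG (hψs τ) hv.smooth hu] at hst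
    have hs : Continuous fun x : X => (τ, x) := by fun_prop
    have hQc : Continuous fun x => G (moment ω₀ ρ₀ c (ψ τ) x) *
        ratio ω₀ (traceDensity (perturb ω₀ (ψ τ)) (gradForm v u)) x := by
      refine (hG.continuous.comp (hm.comp hs)).mul ?_
      have h := (continuous_ratio_trace_comb D.kahler hφ.smooth hv.smooth
        (isPullback_gradForm hu hv.smooth)
        fun e he z hz i j => continuousAt_gradForm hu hv.smooth he hz i j).comp (hi.comp hs)
      exact h
    have hF's : Continuous (F' τ) := by
      have h := hF'c.comp hs
      exact h
    change (∫ x, F' τ x + G (moment ω₀ ρ₀ c (ψ τ) x) *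
      ratio ω₀ (traceDensity (perturb ω₀ (ψ τ)) (gradForm v u)) x ∂(vol ω₀)) = 0 at hst
    rw [integral_add (integrable_of_continuous D.kahler hF's)
      (integrable_of_continuous D.kahler hQc)] at hst
    have : (∫ x, F' τ x ∂(vol ω₀)) = -gDirichlet ω₀ ρ₀ c G (ψ τ) v u := eq_neg_of_add_eq_zero_left hst
    rw [this] at key
    exact key
  · intro τ
    have hs : Continuous fun x : X => (τ, x) := by fun_prop
    have h1 := hdet.comp hs
    have h2 := hG.continuous.comp (hm.comp hs)
    have h3 := hu.continuous.mul (h2.mul h1)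
    exact h3
  · intro τ x
    have h1 := hasDerivAt_ratio_det ω₀ hφ.smooth hv.smooth a τ x
    have h2 : HasDerivAt (fun τ => moment ω₀ ρ₀ c (ψ τ) x) (fun α => genDeriv v α x) τ := by
      refine hasDerivAt_pi.2 fun α => ?_
      simp only [hψ, moment_comb D c hφ.smooth hv.smooth]
      simpa using ((hasDerivAt_id τ).mul_const (genDeriv v α x)).const_add
        (moment ω₀ ρ₀ c (fun _ => 0) x α + a * genDeriv φ α x)
    have h3 := (hG.differentiable (by simp) (moment ω₀ ρ₀ c (ψ τ) x)).hasFDerivAt.comp_hasDerivAt τ h2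
    exact (h3.mul h1).const_mul (u x)

/-- Exchanging u and v conjugates the Hermitian pairing, and only the real part is kept. This
symmetry makes the one-form defining E_g closed. -/
theorem traceDensity_gradForm_comm {h : CoeffForm n X} (H : IsClosedForm h) (u v : X → ℝ)
    {e : OpenPartialHomeomorph X (Fin n → ℂ)} (he : e ∈ atlas (Fin n → ℂ) X)
    {z : Fin n → ℂ} (hz : z ∈ e.target) :
    traceDensity h (gradForm v u) e z = traceDensity h (gradForm u v) e z := by
  have hA : ∀ i j, (h e z).adjugate i j = star ((h e z).adjugate j i) := fun i j =>
    ((H.hermitian e he z hz).adjugate.apply i j).symm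
  simp only [traceDensity, trace_adjugate_mul_eq_sum]
  rw [← Complex.conj_re, map_sum, Finset.sum_comm]
  simp only [map_sum]
  rw [Finset.sum_comm, Finset.sum_comm]
  congr 1
  refine Finset.sum_congr rfl fun i _ => Finset.sum_congr rfl fun j _ => ?_
  rw [hA]
  simp only [gradForm, Matrix.of_apply, Complex.star_def, map_mul, Complex.conj_conj]
  ring

theorem gDirichlet_comm (D : TorusKahler r ω₀ ρ₀) (c : Fin r → ℝ)
    (G : (Fin r → ℝ) → ℝ) {φ : X → ℝ} (hφ : IsSmooth n φ) (u v : X → ℝ) :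
    gDirichlet ω₀ ρ₀ c G φ v u = gDirichlet ω₀ ρ₀ c G φ u v := by
  refine integral_congr_ae (Filter.Eventually.of_forall fun x => ?_)
  simp only [ratio]
  rw [traceDensity_gradForm_comm (D.kahler.isClosedForm.perturb hφ) u v (chart_mem_atlas _ x)
    (mem_chart_target _ x)]

theorem gDirichlet_nonneg (c : Fin r → ℝ) {G : (Fin r → ℝ) → ℝ} {φ : X → ℝ}
    (hω₀ : IsKahlerForm ω₀) (hp : IsPositive (perturb ω₀ φ))
    (hG : ∀ x, 0 ≤ G (moment ω₀ ρ₀ c φ x)) (v : X → ℝ) : 0 ≤ gDirichlet ω₀ ρ₀ c G φ v v := by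
  refine integral_nonneg fun x => mul_nonneg (hG x) (div_nonneg ?_ ?_)
  · exact traceDensity_gradForm_nonneg hp v (chart_mem_atlas _ x) (mem_chart_target _ x)
  · exact (PosDef_det_re_pos (hω₀.positive _ (chart_mem_atlas _ x) _ (mem_chart_target _ x))).le

end Variation

/-- A function smooth near a compact set agrees on it with a globally smooth function. -/
theorem exists_contDiff_eqOn {E : Type*} [NormedAddCommGroup E] [NormedSpace ℝ E]
    [FiniteDimensional ℝ E] {K U : Set E} (hK : IsCompact K) (hU : IsOpen U) (hKU : K ⊆ U)
    {g : E → ℝ} (hg : ContDiffOn ℝ ∞ g U) : ∃ G : E → ℝ, ContDiff ℝ ∞ G ∧ EqOn G g K := by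
  obtain ⟨f, hf0, hf1, -⟩ := exists_contMDiffMap_zero_one_nhds_of_isClosed (n := ⊤) 𝓘(ℝ, E)
    hU.isClosed_compl hK.isClosed (disjoint_compl_left_iff_subset.2 hKU)
  have hfs : ContDiff ℝ ∞ f := contMDiff_iff_contDiff.1 f.contMDiff
  refine ⟨fun x => f x * g x, contDiff_iff_contDiffAt.2 fun x => ?_, fun x hx => ?_⟩
  · by_cases hx : x ∈ U
    · exact hfs.contDiffAt.mul (hg.contDiffAt (hU.mem_nhds hx))
    · have h0 : (fun x => f x * g x) =ᶠ[nhds x] fun _ => 0 := by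
        have := hf0.filter_mono (nhds_le_nhdsSet (show x ∈ Uᶜ from hx))
        filter_upwards [this] with y hy
        rw [hy, zero_mul]
      exact contDiffAt_const.congr_of_eventuallyEq h0
  · have := (hf1.self_of_nhdsSet x hx)
    simp only [this, one_mul]

/-! ### The moment map, its image and its behaviour under translation -/

section Moment

variable {n r : ℕ} {X : Type*} [TopologicalSpace X] [ChartedSpace (Fin n → ℂ) X]
  [IsManifold 𝓘(ℂ, Fin n → ℂ) ω X] [MulAction (Fin r → ℂˣ) X] [MeasurableSpace X]
  [BorelSpace X] [CompactSpace X] [T2Space X] [ConnectedSpace X]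
  {ω₀ : CoeffForm n X} {ρ₀ : X → ℝ}

theorem totalVol_pos (hω₀ : IsKahlerForm ω₀) : 0 < totalVol ω₀ := by
  have := isFiniteMeasure_vol hω₀.isClosedForm
  have := isOpenPosMeasure_vol hω₀.isClosedForm hω₀.positive
  have h : (vol ω₀) univ ≠ 0 := isOpen_univ.measure_ne_zero _ univ_nonempty
  exact ENNReal.toReal_pos h (measure_ne_top _ _)

/-- The averages of the Hamilton functions of `ω₀`. -/
def momentShift (ω₀ : CoeffForm n X) (ρ₀ : X → ℝ) (α : Fin r) : ℝ :=
  (totalVol ω₀)⁻¹ * ∫ x, ham ω₀ ρ₀ (fun _ => 0) α x ∂(vol ω₀)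

theorem isPotential_zero (D : TorusKahler r ω₀ ρ₀) : IsPotential r ω₀ fun _ => 0 :=
  ⟨isSmooth_const 0, by rw [perturb_zero]; exact D.kahler.positive, fun _ _ => rfl⟩

theorem gWeight_eq_integral (D : TorusKahler r ω₀ ρ₀) (c : Fin r → ℝ) (G : (Fin r → ℝ) → ℝ)
    {φ : X → ℝ} (hφ : IsPotential r ω₀ φ) (u : X → ℝ) :
    gWeight ω₀ ρ₀ c G φ u = ∫ x, u x * G (moment ω₀ ρ₀ c φ x) ∂(vol (perturb ω₀ φ)) := by
  rw [integral_vol D.kahler (D.kahler.isClosedForm.perturb hφ.smooth) hφ.positive, gWeight]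
  simp only [mul_assoc]

theorem gDirichlet_one (c : Fin r → ℝ) (G : (Fin r → ℝ) → ℝ) (φ v : X → ℝ) :
    gDirichlet ω₀ ρ₀ c G φ v (fun _ => 1) = 0 := by
  refine integral_eq_zero_of_ae (Filter.Eventually.of_forall fun x => ?_)
  simp [ratio, traceDensity, gradForm, wd, Matrix.trace, Matrix.mul_apply]

/-- The push-forward of `ω_φⁿ` under the moment map does not depend on `φ`. -/
theorem gWeight_one (D : TorusKahler r ω₀ ρ₀) (c : Fin r → ℝ) {G : (Fin r → ℝ) → ℝ}
    (hG : ContDiff ℝ ∞ G) {φ : X → ℝ} (hφ : IsSmoothInvariant n r φ) :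
    gWeight ω₀ ρ₀ c G φ (fun _ => 1) = gWeight ω₀ ρ₀ c G (fun _ => 0) fun _ => 1 := by
  have h := fun τ => hasDerivAt_gWeight D c hG (isSmoothInvariant_const (n := n) (r := r) (X := X) 0)
    hφ (isSmooth_const (1 : ℝ)) 0 τ
  simp only [gDirichlet_one, neg_zero] at h
  -- Along the segment τφ from 0 to φ the derivative is a Dirichlet form paired with a constant,
  -- hence zero.
  have := is_const_of_deriv_eq_zero (fun τ => (h τ).differentiableAt) (fun τ => (h τ).deriv) 1 0
  simpa using this

/-- Taking G to be a coordinate function shows that the mean of θ_α does not depend on φ, so one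
shift, fixed by ω₀, normalizes the Hamilton functions of every ω_φ. -/
theorem isHamiltonian_moment (D : TorusKahler r ω₀ ρ₀) {φ : X → ℝ} (hφ : IsPotential r ω₀ φ)
    (α : Fin r) :
    IsHamiltonian (perturb ω₀ φ) α fun x => moment ω₀ ρ₀ (momentShift ω₀ ρ₀) φ x α where
  smooth := (isSmooth_ham D hφ.smooth α).sub (isSmooth_const _)
  eq e he z hz j := by
    rw [dzbar_ham D hφ.isSmoothInvariant he hz]
    simp only [dzbar, moment, Complex.ofReal_sub, fderiv_sub_const]
  normalized := by
    have hG : ContDiff ℝ ∞ fun p : Fin r → ℝ => p α := contDiff_apply ℝ ℝ α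
    have h1 := gWeight_one D (momentShift ω₀ ρ₀) hG hφ.isSmoothInvariant
    rw [gWeight_eq_integral D _ _ hφ, gWeight_eq_integral D _ _ (isPotential_zero D),
      perturb_zero] at h1
    simp only [one_mul] at h1
    rw [h1]
    simp only [moment]
    have := isFiniteMeasure_vol D.kahler.isClosedForm
    rw [integral_sub (integrable_of_continuous D.kahler
      (isSmooth_ham D (isSmooth_const 0) α).continuous) (integrable_const _), integral_const,
      momentShift, smul_eq_mul]
    have hV := (totalVol_pos D.kahler).ne'
    change _ - totalVol ω₀ * _ = 0
    rw [mul_inv_cancel_left₀ hV, sub_self]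

theorem IsHamiltonian.unique {φ : X → ℝ} (hω₀ : IsKahlerForm ω₀) (hφ : IsPotential r ω₀ φ)
    {α : Fin r} {θ θ' : X → ℝ} (h : IsHamiltonian (perturb ω₀ φ) α θ)
    (h' : IsHamiltonian (perturb ω₀ φ) α θ') : θ = θ' := by
  have hcl := hω₀.isClosedForm.perturb hφ.smooth
  have := isFiniteMeasure_vol hcl
  have := isOpenPosMeasure_vol hcl hφ.positive
  have hconst := IsSmooth.eq_of_wd_eq_zero (h.smooth.sub h'.smooth) (fun e he z hz i => by
    have h1 := (h.smooth.contDiffAt he hz).differentiableAt (by simp)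
    have h2 := (h'.smooth.contDiffAt he hz).differentiableAt (by simp)
    have h3 := (h.eq e he z hz i).symm.trans (h'.eq e he z hz i)
    rw [dzbar_ofReal h1, dzbar_ofReal h2] at h3
    have h4 := star_injective h3
    have h5 : wd (fun w => θ (e.symm w) - θ' (e.symm w)) z (Pi.single i 1) =
        wd (fun w => θ (e.symm w)) z (Pi.single i 1) -
          wd (fun w => θ' (e.symm w)) z (Pi.single i 1) := by
      simp only [wd, fderiv_fun_sub h1 h2, sub_apply]
      push_cast; ring
    rw [h5, h4, sub_self])
  ext x
  have hint : ∀ f : X → ℝ, IsSmooth n f → Integrable f (vol (perturb ω₀ φ)) := fun f hf =>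
    hf.continuous.integrable_of_hasCompactSupport (HasCompactSupport.of_compactSpace f)
  have h6 : ∫ y, (θ y - θ' y) ∂(vol (perturb ω₀ φ)) = 0 := by
    rw [integral_sub (hint _ h.smooth) (hint _ h'.smooth), h.normalized, h'.normalized, sub_zero]
  simp only [fun y => hconst y x, integral_const, smul_eq_mul] at h6
  have hpos : (vol (perturb ω₀ φ)).real univ ≠ 0 :=
    (ENNReal.toReal_pos (isOpen_univ.measure_ne_zero _ univ_nonempty) (measure_ne_top _ _)).ne'
  exact sub_eq_zero.1 ((mul_eq_zero.1 h6).resolve_left hpos)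

/-- Normalized Hamilton functions are unique, so the arbitrary choice in `momentMap` is the explicit
one. -/
theorem momentMap_perturb (D : TorusKahler r ω₀ ρ₀) {φ : X → ℝ} (hφ : IsPotential r ω₀ φ) (x : X) :
    momentMap r (perturb ω₀ φ) x = moment ω₀ ρ₀ (momentShift ω₀ ρ₀) φ x := by
  ext α
  have h := isHamiltonian_moment D hφ α
  have h' := Classical.epsilon_spec (p := fun θ : X → ℝ => IsHamiltonian (perturb ω₀ φ) α θ) ⟨_, h⟩
  exact congrFun (h'.unique D.kahler hφ h) x

theorem momentMap_base (D : TorusKahler r ω₀ ρ₀) (x : X) :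
    momentMap r ω₀ x = moment ω₀ ρ₀ (momentShift ω₀ ρ₀) (fun _ => 0) x := by
  rw [← momentMap_perturb D (isPotential_zero D), perturb_zero]

theorem continuous_moment (D : TorusKahler r ω₀ ρ₀) (c : Fin r → ℝ) {φ : X → ℝ}
    (hφ : IsSmooth n φ) : Continuous (moment ω₀ ρ₀ c φ) :=
  continuous_pi fun α => (isSmooth_ham D hφ α).continuous.sub continuous_const

theorem isCompact_momentPolytope (D : TorusKahler r ω₀ ρ₀) : IsCompact (momentPolytope r ω₀) := by
  have : momentMap r ω₀ = moment ω₀ ρ₀ (momentShift ω₀ ρ₀) (fun _ => 0) := funext (momentMap_base D)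
  rw [momentPolytope, this]
  exact isCompact_range (continuous_moment D _ (isSmooth_const 0))

/-- The push-forward of ω_φⁿ is independent of φ. A bump function at a value outside the image for
ω₀ would have integral zero for ω₀ but a positive one for ω_φ. -/
theorem moment_mem_momentPolytope (D : TorusKahler r ω₀ ρ₀) {φ : X → ℝ} (hφ : IsPotential r ω₀ φ)
    (x : X) : moment ω₀ ρ₀ (momentShift ω₀ ρ₀) φ x ∈ momentPolytope r ω₀ := by
  by_contra hx
  set c : Fin r → ℝ := momentShift ω₀ ρ₀
  set p := moment ω₀ ρ₀ c φ x
  obtain ⟨G, hGsupp, -, hGs, hGrange, hGp⟩ := exists_contDiff_tsupport_subset (n := ⊤)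
    ((isCompact_momentPolytope D).isClosed.isOpen_compl.mem_nhds hx)
  have hcl := D.kahler.isClosedForm.perturb hφ.smooth
  have := isFiniteMeasure_vol hcl
  have := isOpenPosMeasure_vol hcl hφ.positive
  have h1 := gWeight_one D c hGs hφ.isSmoothInvariant
  rw [gWeight_eq_integral D _ _ hφ, gWeight_eq_integral D _ _ (isPotential_zero D)] at h1
  have h0 : ∀ y, G (moment ω₀ ρ₀ c (fun _ => 0) y) = 0 := fun y => by
    by_contra hne
    have h2 := hGsupp (subset_tsupport _ hne)
    exact h2 ⟨y, momentMap_base D y⟩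
  simp only [h0, one_mul, integral_zero] at h1
  have hpos := Continuous.integral_pos_of_hasCompactSupport_nonneg_nonzero
    (μ := vol (perturb ω₀ φ)) (f := fun y => G (moment ω₀ ρ₀ c φ y)) (x := x)
    (hGs.continuous.comp (continuous_moment D c hφ.smooth)) (HasCompactSupport.of_compactSpace _)
    (fun y => (hGrange (mem_range_self _)).1) (by change G p ≠ 0; rw [hGp]; exact one_ne_zero)
  exact hpos.ne' h1

theorem moment_translate (D : TorusKahler r ω₀ ρ₀) (c : Fin r → ℝ) (φ : X → ℝ) (σ : Fin r → ℂˣ)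
    (x : X) : moment ω₀ ρ₀ c (translate ω₀ ρ₀ σ φ) x = moment ω₀ ρ₀ c φ (σ • x) := by
  ext α
  simp only [moment, ham_translate D]

theorem integral_translate (D : TorusKahler r ω₀ ρ₀) {φ : X → ℝ} (hφ : IsSmooth n φ)
    (σ : Fin r → ℂˣ) (f : X → ℝ) :
    ∫ x, f (σ • x) ∂(vol (perturb ω₀ (translate ω₀ ρ₀ σ φ))) = ∫ x, f x ∂(vol (perturb ω₀ φ)) :=
  integral_vol_pullback (σ := torusHomeo D.act σ) (D.act.isHolo σ)
    (D.kahler.isClosedForm.perturb hφ).compatible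
    (D.kahler.isClosedForm.perturb (isSmooth_translate D.act D.kahler D.ricci hφ σ)).compatible
    (isPullback_translate D.act D.kahler D.ricci hφ σ) f

theorem gWeight_translate (D : TorusKahler r ω₀ ρ₀) (c : Fin r → ℝ) (G : (Fin r → ℝ) → ℝ)
    {φ : X → ℝ} (hφ : IsPotential r ω₀ φ) (σ : Fin r → ℂˣ) (u : X → ℝ) :
    gWeight ω₀ ρ₀ c G (translate ω₀ ρ₀ σ φ) (fun x => u (σ • x)) = gWeight ω₀ ρ₀ c G φ u := by
  rw [gWeight_eq_integral D _ _ hφ, gWeight_eq_integral D _ _ (isPotential_translate D hφ σ)]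
  simp only [moment_translate D]
  exact integral_translate D hφ.smooth σ fun x => u x * G (moment ω₀ ρ₀ c φ x)

end Moment

/-- The radial primitive of a closed one-form `A da + B db` on the plane. -/
theorem hasDerivAt_integral_radial {A B P Q : ℝ × ℝ → ℝ} (cA : Continuous A) (cB : Continuous B)
    (cP : Continuous P) (cQ : Continuous Q)
    (hA : ∀ s τ, HasDerivAt (fun τ => A (s, τ)) (-P (s, τ)) τ)
    (hB : ∀ s τ, HasDerivAt (fun τ => B (s, τ)) (-Q (s, τ)) τ)
    (hC : ∀ s b, HasDerivAt (fun s => B (s, s * b)) (-(P (s, s * b) + b * Q (s, s * b))) s)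
    (b : ℝ) :
    HasDerivAt (fun b => ∫ s in (0 : ℝ)..1, (A (s, s * b) + b * B (s, s * b))) (B (1, b)) b := by
  set F : ℝ → ℝ → ℝ := fun b s => A (s, s * b) + b * B (s, s * b) with hF
  set F' : ℝ → ℝ → ℝ := fun b s => -P (s, s * b) * s + (B (s, s * b) + b * (-Q (s, s * b) * s))
    with hF'
  have hFc : ∀ b, Continuous (F b) := fun b => by
    simp only [hF]; fun_prop
  have hF'c : Continuous (Function.uncurry F') := by
    have : Function.uncurry F' = fun q : ℝ × ℝ => -P (q.2, q.2 * q.1) * q.2 +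
      (B (q.2, q.2 * q.1) + q.1 * (-Q (q.2, q.2 * q.1) * q.2)) := rfl
    rw [this]; fun_prop
  have hFd : ∀ b s, HasDerivAt (fun b => F b s) (F' b s) b := by
    intro b s
    have h0 : HasDerivAt (fun b : ℝ => s * b) s b := by
      simpa using (hasDerivAt_id b).const_mul s
    have h1 : HasDerivAt (fun b => A (s, s * b)) (-P (s, s * b) * s) b := (hA s (s * b)).comp b h0
    have h2 : HasDerivAt (fun b => B (s, s * b)) (-Q (s, s * b) * s) b := (hB s (s * b)).comp b h0
    have h3 := h1.add ((hasDerivAt_id' b).mul h2)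
    rw [one_mul] at h3
    exact h3
  have key := hasDerivAt_setIntegral_of_continuous (μ := volume.restrict (Icc (0 : ℝ) 1))
    isCompact_Icc (measurableSet_Icc (a := (0 : ℝ)) (b := 1)) hFc hF'c hFd b
  rw [Measure.restrict_restrict measurableSet_Icc, inter_self] at key
  -- Closedness of the one-form: the b-derivative of the integrand is the total s-derivative of
  -- s·B(s, sb), so the integral telescopes to B(1, b).
  have hW2 : ∀ s, HasDerivAt (fun s => s * B (s, s * b)) (F' b s) s := by
    intro s
    refine ((hasDerivAt_id' s).mul (hC s b)).congr_deriv ?_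
    simp only [hF']
    ring
  have hval : (∫ s in Icc (0 : ℝ) 1, F' b s) = B (1, b) := by
    rw [integral_Icc_eq_integral_Ioc, ← intervalIntegral.integral_of_le zero_le_one,
      intervalIntegral.integral_eq_sub_of_hasDerivAt (fun s _ => hW2 s)]
    · simp
    · have : Continuous (F' b) := hF'c.comp (continuous_const.prodMk continuous_id)
      exact this.intervalIntegrable _ _
  rw [hval] at key
  simp only [intervalIntegral.integral_of_le zero_le_one, ← integral_Icc_eq_integral_Ioc]
  exact key

/-! ### The weighted energy: first variation, concavity, behaviour under translation -/

section Energy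

variable {n r : ℕ} {X : Type*} [TopologicalSpace X] [ChartedSpace (Fin n → ℂ) X]
  [IsManifold 𝓘(ℂ, Fin n → ℂ) ω X] [MulAction (Fin r → ℂˣ) X] [MeasurableSpace X]
  [BorelSpace X] [CompactSpace X] [T2Space X] [ConnectedSpace X]
  {ω₀ : CoeffForm n X} {ρ₀ : X → ℝ}

/-- `V E_g(φ)`. -/
def gEnergy (ω₀ : CoeffForm n X) (ρ₀ : X → ℝ) (c : Fin r → ℝ) (G : (Fin r → ℝ) → ℝ)
    (φ : X → ℝ) : ℝ :=
  ∫ s in (0 : ℝ)..1, gWeight ω₀ ρ₀ c G (fun x => s * φ x) φ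

theorem gWeight_add_mul (D : TorusKahler r ω₀ ρ₀) (c : Fin r → ℝ) {G : (Fin r → ℝ) → ℝ}
    (hG : Continuous G) {ψ u w : X → ℝ} (hψ : IsSmooth n ψ) (hu : Continuous u) (hw : Continuous w)
    (b : ℝ) : gWeight ω₀ ρ₀ c G ψ (fun x => u x + b * w x) =
      gWeight ω₀ ρ₀ c G ψ u + b * gWeight ω₀ ρ₀ c G ψ w := by
  have hk : Continuous fun x => G (moment ω₀ ρ₀ c ψ x) * ratio ω₀ (detDensity (perturb ω₀ ψ)) x :=
    (hG.comp (continuous_moment D c hψ)).mul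
      ((D.kahler.isClosedForm.perturb hψ).continuous_ratio_det D.kahler)
  simp only [gWeight]
  have hi1 : Integrable (fun x => u x * (G (moment ω₀ ρ₀ c ψ x) *
      ratio ω₀ (detDensity (perturb ω₀ ψ)) x)) (vol ω₀) :=
    integrable_of_continuous D.kahler (hu.mul hk)
  have hi2 : Integrable (fun x => w x * (G (moment ω₀ ρ₀ c ψ x) *
      ratio ω₀ (detDensity (perturb ω₀ ψ)) x)) (vol ω₀) :=
    integrable_of_continuous D.kahler (hw.mul hk)
  rw [← integral_const_mul, ← integral_add hi1 (hi2.const_mul b)]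
  exact integral_congr_ae (Filter.Eventually.of_forall fun x => by simp only; ring)

/-- Inherited from linearity of the weighted integral by uniqueness of derivatives, since the
Dirichlet form is minus its first variation. -/
theorem gDirichlet_add_mul (D : TorusKahler r ω₀ ρ₀) (c : Fin r → ℝ) {G : (Fin r → ℝ) → ℝ}
    (hG : ContDiff ℝ ∞ G) {ψ v u w : X → ℝ} (hψ : IsSmoothInvariant n r ψ)
    (hv : IsSmoothInvariant n r v) (hu : IsSmooth n u) (hw : IsSmooth n w) (b : ℝ) :
    gDirichlet ω₀ ρ₀ c G ψ v (fun x => u x + b * w x) =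
      gDirichlet ω₀ ρ₀ c G ψ v u + b * gDirichlet ω₀ ρ₀ c G ψ v w := by
  have h1 := hasDerivAt_gWeight D c hG hψ hv (hu.add ((isSmooth_const b).mul hw)) 1 0
  have h2 := (hasDerivAt_gWeight D c hG hψ hv hu 1 0).add
    ((hasDerivAt_gWeight D c hG hψ hv hw 1 0).const_mul b)
  have h3 : (fun τ => gWeight ω₀ ρ₀ c G (fun x => 1 * ψ x + τ * v x) fun x => u x + b * w x) =
      (fun τ => gWeight ω₀ ρ₀ c G (fun x => 1 * ψ x + τ * v x) u) +
        fun τ => b * gWeight ω₀ ρ₀ c G (fun x => 1 * ψ x + τ * v x) w := by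
    ext τ
    exact gWeight_add_mul D c hG.continuous (hψ.comb hv 1 τ).smooth hu.continuous hw.continuous b
  rw [h3] at h1
  have h4 := h1.unique h2
  simp only [one_mul, zero_mul, add_zero] at h4
  linarith

/-- The radial integral is a primitive of u ↦ ∫ u G(μ_φ) ω_φⁿ because this one-form is closed, which
is the symmetry of the Dirichlet form. Differences of energy can then be computed along any segment.
-/
theorem hasDerivAt_gEnergy (D : TorusKahler r ω₀ ρ₀) (c : Fin r → ℝ) {G : (Fin r → ℝ) → ℝ}
    (hG : ContDiff ℝ ∞ G) {φ v : X → ℝ} (hφ : IsSmoothInvariant n r φ)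
    (hv : IsSmoothInvariant n r v) (b : ℝ) :
    HasDerivAt (fun b => gEnergy ω₀ ρ₀ c G fun x => φ x + b * v x)
      (gWeight ω₀ ρ₀ c G (fun x => φ x + b * v x) v) b := by
  set Wφ : ℝ × ℝ → ℝ := fun p => gWeight ω₀ ρ₀ c G (fun x => p.1 * φ x + p.2 * v x) φ with hWφ
  set Wv : ℝ × ℝ → ℝ := fun p => gWeight ω₀ ρ₀ c G (fun x => p.1 * φ x + p.2 * v x) v with hWv
  set Qφ : ℝ × ℝ → ℝ := fun p => gDirichlet ω₀ ρ₀ c G (fun x => p.1 * φ x + p.2 * v x) v φ with hQφ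
  set Qv : ℝ × ℝ → ℝ := fun p => gDirichlet ω₀ ρ₀ c G (fun x => p.1 * φ x + p.2 * v x) v v with hQv
  have cWφ : Continuous Wφ := continuous_gWeight_comb D c hG hφ.smooth hv.smooth hφ.smooth.continuous
  have cWv : Continuous Wv := continuous_gWeight_comb D c hG hφ.smooth hv.smooth hv.smooth.continuous
  have cQφ : Continuous Qφ :=
    continuous_gDirichlet_comb D c hG hφ.smooth hv.smooth hφ.smooth hv.smooth
  have cQv : Continuous Qv :=
    continuous_gDirichlet_comb D c hG hφ.smooth hv.smooth hv.smooth hv.smooth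
  have hfam : ∀ s b : ℝ, (fun x => s * (φ x + b * v x)) = fun x => s * φ x + (s * b) * v x :=
    fun s b => by ext x; ring
  have hE : (fun b => gEnergy ω₀ ρ₀ c G fun x => φ x + b * v x) =
      fun b => ∫ s in (0 : ℝ)..1, (Wφ (s, s * b) + b * Wv (s, s * b)) := by
    ext b
    rw [gEnergy]
    congr 1
    ext s
    rw [hfam]
    exact gWeight_add_mul D c hG.continuous (hφ.comb hv _ _).smooth hφ.smooth.continuous
      hv.smooth.continuous b
  have hC : ∀ s b, HasDerivAt (fun s => Wv (s, s * b))
      (-(Qφ (s, s * b) + b * Qv (s, s * b))) s := by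
    intro s b
    have h1 := hasDerivAt_gWeight D c hG (isSmoothInvariant_const (n := n) (r := r) (X := X) 0)
      (hφ.add (hv.const_mul b)) hv.smooth 0 s
    have h2 : ∀ s : ℝ, (fun x : X => 0 * (0 : ℝ) + s * (φ x + b * v x)) =
        fun x => s * φ x + (s * b) * v x := fun s => by ext x; ring
    simp only [h2] at h1
    rw [gDirichlet_comm D c G (hφ.comb hv _ _).smooth, gDirichlet_add_mul D c hG (hφ.comb hv _ _) hv
      hφ.smooth hv.smooth] at h1
    exact h1
  have key := hasDerivAt_integral_radial cWφ cWv cQφ cQv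
    (fun s τ => hasDerivAt_gWeight D c hG hφ hv hφ.smooth s τ)
    (fun s τ => hasDerivAt_gWeight D c hG hφ hv hv.smooth s τ) hC b
  have h1 : Wv (1, b) = gWeight ω₀ ρ₀ c G (fun x => φ x + b * v x) v := by simp [hWv]
  rw [hE, ← h1]
  exact key

theorem continuous_gWeight_line (D : TorusKahler r ω₀ ρ₀) (c : Fin r → ℝ) {G : (Fin r → ℝ) → ℝ}
    (hG : ContDiff ℝ ∞ G) {φ v u : X → ℝ} (hφ : IsSmooth n φ) (hv : IsSmooth n v)
    (hu : Continuous u) :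
    Continuous fun b : ℝ => gWeight ω₀ ρ₀ c G (fun x => φ x + b * v x) u := by
  have h := (continuous_gWeight_comb D c hG hφ hv hu).comp
    (continuous_const.prodMk continuous_id : Continuous fun b : ℝ => ((1 : ℝ), b))
  simpa [Function.comp_def] using h

theorem gEnergy_sub (D : TorusKahler r ω₀ ρ₀) (c : Fin r → ℝ) {G : (Fin r → ℝ) → ℝ}
    (hG : ContDiff ℝ ∞ G) {φ v : X → ℝ} (hφ : IsSmoothInvariant n r φ)
    (hv : IsSmoothInvariant n r v) :
    (gEnergy ω₀ ρ₀ c G fun x => φ x + v x) - gEnergy ω₀ ρ₀ c G φ =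
      ∫ b in (0 : ℝ)..1, gWeight ω₀ ρ₀ c G (fun x => φ x + b * v x) v := by
  rw [intervalIntegral.integral_eq_sub_of_hasDerivAt (fun b _ => hasDerivAt_gEnergy D c hG hφ hv b)]
  · simp
  · exact (continuous_gWeight_line D c hG hφ.smooth hv.smooth hv.smooth.continuous).intervalIntegrable
      _ _

theorem isPotential_segment {φ ψ : X → ℝ} (hφ : IsPotential r ω₀ φ) (hψ : IsPotential r ω₀ ψ)
    {b : ℝ} (hb : b ∈ Icc (0 : ℝ) 1) : IsPotential r ω₀ fun x => φ x + b * (ψ x - φ x) := by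
  have hs := hφ.isSmoothInvariant.add
    ((hψ.isSmoothInvariant.sub hφ.isSmoothInvariant).const_mul b)
  refine ⟨hs.smooth, fun e he z hz => ?_, hs.invariant⟩
  have h1 : perturb ω₀ (fun x => φ x + b * (ψ x - φ x)) e z =
      ((1 - b : ℝ) : ℂ) • perturb ω₀ φ e z + ((b : ℝ) : ℂ) • perturb ω₀ ψ e z := by
    have : (fun x => φ x + b * (ψ x - φ x)) = fun x => (1 - b) * φ x + b * ψ x := by ext x; ring
    rw [this]
    simp only [perturb]
    rw [ddbar_comb hφ.smooth hψ.smooth _ _ he hz]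
    push_cast
    module
  rw [h1]
  rcases eq_or_lt_of_le hb.2 with h | h
  · subst h; simpa using hψ.positive e he z hz
  · refine Matrix.PosDef.add_posSemidef ((hφ.positive e he z hz).smul ?_)
      ((hψ.positive e he z hz).posSemidef.smul ?_)
    · exact_mod_cast sub_pos.2 h
    · exact_mod_cast hb.1

theorem isPotential_smul (D : TorusKahler r ω₀ ρ₀) {φ : X → ℝ} (hφ : IsPotential r ω₀ φ)
    {s : ℝ} (hs : s ∈ Icc (0 : ℝ) 1) : IsPotential r ω₀ fun x => s * φ x := by
  simpa using isPotential_segment (isPotential_zero D) hφ hs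

/-- Concavity of the energy. -/
theorem gEnergy_sub_le (D : TorusKahler r ω₀ ρ₀) (c : Fin r → ℝ) {G : (Fin r → ℝ) → ℝ}
    (hG : ContDiff ℝ ∞ G)
    (hpos : ∀ φ : X → ℝ, IsPotential r ω₀ φ → ∀ x, 0 ≤ G (moment ω₀ ρ₀ c φ x)) {φ ψ : X → ℝ}
    (hφ : IsPotential r ω₀ φ) (hψ : IsPotential r ω₀ ψ) :
    gEnergy ω₀ ρ₀ c G ψ - gEnergy ω₀ ρ₀ c G φ ≤ gWeight ω₀ ρ₀ c G φ fun x => ψ x - φ x := by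
  have hv := hψ.isSmoothInvariant.sub hφ.isSmoothInvariant
  have h1 := gEnergy_sub D c hG hφ.isSmoothInvariant hv
  simp only [add_sub_cancel] at h1
  rw [h1]
  have hd : ∀ b, HasDerivAt (fun b => gWeight ω₀ ρ₀ c G (fun x => φ x + b * (ψ x - φ x))
      fun x => ψ x - φ x) (-gDirichlet ω₀ ρ₀ c G (fun x => φ x + b * (ψ x - φ x))
        (fun x => ψ x - φ x) fun x => ψ x - φ x) b := fun b => by
    simpa using hasDerivAt_gWeight D c hG hφ.isSmoothInvariant hv hv.smooth 1 b
  have hcont := continuous_gWeight_line D c hG hφ.smooth hv.smooth hv.smooth.continuous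
  -- The derivative of the energy along the segment is antitone, its own derivative being minus a
  -- nonnegative Dirichlet form; so it is at most its value at φ.
  have hanti := antitoneOn_of_deriv_nonpos (convex_Icc (0 : ℝ) 1) hcont.continuousOn
    (fun b _ => (hd b).differentiableAt.differentiableWithinAt) (fun b hb => by
      rw [(hd b).deriv, neg_nonpos]
      have hp := isPotential_segment hφ hψ (interior_subset hb)
      exact gDirichlet_nonneg c D.kahler hp.positive (hpos _ hp) _)
  have h2 := intervalIntegral.integral_mono_on (μ := volume) (a := (0 : ℝ)) (b := 1) zero_le_one
    (hcont.intervalIntegrable _ _) (intervalIntegrable_const (c := gWeight ω₀ ρ₀ c G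
      (fun x => φ x + 0 * (ψ x - φ x)) fun x => ψ x - φ x))
    (fun b hb => hanti (left_mem_Icc.2 zero_le_one) hb hb.1)
  simpa using h2

/-- The energy difference between σ[0] and σ[φ] is computed along b ↦ σ[bφ], whose velocity is φ∘σ.
Pulling each integral back by σ gives the integral that defines the energy of φ. -/
theorem gEnergy_translate (D : TorusKahler r ω₀ ρ₀) (c : Fin r → ℝ) {G : (Fin r → ℝ) → ℝ}
    (hG : ContDiff ℝ ∞ G) {φ : X → ℝ} (hφ : IsPotential r ω₀ φ) (σ : Fin r → ℂˣ) :
    gEnergy ω₀ ρ₀ c G (translate ω₀ ρ₀ σ φ) =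
      gEnergy ω₀ ρ₀ c G φ + gEnergy ω₀ ρ₀ c G (translate ω₀ ρ₀ σ fun _ => 0) := by
  have h0 := isPotential_translate D (isPotential_zero D) σ
  have hφσ := isPotential_translate D hφ σ
  have hv : IsSmoothInvariant n r fun x => φ (σ • x) := by
    have := hφσ.isSmoothInvariant.sub h0.isSmoothInvariant
    simpa [translate] using this
  have h1 := gEnergy_sub D c hG h0.isSmoothInvariant hv
  have h2 : (fun x => translate ω₀ ρ₀ σ (fun _ => 0) x + φ (σ • x)) = translate ω₀ ρ₀ σ φ := by
    ext x; simp only [translate]; ring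
  rw [h2] at h1
  have h3 : (∫ b in (0 : ℝ)..1, gWeight ω₀ ρ₀ c G
      (fun x => translate ω₀ ρ₀ σ (fun _ => 0) x + b * φ (σ • x)) fun x => φ (σ • x)) =
        gEnergy ω₀ ρ₀ c G φ := by
    refine intervalIntegral.integral_congr fun b hb => ?_
    rw [uIcc_of_le zero_le_one] at hb
    have h4 : (fun x => translate ω₀ ρ₀ σ (fun _ => 0) x + b * φ (σ • x)) =
        translate ω₀ ρ₀ σ fun x => b * φ x := by
      ext x; simp only [translate]; ring
    rw [h4]
    exact gWeight_translate D c G (isPotential_smul D hφ hb) σ φ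
  linarith

theorem gEnergy_translate_mul (D : TorusKahler r ω₀ ρ₀) (c : Fin r → ℝ) {G : (Fin r → ℝ) → ℝ}
    (hG : ContDiff ℝ ∞ G) (σ τ : Fin r → ℂˣ) :
    gEnergy ω₀ ρ₀ c G (translate ω₀ ρ₀ (σ * τ) fun _ => 0) =
      gEnergy ω₀ ρ₀ c G (translate ω₀ ρ₀ σ fun _ => 0) +
        gEnergy ω₀ ρ₀ c G (translate ω₀ ρ₀ τ fun _ => 0) := by
  rw [translate_mul D.act D.kahler, gEnergy_translate D c hG
    (isPotential_translate D (isPotential_zero D) σ)]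

/-! ### The entropy -/

/-- The factors 1/V cancel in the Radon–Nikodym derivative, leaving ω_φⁿ/ω₀ⁿ. -/
theorem entropy_measureMA (D : TorusKahler r ω₀ ρ₀) {φ : X → ℝ} (hφ : IsPotential r ω₀ φ) :
    entropy (measureMA ω₀ φ) (measureMA ω₀ 0) = (totalVol ω₀)⁻¹ *
      ∫ x, Real.log (ratio ω₀ (detDensity (perturb ω₀ φ)) x) ∂(vol (perturb ω₀ φ)) := by
  have hcl := D.kahler.isClosedForm.perturb hφ.smooth
  have := isFiniteMeasure_vol D.kahler.isClosedForm
  have hV := inv_pos.2 (totalVol_pos D.kahler)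
  have h0 : measureMA ω₀ 0 = ENNReal.ofReal (totalVol ω₀)⁻¹ • vol ω₀ := by
    have : perturb ω₀ (0 : X → ℝ) = ω₀ := perturb_zero ω₀
    rw [measureMA, this]
  have : IsFiniteMeasure (measureMA ω₀ 0) := by
    rw [h0]; exact Measure.smul_finite _ ENNReal.ofReal_ne_top
  have hm : Measurable fun x => ENNReal.ofReal (ratio ω₀ (detDensity (perturb ω₀ φ)) x) :=
    (hcl.continuous_ratio_det D.kahler).measurable.ennreal_ofReal
  have h1 : measureMA ω₀ φ = (measureMA ω₀ 0).withDensity fun x =>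
      ENNReal.ofReal (ratio ω₀ (detDensity (perturb ω₀ φ)) x) := by
    rw [h0, withDensity_smul_measure, ← vol_eq_withDensity D.kahler hcl, measureMA]
  have h2 : llr (measureMA ω₀ φ) (measureMA ω₀ 0) =ᵐ[measureMA ω₀ φ] fun x =>
      Real.log (ratio ω₀ (detDensity (perturb ω₀ φ)) x) := by
    have hac : measureMA ω₀ φ ≪ measureMA ω₀ 0 := by
      rw [h1]; exact withDensity_absolutelyContinuous _ _
    refine hac.ae_le ?_
    have := Measure.rnDeriv_withDensity (measureMA ω₀ 0) hm
    rw [← h1] at this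
    filter_upwards [this] with x hx
    rw [llr, hx, ENNReal.toReal_ofReal (ratio_det_pos D.kahler hφ.positive x).le]
  rw [entropy, integral_congr_ae h2, measureMA, integral_smul_measure,
    ENNReal.toReal_ofReal hV.le, smul_eq_mul]

/-- Both sides are the logarithm of ω_φⁿ divided by e^{-φ}Ω, and translation pulls back numerator
and denominator alike. -/
theorem log_ratio_translate (D : TorusKahler r ω₀ ρ₀) {φ : X → ℝ} (hφ : IsPotential r ω₀ φ)
    (σ : Fin r → ℂˣ) (x : X) :
    Real.log (ratio ω₀ (detDensity (perturb ω₀ (translate ω₀ ρ₀ σ φ))) x) +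
        translate ω₀ ρ₀ σ φ x - ρ₀ x =
      Real.log (ratio ω₀ (detDensity (perturb ω₀ φ)) (σ • x)) + φ (σ • x) - ρ₀ (σ • x) := by
  set e := chartAt (Fin n → ℂ) x
  have he : e ∈ atlas (Fin n → ℂ) X := chart_mem_atlas _ _
  have hx : x ∈ e.source := mem_chart_source _ _
  have hex : e.symm (e x) = x := e.left_inv hx
  have hz := e.map_source hx
  set e' := chartAt (Fin n → ℂ) (σ • x)
  have he' : e' ∈ atlas (Fin n → ℂ) X := chart_mem_atlas _ _
  have hx' : σ • x ∈ e'.source := mem_chart_source _ _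
  have hz' : σ • e.symm (e x) ∈ e'.source := by rwa [hex]
  have h1 := ratio_pullback_det D.act D.kahler σ he he' hz hz'
  have h2 := (isPullback_translate D.act D.kahler D.ricci hφ.smooth σ).densityPullback_det
    e he e' he' (e x) hz hz'
  have h3 : ratio ω₀ (detDensity (perturb ω₀ (translate ω₀ ρ₀ σ φ))) x =
      ratio ω₀ (pullbackDensity (fun x => σ • x) (detDensity ω₀)) x *
        ratio ω₀ (detDensity (perturb ω₀ φ)) (σ • x) := by
    rw [hex] at h1 h2
    rw [h1]
    change detDensity (perturb ω₀ (translate ω₀ ρ₀ σ φ)) e (e x) / (ω₀ e (e x)).det.re =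
      _ * (detDensity (perturb ω₀ φ) e' (e' (σ • x)) / (ω₀ e' (e' (σ • x))).det.re)
    rw [h2]
    have hp := PosDef_det_re_pos (D.kahler.positive e' he' _ (e'.map_source hx'))
    field_simp
  have hpos := ratio_det_pos D.kahler (isPotential_translate D hφ σ).positive x
  have hpos' := ratio_det_pos D.kahler hφ.positive (σ • x)
  rw [h3] at hpos
  have hpos'' : 0 < ratio ω₀ (pullbackDensity (fun x => σ • x) (detDensity ω₀)) x :=
    pos_of_mul_pos_left hpos hpos'.le
  rw [h3, Real.log_mul hpos''.ne' hpos'.ne', translate, logCocycle]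
  ring

end Energy

/-! ### The functionals of the theorem in terms of weighted integrals -/

section Functionals

variable {n r : ℕ} {X : Type*} [TopologicalSpace X] [ChartedSpace (Fin n → ℂ) X]
  [IsManifold 𝓘(ℂ, Fin n → ℂ) ω X] [MulAction (Fin r → ℂˣ) X] [MeasurableSpace X]
  [BorelSpace X] [CompactSpace X] [T2Space X] [ConnectedSpace X]
  {ω₀ : CoeffForm n X} {ρ₀ : X → ℝ} {g G : (Fin r → ℝ) → ℝ}

theorem gIntegral_eq_gWeight (D : TorusKahler r ω₀ ρ₀) (hGg : EqOn G g (momentPolytope r ω₀))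
    {φ : X → ℝ} (hφ : IsPotential r ω₀ φ) (f : X → ℝ) :
    gIntegral r ω₀ g φ f = gWeight ω₀ ρ₀ (momentShift ω₀ ρ₀) G φ f := by
  rw [gWeight_eq_integral D _ _ hφ, gIntegral]
  refine integral_congr_ae (Filter.Eventually.of_forall fun x => ?_)
  simp only [momentMap_perturb D hφ, hGg (moment_mem_momentPolytope D hφ x)]

theorem integral_base_eq_gWeight (D : TorusKahler r ω₀ ρ₀) (hGg : EqOn G g (momentPolytope r ω₀))
    (f : X → ℝ) : ∫ x, f x * g (momentMap r ω₀ x) ∂(vol ω₀) =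
      gWeight ω₀ ρ₀ (momentShift ω₀ ρ₀) G (fun _ => 0) f := by
  rw [← gIntegral_eq_gWeight D hGg (isPotential_zero D), gIntegral, perturb_zero]

theorem energyG_eq_gEnergy (D : TorusKahler r ω₀ ρ₀) (hGg : EqOn G g (momentPolytope r ω₀))
    {φ : X → ℝ} (hφ : IsPotential r ω₀ φ) :
    energyG r ω₀ g φ = (totalVol ω₀)⁻¹ * gEnergy ω₀ ρ₀ (momentShift ω₀ ρ₀) G φ := by
  rw [energyG, gEnergy, ← intervalIntegral.integral_const_mul]
  refine intervalIntegral.integral_congr fun s hs => ?_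
  rw [uIcc_of_le zero_le_one] at hs
  rw [gIntegral_eq_gWeight D hGg (isPotential_smul D hφ hs)]

theorem functionalI_sub_functionalJ (D : TorusKahler r ω₀ ρ₀)
    (hGg : EqOn G g (momentPolytope r ω₀)) {φ : X → ℝ} (hφ : IsPotential r ω₀ φ) :
    functionalI r ω₀ g φ - functionalJ r ω₀ g φ = (totalVol ω₀)⁻¹ *
      (gEnergy ω₀ ρ₀ (momentShift ω₀ ρ₀) G φ - gWeight ω₀ ρ₀ (momentShift ω₀ ρ₀) G φ φ) := by
  rw [functionalI, functionalJ, gIntegral_eq_gWeight D hGg hφ, energyG_eq_gEnergy D hGg hφ]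
  ring

theorem gWeight_one_eq_totalVol (D : TorusKahler r ω₀ ρ₀) (hG : ContDiff ℝ ∞ G)
    (hGg : EqOn G g (momentPolytope r ω₀))
    (hnorm : ∫ x, (g (momentMap r ω₀ x) - 1) ∂(vol ω₀) = 0) {φ : X → ℝ}
    (hφ : IsSmoothInvariant n r φ) :
    gWeight ω₀ ρ₀ (momentShift ω₀ ρ₀) G φ (fun _ => 1) = totalVol ω₀ := by
  have := isFiniteMeasure_vol D.kahler.isClosedForm
  rw [gWeight_one D _ hG hφ, ← integral_base_eq_gWeight D hGg]
  have hc : Continuous fun x => g (momentMap r ω₀ x) := by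
    have : (fun x => g (momentMap r ω₀ x)) =
        fun x => G (moment ω₀ ρ₀ (momentShift ω₀ ρ₀) (fun _ => 0) x) := by
      ext x
      rw [← momentMap_base D, hGg (mem_range_self x)]
    rw [this]
    exact hG.continuous.comp (continuous_moment D _ (isSmooth_const 0))
  rw [integral_sub (integrable_of_continuous D.kahler hc) (integrable_const _), integral_const,
    smul_eq_mul, mul_one, sub_eq_zero] at hnorm
  simp only [one_mul]
  exact hnorm

/-- The functional `I_g - J_g` does not see additive constants. -/
theorem gEnergy_sub_gWeight_add_const (D : TorusKahler r ω₀ ρ₀) (hG : ContDiff ℝ ∞ G)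
    (hGg : EqOn G g (momentPolytope r ω₀))
    (hnorm : ∫ x, (g (momentMap r ω₀ x) - 1) ∂(vol ω₀) = 0) {ψ : X → ℝ}
    (hψ : IsSmoothInvariant n r ψ) (k : ℝ) :
    (gEnergy ω₀ ρ₀ (momentShift ω₀ ρ₀) G fun x => ψ x + k) -
        (gWeight ω₀ ρ₀ (momentShift ω₀ ρ₀) G (fun x => ψ x + k) fun x => ψ x + k) =
      gEnergy ω₀ ρ₀ (momentShift ω₀ ρ₀) G ψ - gWeight ω₀ ρ₀ (momentShift ω₀ ρ₀) G ψ ψ := by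
  set c : Fin r → ℝ := momentShift ω₀ ρ₀
  have hk := isSmoothInvariant_const (n := n) (r := r) (X := X) k
  have h1 : IsSmoothInvariant n r fun _ : X => (1 : ℝ) := isSmoothInvariant_const 1
  have hlin : ∀ χ u : X → ℝ, IsSmoothInvariant n r χ → Continuous u →
      gWeight ω₀ ρ₀ c G χ (fun x => u x + k) = gWeight ω₀ ρ₀ c G χ u + k * totalVol ω₀ := by
    intro χ u hχ hu
    have := gWeight_add_mul D c hG.continuous hχ.smooth hu
      (continuous_const : Continuous fun _ : X => (1 : ℝ)) k
    rw [gWeight_one_eq_totalVol D hG hGg hnorm hχ] at this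
    simpa using this
  have hE := gEnergy_sub D c hG hψ hk
  have h2 : ∀ b : ℝ, gWeight ω₀ ρ₀ c G (fun x => ψ x + b * k) (fun _ => k) = k * totalVol ω₀ := by
    intro b
    have := hlin _ (fun _ => 0) (hψ.add (hk.const_mul b)) continuous_const
    have h0 : gWeight ω₀ ρ₀ c G (fun x => ψ x + b * k) (fun _ => 0) = 0 := by simp [gWeight]
    rw [h0] at this
    simpa using this
  simp only [h2, intervalIntegral.integral_const, sub_zero, one_smul] at hE
  -- Moving the potential by a constant does not change the weighted volume: the variation pairs
  -- with the gradient of a constant.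
  have h3 : gWeight ω₀ ρ₀ c G (fun x => ψ x + k) ψ = gWeight ω₀ ρ₀ c G ψ ψ := by
    have hd := fun τ => hasDerivAt_gWeight D c hG hψ h1 hψ.smooth 1 τ
    have hz : ∀ τ : ℝ, gDirichlet ω₀ ρ₀ c G (fun x => 1 * ψ x + τ * 1) (fun _ => 1) ψ = 0 := fun τ => by
      rw [gDirichlet_comm D c G (hψ.comb h1 1 τ).smooth]
      exact gDirichlet_one _ _ _ _
    simp only [hz, neg_zero] at hd
    have := is_const_of_deriv_eq_zero (fun τ => (hd τ).differentiableAt) (fun τ => (hd τ).deriv) k 0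
    simpa using this
  rw [hlin _ ψ (hψ.add hk) hψ.smooth.continuous, h3]
  linarith

/-- The unweighted energy cancels, and the remaining terms apart from E_g assemble into one
integrand that is equivariant under translation. -/
theorem mabuchiG_eq (D : TorusKahler r ω₀ ρ₀) (hGg : EqOn G g (momentPolytope r ω₀))
    {φ : X → ℝ} (hφ : IsPotential r ω₀ φ) :
    mabuchiG ω₀ r g ρ₀ φ = (totalVol ω₀)⁻¹ *
      ((∫ x, (Real.log (ratio ω₀ (detDensity (perturb ω₀ φ)) x) + φ x - ρ₀ x)
        ∂(vol (perturb ω₀ φ))) + (∫ x, ρ₀ x ∂(vol ω₀)) -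
        gEnergy ω₀ ρ₀ (momentShift ω₀ ρ₀) G φ) := by
  have hcl := D.kahler.isClosedForm.perturb hφ.smooth
  have := isFiniteMeasure_vol hcl
  have hint : ∀ f : X → ℝ, Continuous f → Integrable f (vol (perturb ω₀ φ)) := fun f hf =>
    hf.integrable_of_hasCompactSupport (HasCompactSupport.of_compactSpace f)
  have hlog : Continuous fun x => Real.log (ratio ω₀ (detDensity (perturb ω₀ φ)) x) :=
    (hcl.continuous_ratio_det D.kahler).log fun x => (ratio_det_pos D.kahler hφ.positive x).ne'
  have hsum : Continuous fun x => Real.log (ratio ω₀ (detDensity (perturb ω₀ φ)) x) + φ x :=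
    hlog.add hφ.smooth.continuous
  rw [integral_sub (hint _ hsum) (hint _ D.ricci.smooth.continuous),
    integral_add (hint _ hlog) (hint _ hφ.smooth.continuous), mabuchiG, mabuchi,
    entropy_measureMA D hφ, energyG_eq_gEnergy D hGg hφ]
  ring

theorem mabuchiG_translate (D : TorusKahler r ω₀ ρ₀) (hG : ContDiff ℝ ∞ G)
    (hGg : EqOn G g (momentPolytope r ω₀)) {φ : X → ℝ} (hφ : IsPotential r ω₀ φ)
    (σ : Fin r → ℂˣ) :
    mabuchiG ω₀ r g ρ₀ (translate ω₀ ρ₀ σ φ) = mabuchiG ω₀ r g ρ₀ φ - (totalVol ω₀)⁻¹ *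
      gEnergy ω₀ ρ₀ (momentShift ω₀ ρ₀) G (translate ω₀ ρ₀ σ fun _ => 0) := by
  rw [mabuchiG_eq D hGg hφ, mabuchiG_eq D hGg (isPotential_translate D hφ σ),
    gEnergy_translate D _ hG hφ]
  simp only [log_ratio_translate D hφ]
  rw [integral_translate D hφ.smooth σ fun x =>
    Real.log (ratio ω₀ (detDensity (perturb ω₀ φ)) x) + φ x - ρ₀ x]
  ring

/-- If the `g`-Mabuchi functional is bounded below, then the energy is invariant. -/
theorem gEnergy_translate_zero (D : TorusKahler r ω₀ ρ₀) (hG : ContDiff ℝ ∞ G)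
    (hGg : EqOn G g (momentPolytope r ω₀))
    (hM : ∃ C : ℝ, ∀ φ : X → ℝ, IsPotential r ω₀ φ → C ≤ mabuchiG ω₀ r g ρ₀ φ) (σ : Fin r → ℂˣ) :
    gEnergy ω₀ ρ₀ (momentShift ω₀ ρ₀) G (translate ω₀ ρ₀ σ fun _ => 0) = 0 := by
  obtain ⟨C, hC⟩ := hM
  set E : (Fin r → ℂˣ) → ℝ := fun σ =>
    gEnergy ω₀ ρ₀ (momentShift ω₀ ρ₀) G (translate ω₀ ρ₀ σ fun _ => 0) with hE
  have hmul : ∀ σ τ, E (σ * τ) = E σ + E τ := fun σ τ => gEnergy_translate_mul D _ hG σ τ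
  have hone : E 1 = 0 := by
    have := hmul 1 1
    rw [mul_one] at this
    linarith
  have hpow : ∀ σ (k : ℕ), E (σ ^ k) = k * E σ := by
    intro σ k
    induction k with
    | zero => simp [hone]
    | succ k ih => rw [pow_succ, hmul, ih]; push_cast; ring
  have hV := inv_pos.2 (totalVol_pos D.kahler)
  -- If E σ > 0, the value of M_g at σᵏ[0] is M_g(0) - k E(σ)/V, which falls below any bound as k
  -- grows. Applying the inequality to σ⁻¹ gives equality.
  have hle : ∀ σ, E σ ≤ 0 := by
    intro σ
    by_contra hσ
    push Not at hσ
    obtain ⟨k, hk⟩ := exists_nat_gt ((mabuchiG ω₀ r g ρ₀ (fun _ => 0) - C) /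
      ((totalVol ω₀)⁻¹ * E σ))
    rw [div_lt_iff₀ (mul_pos hV hσ)] at hk
    have h1 := hC _ (isPotential_translate D (isPotential_zero D) (σ ^ k))
    rw [mabuchiG_translate D hG hGg (isPotential_zero D)] at h1
    change C ≤ _ - _ * E (σ ^ k) at h1
    rw [hpow] at h1
    nlinarith
  have h1 := hmul σ σ⁻¹
  rw [mul_inv_cancel, hone] at h1
  exact le_antisymm (hle σ) (by linarith [hle σ⁻¹])

end Functionals

/-! ### One-parameter groups and change of variables for Ω -/

section Flow

variable {n r : ℕ} {X : Type*} [TopologicalSpace X] [ChartedSpace (Fin n → ℂ) X]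
  [IsManifold 𝓘(ℂ, Fin n → ℂ) ω X] [MulAction (Fin r → ℂˣ) X] [MeasurableSpace X]
  [BorelSpace X] [CompactSpace X] [T2Space X] [ConnectedSpace X]
  {ω₀ : CoeffForm n X} {ρ₀ : X → ℝ}

/-- The derivative at `s = 0` of `exp(s a)[φ]`. -/
def flowDeriv (ω₀ : CoeffForm n X) (ρ₀ : X → ℝ) (φ : X → ℝ) (a : Fin r → ℂ) (x : X) : ℝ :=
  deriv (fun s : ℝ => translate ω₀ ρ₀ (torusExp (s • a)) φ x) 0

theorem isSmooth_flowDeriv (D : TorusKahler r ω₀ ρ₀) {φ : X → ℝ} (hφ : IsSmooth n φ)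
    (a : Fin r → ℂ) : IsSmooth n (flowDeriv ω₀ ρ₀ φ a) := by
  refine isSmooth_of_contDiffAt fun e he z hz => ?_
  refine (contDiffAt_fderiv_slice (contDiffAt_translateChart D hφ he 0 hz)
    (a, 0)).congr_of_eventuallyEq ?_
  filter_upwards [e.open_target.mem_nhds hz] with y hy
  rw [flowDeriv, (hasDerivAt_translate D hφ he hy a 0).deriv, zero_smul]

/-- By the action law, the derivative at time s is the one at time 0 evaluated at the moved point.
This makes it jointly continuous in s and x, as differentiation under the integral requires. -/
theorem hasDerivAt_translate_flow (D : TorusKahler r ω₀ ρ₀) {φ : X → ℝ} (hφ : IsSmooth n φ)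
    (a : Fin r → ℂ) (x : X) (s : ℝ) :
    HasDerivAt (fun s : ℝ => translate ω₀ ρ₀ (torusExp (s • a)) φ x)
      (flowDeriv ω₀ ρ₀ φ a (torusExp (s • a) • x)) s := by
  have h0 : ∀ y, HasDerivAt (fun s : ℝ => translate ω₀ ρ₀ (torusExp (s • a)) φ y)
      (flowDeriv ω₀ ρ₀ φ a y) 0 := by
    intro y
    set e := chartAt (Fin n → ℂ) y
    have he : e ∈ atlas (Fin n → ℂ) X := chart_mem_atlas _ _
    have hy : y ∈ e.source := mem_chart_source _ _
    have := hasDerivAt_translate D hφ he (e.map_source hy) a 0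
    rw [e.left_inv hy] at this
    exact this.differentiableAt.hasDerivAt
  have h1 := (h0 (torusExp (s • a) • x)).sub_const (logCocycle ω₀ ρ₀ (torusExp (s • a)) x)
  have h2 : (fun s' : ℝ => translate ω₀ ρ₀ (torusExp (s' • a)) φ x) = fun s' =>
      (fun t : ℝ => translate ω₀ ρ₀ (torusExp (t • a)) φ (torusExp (s • a) • x) -
        logCocycle ω₀ ρ₀ (torusExp (s • a)) x) (s' - s) := by
    ext s'
    have : torusExp (s' • a) = torusExp ((s' - s) • a) * torusExp (s • a) := by
      rw [← torusExp_add, ← add_smul, sub_add_cancel]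
    rw [this, translate_mul D.act D.kahler]
    rfl
  rw [h2]
  rw [← sub_self s] at h1
  exact h1.comp_sub_const s s

theorem hasDerivAt_integral_translate (D : TorusKahler r ω₀ ρ₀) {φ k : X → ℝ} (hφ : IsSmooth n φ)
    (hk : Continuous k) (a : Fin r → ℂ) :
    HasDerivAt (fun s : ℝ => ∫ x, translate ω₀ ρ₀ (torusExp (s • a)) φ x * k x ∂(vol ω₀))
      (∫ x, flowDeriv ω₀ ρ₀ φ a x * k x ∂(vol ω₀)) 0 := by
  have := isFiniteMeasure_vol D.kahler.isClosedForm
  have hflow : Continuous fun q : ℝ × X => torusExp (q.1 • a) • q.2 := by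
    have h := D.act.continuous_smul.comp
      ((continuous_fst.smul continuous_const).prodMk continuous_snd :
        Continuous fun q : ℝ × X => (q.1 • a, q.2))
    exact h
  have key := hasDerivAt_integral_of_continuous (μ := vol ω₀)
    (F := fun s x => translate ω₀ ρ₀ (torusExp (s • a)) φ x * k x)
    (F' := fun s x => flowDeriv ω₀ ρ₀ φ a (torusExp (s • a) • x) * k x)
    (fun s => (isSmooth_translate D.act D.kahler D.ricci hφ _).continuous.mul hk) ?_
    (fun s x => (hasDerivAt_translate_flow D hφ a x s).mul_const (k x)) 0
  · simpa only [zero_smul, torusExp_zero, one_smul] using key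
  · have h := (isSmooth_flowDeriv D hφ a).continuous.comp hflow
    exact h.mul (hk.comp continuous_snd)

/-- The concave function `s ↦ log (σ^*Ω/Ω)`, `σ = exp(s b)`, lies below its tangent at `0`. -/
theorem logCocycle_le_neg_flowDeriv (D : TorusKahler r ω₀ ρ₀) (b : Fin r → ℝ) (x : X) :
    logCocycle ω₀ ρ₀ (torusExp fun α => (b α : ℂ)) x ≤
      -flowDeriv ω₀ ρ₀ (fun _ => 0) (fun α => (b α : ℂ)) x := by
  have h1 := (hasDerivAt_translate_flow D (isSmooth_const (0 : ℝ)) (fun α => (b α : ℂ)) x 0).neg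
  have h2 : -(fun s : ℝ => translate ω₀ ρ₀ (torusExp (s • fun α => (b α : ℂ))) (fun _ => 0) x) =
      fun s : ℝ => logCocycle ω₀ ρ₀ (torusExp (s • fun α => (b α : ℂ))) x := by
    ext s; simp [translate]
  rw [h2, zero_smul, torusExp_zero, one_smul] at h1
  -- The chord from 0 to 1 starts at height 0, so its slope is the value of the cocycle at time 1.
  have h3 := (concaveOn_logCocycle D b x).slope_le_of_hasDerivAt (mem_univ 0) (mem_univ 1)
    zero_lt_one h1
  simpa [slope_def_field, torusExp_zero, logCocycle_one D.act D.kahler] using h3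

/-- Change of variables for `Ω = e^{ρ₀} ω₀ⁿ`. -/
theorem integral_exp_logCocycle (D : TorusKahler r ω₀ ρ₀) (σ : Fin r → ℂˣ) (f : X → ℝ) :
    ∫ x, f (σ • x) * Real.exp (logCocycle ω₀ ρ₀ σ x + ρ₀ x) ∂(vol ω₀) =
      ∫ x, f x * Real.exp (ρ₀ x) ∂(vol ω₀) := by
  have h0 := isPotential_zero D
  have hσ := isPotential_translate D h0 σ
  have h1 := integral_translate D h0.smooth σ fun x => f x * Real.exp (ρ₀ x)
  rw [perturb_zero, integral_vol D.kahler (D.kahler.isClosedForm.perturb hσ.smooth) hσ.positive] at h1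
  rw [← h1]
  refine integral_congr_ae (Filter.Eventually.of_forall fun x => ?_)
  have h2 := log_ratio_translate D h0 σ x
  have h3 : ratio ω₀ (detDensity ω₀) (σ • x) = 1 :=
    div_self (PosDef_det_re_pos (D.kahler.positive _ (chart_mem_atlas _ _) _
      (mem_chart_target _ _))).ne'
  rw [perturb_zero, h3, Real.log_one] at h2
  have hpos := ratio_det_pos D.kahler hσ.positive x
  have h4 : ratio ω₀ (detDensity (perturb ω₀ (translate ω₀ ρ₀ σ fun _ => 0))) x =
      Real.exp (logCocycle ω₀ ρ₀ σ x + ρ₀ x - ρ₀ (σ • x)) := by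
    rw [← Real.exp_log hpos]
    congr 1
    simp only [translate] at h2 ⊢
    linarith
  simp only [h4]
  rw [mul_assoc, ← Real.exp_add]
  congr 2
  ring

end Flow

/-! ### The two inequalities for the cocycle and the sign of its mean -/

section Minimum

variable {n r : ℕ} {X : Type*} [TopologicalSpace X] [ChartedSpace (Fin n → ℂ) X]
  [IsManifold 𝓘(ℂ, Fin n → ℂ) ω X] [MulAction (Fin r → ℂˣ) X] [MeasurableSpace X]
  [BorelSpace X] [CompactSpace X] [T2Space X] [ConnectedSpace X]
  {ω₀ : CoeffForm n X} {ρ₀ : X → ℝ} {g G : (Fin r → ℝ) → ℝ}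

theorem SolvesContinuity.weight_eq (D : TorusKahler r ω₀ ρ₀)
    (hGg : EqOn G g (momentPolytope r ω₀)) {t : ℝ} {φ : X → ℝ}
    (hφ : SolvesContinuity ω₀ r g ρ₀ t φ) (x : X) :
    G (moment ω₀ ρ₀ (momentShift ω₀ ρ₀) φ x) * ratio ω₀ (detDensity (perturb ω₀ φ)) x =
      Real.exp (-t * φ x + ρ₀ x) := by
  set e := chartAt (Fin n → ℂ) x
  have he : e ∈ atlas (Fin n → ℂ) X := chart_mem_atlas _ _
  have hx : x ∈ e.source := mem_chart_source _ _
  have h := hφ.eq e he (e x) (e.map_source hx)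
  rw [e.left_inv hx, momentMap_perturb D hφ.potential,
    ← hGg (moment_mem_momentPolytope D hφ.potential x)] at h
  have hp := PosDef_det_re_pos (D.kahler.positive e he _ (e.map_source hx))
  change _ * ((perturb ω₀ φ e (e x)).det.re / (ω₀ e (e x)).det.re) = _
  rw [← mul_div_assoc, h, mul_div_assoc, div_self hp.ne', mul_one]

theorem SolvesContinuity.gWeight_eq (D : TorusKahler r ω₀ ρ₀)
    (hGg : EqOn G g (momentPolytope r ω₀)) {t : ℝ} {φ : X → ℝ}
    (hφ : SolvesContinuity ω₀ r g ρ₀ t φ) (u : X → ℝ) :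
    gWeight ω₀ ρ₀ (momentShift ω₀ ρ₀) G φ u =
      ∫ x, u x * Real.exp (-t * φ x + ρ₀ x) ∂(vol ω₀) := by
  simp only [gWeight, hφ.weight_eq D hGg]

theorem continuous_logCocycle (D : TorusKahler r ω₀ ρ₀) (σ : Fin r → ℂˣ) :
    Continuous (logCocycle ω₀ ρ₀ σ) := by
  have h := (isSmooth_translate D.act D.kahler D.ricci (isSmooth_const (0 : ℝ)) σ).continuous.neg
  have h1 : -translate ω₀ ρ₀ σ (fun _ => (0 : ℝ)) = logCocycle ω₀ ρ₀ σ := by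
    ext x; simp [translate]
  exact h1 ▸ h

/-- Jensen's inequality for the change of variables by `σ`. -/
theorem integral_logCocycle_le_mul (D : TorusKahler r ω₀ ρ₀) {t : ℝ} {φ : X → ℝ}
    (hφ : IsSmooth n φ) (σ : Fin r → ℂˣ) :
    ∫ x, logCocycle ω₀ ρ₀ σ x * Real.exp (-t * φ x + ρ₀ x) ∂(vol ω₀) ≤
      t * ∫ x, (φ (σ • x) - φ x) * Real.exp (-t * φ x + ρ₀ x) ∂(vol ω₀) := by
  have hφc := hφ.continuous
  have hρc := D.ricci.smooth.continuous
  have hσc : Continuous fun x : X => φ (σ • x) := hφc.comp (D.act.isHolo σ).continuous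
  have hlc := continuous_logCocycle D σ
  set k : X → ℝ := fun x => Real.exp (-t * φ x + ρ₀ x) with hk
  have hkc : Continuous k := by fun_prop
  have h1 := integral_exp_logCocycle D σ fun x => Real.exp (-t * φ x)
  -- With dm = e^{-tφ}Ω, the left side is the total mass of σ^*dm, since e^{c_σ}Ω = σ^*Ω.
  have h2 : (∫ x, Real.exp (logCocycle ω₀ ρ₀ σ x - t * (φ (σ • x) - φ x)) * k x ∂(vol ω₀)) =
      ∫ x, k x ∂(vol ω₀) := by
    have e1 : ∀ x, Real.exp (logCocycle ω₀ ρ₀ σ x - t * (φ (σ • x) - φ x)) * k x =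
        Real.exp (-t * φ (σ • x)) * Real.exp (logCocycle ω₀ ρ₀ σ x + ρ₀ x) := fun x => by
      simp only [hk]
      rw [← Real.exp_add, ← Real.exp_add]
      congr 1
      ring
    have e2 : ∀ x, k x = Real.exp (-t * φ x) * Real.exp (ρ₀ x) := fun x => by
      simp only [hk]
      rw [← Real.exp_add]
    simp only [e1]
    rw [h1]
    simp only [e2]
  have i1 : Integrable (fun x => logCocycle ω₀ ρ₀ σ x * k x) (vol ω₀) :=
    integrable_of_continuous D.kahler (hlc.mul hkc)
  have i2 : Integrable (fun x => (φ (σ • x) - φ x) * k x) (vol ω₀) :=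
    integrable_of_continuous D.kahler ((hσc.sub hφc).mul hkc)
  have i3 : Integrable k (vol ω₀) := integrable_of_continuous D.kahler hkc
  have i4 : Integrable (fun x => Real.exp (logCocycle ω₀ ρ₀ σ x - t * (φ (σ • x) - φ x)) * k x)
      (vol ω₀) := integrable_of_continuous D.kahler
    ((hlc.sub (continuous_const.mul (hσc.sub hφc))).rexp.mul hkc)
  have i5 : Integrable (fun x => logCocycle ω₀ ρ₀ σ x * k x - t * ((φ (σ • x) - φ x) * k x))
      (vol ω₀) := i1.sub (i2.const_mul t)
  -- Jensen in the form 1 + y ≤ e^y; the masses on the two sides then cancel.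
  have h3 : (∫ x, (logCocycle ω₀ ρ₀ σ x * k x - t * ((φ (σ • x) - φ x) * k x)) + k x ∂(vol ω₀)) ≤
      ∫ x, Real.exp (logCocycle ω₀ ρ₀ σ x - t * (φ (σ • x) - φ x)) * k x ∂(vol ω₀) := by
    refine integral_mono (i5.add i3) i4 fun x => ?_
    have := mul_le_mul_of_nonneg_right
      (Real.add_one_le_exp (logCocycle ω₀ ρ₀ σ x - t * (φ (σ • x) - φ x)))
      (Real.exp_pos (-t * φ x + ρ₀ x)).le
    calc _ = (logCocycle ω₀ ρ₀ σ x - t * (φ (σ • x) - φ x) + 1) * k x := by ring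
      _ ≤ _ := this
  rw [h2, integral_add i5 i3, integral_sub i1 (i2.const_mul t),
    integral_const_mul] at h3
  linarith

/-- The energy is concave and invariant, hence `∫ log (σ^*Ω/Ω) dm ≤ ∫ (φ ∘ σ - φ) dm`. -/
theorem gWeight_logCocycle_le (D : TorusKahler r ω₀ ρ₀) (hG : ContDiff ℝ ∞ G)
    (hGg : EqOn G g (momentPolytope r ω₀)) (hgpos : ∀ p ∈ momentPolytope r ω₀, 0 < g p)
    (hM : ∃ C : ℝ, ∀ φ : X → ℝ, IsPotential r ω₀ φ → C ≤ mabuchiG ω₀ r g ρ₀ φ) {φ : X → ℝ}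
    (hφ : IsPotential r ω₀ φ) (σ : Fin r → ℂˣ) :
    gWeight ω₀ ρ₀ (momentShift ω₀ ρ₀) G φ (logCocycle ω₀ ρ₀ σ) ≤
      gWeight ω₀ ρ₀ (momentShift ω₀ ρ₀) G φ fun x => φ (σ • x) - φ x := by
  have hpos : ∀ ψ : X → ℝ, IsPotential r ω₀ ψ → ∀ x,
      0 ≤ G (moment ω₀ ρ₀ (momentShift ω₀ ρ₀) ψ x) := fun ψ hψ x => by
    have hm := moment_mem_momentPolytope D hψ x
    rw [hGg hm]
    exact (hgpos _ hm).le
  have h1 := gEnergy_sub_le D _ hG hpos hφ (isPotential_translate D hφ σ)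
  -- The energy difference in the concavity inequality is zero, leaving 0 ≤ ∫(σ[φ] - φ) dm.
  rw [gEnergy_translate D _ hG hφ, gEnergy_translate_zero D hG hGg hM, add_zero, sub_self] at h1
  have h2 := gWeight_add_mul D (momentShift ω₀ ρ₀) hG.continuous hφ.smooth
    ((hφ.smooth.continuous.comp (D.act.isHolo σ).continuous).sub hφ.smooth.continuous)
    (continuous_logCocycle D σ) (-1)
  have h3 : (fun x => translate ω₀ ρ₀ σ φ x - φ x) =
      fun x => (φ (σ • x) - φ x) + -1 * logCocycle ω₀ ρ₀ σ x := by
    ext x; simp only [translate]; ring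
  rw [h3] at h1
  have h4 : gWeight ω₀ ρ₀ (momentShift ω₀ ρ₀) G φ
      (fun x => (φ (σ • x) - φ x) + -1 * logCocycle ω₀ ρ₀ σ x) =
    gWeight ω₀ ρ₀ (momentShift ω₀ ρ₀) G φ (fun x => φ (σ • x) - φ x) +
      -1 * gWeight ω₀ ρ₀ (momentShift ω₀ ρ₀) G φ (logCocycle ω₀ ρ₀ σ) := h2
  linarith

/-- If `a ≤ b` and `a ≤ t b` with equality at `0`, `t ≠ 1`, then `a' = 0` at `0`. -/
theorem deriv_eq_zero_of_le_of_le_mul {a b : ℝ → ℝ} {a' b' t : ℝ} (ht : t ≠ 1)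
    (ha : HasDerivAt a a' 0) (hb : HasDerivAt b b' 0) (ha0 : a 0 = 0) (hb0 : b 0 = 0)
    (h1 : ∀ s, a s ≤ b s) (h2 : ∀ s, a s ≤ t * b s) : a' = 0 := by
  have m1 : IsLocalMin (fun s => b s - a s) 0 := Filter.Eventually.of_forall fun s => by
    simp only [ha0, hb0, sub_self]; linarith [h1 s]
  have m2 : IsLocalMin (fun s => t * b s - a s) 0 := Filter.Eventually.of_forall fun s => by
    simp only [ha0, hb0, mul_zero, sub_self]; linarith [h2 s]
  have e1 := m1.hasDerivAt_eq_zero (hb.sub ha)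
  have e2 := m2.hasDerivAt_eq_zero ((hb.const_mul t).sub ha)
  have e3 : (1 - t) * a' = 0 := by
    have : b' = a' := by linarith
    rw [this] at e2
    linarith
  exact (mul_eq_zero.1 e3).resolve_left (sub_ne_zero.2 ht.symm)

theorem SolvesContinuity.integral_logCocycle_real_nonpos (D : TorusKahler r ω₀ ρ₀)
    (hG : ContDiff ℝ ∞ G)
    (hGg : EqOn G g (momentPolytope r ω₀)) (hgpos : ∀ p ∈ momentPolytope r ω₀, 0 < g p)
    (hM : ∃ C : ℝ, ∀ φ : X → ℝ, IsPotential r ω₀ φ → C ≤ mabuchiG ω₀ r g ρ₀ φ) {t : ℝ}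
    (ht : t ≠ 1) {φ : X → ℝ} (hφ : SolvesContinuity ω₀ r g ρ₀ t φ) (b : Fin r → ℝ) :
    gWeight ω₀ ρ₀ (momentShift ω₀ ρ₀) G φ (logCocycle ω₀ ρ₀ (torusExp fun α => (b α : ℂ))) ≤ 0 := by
  have hs := hφ.potential.smooth
  have hφc := hs.continuous
  have hρc := D.ricci.smooth.continuous
  set a : Fin r → ℂ := fun α => (b α : ℂ) with ha
  set k : X → ℝ := fun x => Real.exp (-t * φ x + ρ₀ x) with hk
  have hkc : Continuous k := by fun_prop
  have hgw : ∀ u, gWeight ω₀ ρ₀ (momentShift ω₀ ρ₀) G φ u = ∫ x, u x * k x ∂(vol ω₀) :=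
    hφ.gWeight_eq D hGg
  have hint : ∀ u : X → ℝ, Continuous u → Integrable (fun x => u x * k x) (vol ω₀) := fun u hu =>
    integrable_of_continuous D.kahler (hu.mul hkc)
  have hlc := fun σ : Fin r → ℂˣ => continuous_logCocycle D σ
  have htc := fun σ : Fin r → ℂˣ => (isSmooth_translate D.act D.kahler D.ricci hs σ).continuous
  have d0 := hasDerivAt_integral_translate D (isSmooth_const (0 : ℝ)) hkc a
  have d1 := hasDerivAt_integral_translate D hs hkc a
  have hA : ∀ s : ℝ, (∫ x, logCocycle ω₀ ρ₀ (torusExp (s • a)) x * k x ∂(vol ω₀)) =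
      -∫ x, translate ω₀ ρ₀ (torusExp (s • a)) (fun _ => 0) x * k x ∂(vol ω₀) := fun s => by
    rw [← integral_neg]
    refine integral_congr_ae (Filter.Eventually.of_forall fun x => ?_)
    simp only [translate]; ring
  have hB : ∀ s : ℝ, (∫ x, (φ (torusExp (s • a) • x) - φ x) * k x ∂(vol ω₀)) =
      (∫ x, translate ω₀ ρ₀ (torusExp (s • a)) φ x * k x ∂(vol ω₀)) +
        (∫ x, logCocycle ω₀ ρ₀ (torusExp (s • a)) x * k x ∂(vol ω₀)) -
          ∫ x, φ x * k x ∂(vol ω₀) := fun s => by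
    have i1 := hint _ (htc (torusExp (s • a)))
    have i2 := hint _ (hlc (torusExp (s • a)))
    have i3 : Integrable (fun x => translate ω₀ ρ₀ (torusExp (s • a)) φ x * k x +
      logCocycle ω₀ ρ₀ (torusExp (s • a)) x * k x) (vol ω₀) := i1.add i2
    rw [← integral_add i1 i2, ← integral_sub i3 (hint _ hφc)]
    refine integral_congr_ae (Filter.Eventually.of_forall fun x => ?_)
    simp only [translate]; ring
  have hAd : HasDerivAt (fun s : ℝ => ∫ x, logCocycle ω₀ ρ₀ (torusExp (s • a)) x * k x ∂(vol ω₀))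
      (-∫ x, flowDeriv ω₀ ρ₀ (fun _ => 0) a x * k x ∂(vol ω₀)) 0 := by
    simp only [hA]
    exact d0.neg
  have hBd : HasDerivAt (fun s : ℝ => ∫ x, (φ (torusExp (s • a) • x) - φ x) * k x ∂(vol ω₀))
      ((∫ x, flowDeriv ω₀ ρ₀ φ a x * k x ∂(vol ω₀)) +
        (-∫ x, flowDeriv ω₀ ρ₀ (fun _ => 0) a x * k x ∂(vol ω₀))) 0 := by
    simp only [hB]
    exact (d1.add hAd).sub_const _
  -- A(s) is the mean of the cocycle of exp(sa) and B(s) the mean of φ∘exp(sa) - φ. The hypothesis A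
  -- ≤ B comes from concavity of the energy, A ≤ tB from Jensen.
  have key := deriv_eq_zero_of_le_of_le_mul ht hAd hBd
    (by simp [torusExp_zero, logCocycle_one D.act D.kahler])
    (by simp [torusExp_zero])
    (fun s => by
      rw [← hgw, ← hgw]
      exact gWeight_logCocycle_le D hG hGg hgpos hM hφ.potential _)
    (fun s => integral_logCocycle_le_mul D hs _)
  -- Zero is rewritten as the mean of the initial slopes, which dominate the cocycle pointwise by
  -- concavity.
  rw [hgw, ← key, ← integral_neg]
  have hfc := (isSmooth_flowDeriv D (isSmooth_const (0 : ℝ)) a).continuous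
  refine integral_mono (hint _ (hlc _)) (hint _ hfc).neg fun x => ?_
  have h1 := mul_le_mul_of_nonneg_right (logCocycle_le_neg_flowDeriv D b x)
    (Real.exp_pos (-t * φ x + ρ₀ x)).le
  simp only [neg_mul] at h1 ⊢
  simpa only [hk, neg_mul] using h1

theorem SolvesContinuity.integral_logCocycle_nonpos (D : TorusKahler r ω₀ ρ₀)
    (hG : ContDiff ℝ ∞ G)
    (hGg : EqOn G g (momentPolytope r ω₀)) (hgpos : ∀ p ∈ momentPolytope r ω₀, 0 < g p)
    (hM : ∃ C : ℝ, ∀ φ : X → ℝ, IsPotential r ω₀ φ → C ≤ mabuchiG ω₀ r g ρ₀ φ) {t : ℝ}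
    (ht : t ≠ 1) {φ : X → ℝ} (hφ : SolvesContinuity ω₀ r g ρ₀ t φ) (σ : Fin r → ℂˣ) :
    gWeight ω₀ ρ₀ (momentShift ω₀ ρ₀) G φ (logCocycle ω₀ ρ₀ σ) ≤ 0 := by
  obtain ⟨w, rfl⟩ := torusExp_surjective σ
  -- Polar decomposition of the torus element; the compact factor has trivial cocycle.
  have h1 : torusExp w = compactTorus (fun α => Circle.exp (w α).im) *
      torusExp fun α => ((w α).re : ℂ) := by
    rw [← torusExp_imag, ← torusExp_add]
    congr 1
    ext α
    simp only [Pi.add_apply]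
    rw [add_comm, Complex.re_add_im]
  have h2 : logCocycle ω₀ ρ₀ (torusExp w) = logCocycle ω₀ ρ₀ (torusExp fun α => ((w α).re : ℂ)) := by
    ext x
    rw [h1, logCocycle_mul D.act D.kahler,
      logCocycle_compactTorus D.act D.kahler D.invariant D.ricci, zero_add]
  rw [h2]
  exact hφ.integral_logCocycle_real_nonpos D hG hGg hgpos hM ht fun α => (w α).re

/-- The cocycle identity gives -c_σ = c_{σ⁻¹}∘σ, so σ[φ] = (φ + c_{σ⁻¹})∘σ, and the integral is
transported by σ. -/
theorem gWeight_translate_self (D : TorusKahler r ω₀ ρ₀) (c : Fin r → ℝ) (hG : Continuous G)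
    {φ : X → ℝ} (hφ : IsPotential r ω₀ φ) (σ : Fin r → ℂˣ) :
    gWeight ω₀ ρ₀ c G (translate ω₀ ρ₀ σ φ) (translate ω₀ ρ₀ σ φ) =
      gWeight ω₀ ρ₀ c G φ φ + gWeight ω₀ ρ₀ c G φ (logCocycle ω₀ ρ₀ σ⁻¹) := by
  have h1 : translate ω₀ ρ₀ σ φ = fun x => (fun y => φ y + 1 * logCocycle ω₀ ρ₀ σ⁻¹ y) (σ • x) := by
    ext x
    have h := logCocycle_mul (ρ₀ := ρ₀) D.act D.kahler σ⁻¹ σ x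
    rw [inv_mul_cancel, logCocycle_one D.act D.kahler] at h
    simp only [translate]
    linarith
  conv_lhs => rw [show gWeight ω₀ ρ₀ c G (translate ω₀ ρ₀ σ φ) (translate ω₀ ρ₀ σ φ) =
    gWeight ω₀ ρ₀ c G (translate ω₀ ρ₀ σ φ)
      (fun x => (fun y => φ y + 1 * logCocycle ω₀ ρ₀ σ⁻¹ y) (σ • x)) from congrArg _ h1]
  rw [gWeight_translate D c G hφ σ fun y => φ y + 1 * logCocycle ω₀ ρ₀ σ⁻¹ y,
    gWeight_add_mul D c hG hφ.smooth hφ.smooth.continuous (continuous_logCocycle D σ⁻¹), one_mul]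

/-- Translates are unique up to additive constants. -/
theorem IsTranslate.exists_eq_add_const (hω₀ : IsKahlerForm ω₀) {σ : Fin r → ℂˣ} {φ ψ ψ' : X → ℝ}
    (h : IsTranslate ω₀ σ φ ψ) (h' : IsTranslate ω₀ σ φ ψ') : ∃ k : ℝ, ψ' = fun x => ψ x + k := by
  have hs := h'.potential.smooth.sub h.potential.smooth
  have hz : ∀ e ∈ atlas (Fin n → ℂ) X, ∀ z ∈ e.target,
      (ddbar (fun x => ψ' x - ψ x) : CoeffForm n X) e z = 0 := by
    intro e he z hz
    have h1 := h.eq.unique h'.eq he hz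
    simp only [perturb] at h1
    have h2 := add_left_cancel h1
    have h3 : (fun x => ψ' x - ψ x) = fun x => 1 * ψ' x + -1 * ψ x := by ext x; ring
    rw [h3, ddbar_comb h'.potential.smooth h.potential.smooth _ _ he hz, h2]
    simp
  obtain ⟨x₀⟩ := (inferInstance : Nonempty X)
  refine ⟨ψ' x₀ - ψ x₀, ?_⟩
  ext x
  have := hs.eq_of_ddbar_eq_zero hω₀ hz x x₀
  linarith

end Minimum

end
end GSoliton

theorem proposition4p2 {n r : ℕ} {X : Type*} [TopologicalSpace X] [T2Space X] [CompactSpace X]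
    [ConnectedSpace X] [ChartedSpace (Fin n → ℂ) X] [IsManifold 𝓘(ℂ, Fin n → ℂ) ω X]
    [MeasurableSpace X] [BorelSpace X]
    [MulAction (Fin r → ℂˣ) X] (hact : IsHolomorphicAction r n X)
    (ω₀ : CoeffForm n X) (hω₀ : IsKahlerForm ω₀) (hinv : IsInvariantForm r ω₀)
    (ρ₀ : X → ℝ) (hρ₀ : IsRicciPotential ω₀ ρ₀)
    (g : (Fin r → ℝ) → ℝ)
    (hg : ∃ U : Set (Fin r → ℝ), IsOpen U ∧ momentPolytope r ω₀ ⊆ U ∧ ContDiffOn ℝ ∞ g U)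
    (hgpos : ∀ p ∈ momentPolytope r ω₀, 0 < g p)
    (hgnorm : ∫ x, (g (momentMap r ω₀ x) - 1) ∂(vol ω₀) = 0)
    (hM : ∃ C : ℝ, ∀ φ : X → ℝ, IsPotential r ω₀ φ → C ≤ mabuchiG ω₀ r g ρ₀ φ)
    (t : ℝ) (ht : t ∈ Set.Ico (0 : ℝ) 1)
    (φ : X → ℝ) (hφ : SolvesContinuity ω₀ r g ρ₀ t φ) :
    (∀ σ : Fin r → ℂˣ, ∃ ψ : X → ℝ, IsTranslate ω₀ σ φ ψ) ∧
      IsGLB {a : ℝ | ∃ (σ : Fin r → ℂˣ) (ψ : X → ℝ), IsTranslate ω₀ σ φ ψ ∧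
          a = functionalI r ω₀ g ψ - functionalJ r ω₀ g ψ}
        (functionalI r ω₀ g φ - functionalJ r ω₀ g φ) := by
  have D : TorusKahler r ω₀ ρ₀ := ⟨hact, hω₀, hinv, hρ₀⟩
  have hφp := hφ.potential
  refine ⟨fun σ => ⟨_, isTranslate_translate D hφp σ⟩, IsLeast.isGLB ⟨?_, ?_⟩⟩
  -- The infimum is attained at the identity, where the normalized translate is φ itself.
  · refine ⟨1, φ, ?_, rfl⟩
    have h := isTranslate_translate D hφp 1
    rwa [translate_one hact hω₀] at h
  · rintro _ ⟨σ, ψ, hψ, rfl⟩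
    obtain ⟨U, hU, hPU, hgU⟩ := hg
    -- Only the values of g on P matter, since all moment maps take values there; a global smooth G
    -- allows differentiation without domain conditions.
    obtain ⟨G, hG, hGg⟩ := exists_contDiff_eqOn (isCompact_momentPolytope D) hU hPU hgU
    have hσ := isTranslate_translate D hφp σ
    obtain ⟨k, hk⟩ := hσ.exists_eq_add_const hω₀ hψ
    rw [functionalI_sub_functionalJ D hGg hφp, functionalI_sub_functionalJ D hGg hψ.potential, hk,
      gEnergy_sub_gWeight_add_const D hG hGg hgnorm hσ.potential.isSmoothInvariant,
      gEnergy_translate D _ hG hφp, gEnergy_translate_zero D hG hGg hM,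
      gWeight_translate_self D _ hG.continuous hφp]
    -- After the reductions, V(I_g - J_g) has changed exactly by minus the mean of c_{σ⁻¹}.
    have h1 := hφ.integral_logCocycle_nonpos D hG hGg hgpos hM ht.2.ne σ⁻¹
    refine mul_le_mul_of_nonneg_left ?_ (inv_pos.2 (totalVol_pos hω₀)).le
    linarith
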